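/- Let $G=(V,E)$ be a finite simple undirected graph and, for $v\in V$, let $\mathrm{bc}[v]=\sum_{s\neq v\neq t\in V}\sigma_{st}(v)/\sigma_{st}$ (ordered pairs), where $\sigma_{st}$ is the number of shortest $s$–$t$ paths and $\sigma_{st}(v)$ the number of those passing through $v$ (the quotient is $0$ if $t$ is not reachable from $s$). **States.** A state consists of a finite set of *copies* of vertices of $G$ (each copy $c$ has an original $\mathrm{org}(c)\in V$, a value $\mathrm{reach}(c)$ and a score $\mathrm{bc}'[c]$), and a graph $G'$ whose vertices are some of these copies. Each vertex $u$ of $G'$ carries a class $\mathrm{cls}(u)\ni u$ of copies that have been merged into it. Put $\mathrm{ident}(u)=|\mathrm{cls}(u)|$ and $R(u)=\sum_{m\in \mathrm{cls}(u)}\mathrm{reach}(m)$. Initially $G'=G$, each vertex has one copy, $\mathrm{cls}(u)=\{u\}$, $\mathrm{reach}=1$ and $\mathrm{bc}'=0$. Copies and their scores are kept when a vertex leaves $G'$. **Search from a source $s$.** Let $d_s$ be the distance from $s$ in $G'$ and let $P_s(w)$ be the set of neighbours $v$ of $w$ that are reachable from $s$ and satisfy $d_s(w)=d_s(v)+1$.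 Put $\sigma[s]=1$ and $\sigma[w]=\sum_{v\in P_s(w)}\sigma[v]\,i_s(v)$ for $w\ne s$, where $i_s(s)=1$ and $i_s(v)=\mathrm{ident}(v)$ for $v\ne s$. For $v$ reachable from $s$ and $m\in\mathrm{cls}(v)$ put $$\delta_s[m]=\mathrm{reach}(m)-1+\sum_{w:\,v\in P_s(w)}\frac{\sigma[v]}{\sigma[w]}\sum_{m'\in\mathrm{cls}(w)}\bigl(1+\delta_s[m']\bigr).$$ If all copies in $\mathrm{cls}(w)$ have the same reach, the inner sum is $\mathrm{ident}(w)(1+\delta_s[w])$. **Operations.** Below, $C$ is the component of $G'$ containing the vertices concerned. All right-hand sides are evaluated in the state before the operation. 1. *Articulation vertex $u$.* Remove $u$. To each connected component $K$ of $C-u$ add a new local copy of $u$ joined to the neighbours of $u$ in $K$. Its class consists of one new copy of each $m\in\mathrm{cls}(u)$, with the same original as $m$, with reach $\mathrm{reach}(m)+\frac1{\mathrm{ident}(u)}\sum_{x\in C\setminus(K\cup\{u\})}R(x)$ and with score $0$. 2. *Bridge $\{u,v\}$.* Remove it. Let $S_u,S_v$ be the sums of $R$ over the resulting components of $u$ and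 of $v$. For $m\in\mathrm{cls}(u)$ add $S_v/\mathrm{ident}(u)$ to $\mathrm{reach}(m)$ and add $\bigl(\mathrm{reach}(m)-1+\frac{S_u-R(u)}{\mathrm{ident}(u)}\bigr)S_v$ to $\mathrm{bc}'[m]$. Do the same with $u,v$ exchanged. 3. *Degree-1 vertex $u$ with neighbour $v$.* Remove $u$. Let $T=\sum_{x\in C\setminus\{u\}}R(x)$. Add $(\mathrm{reach}(m)-1)T$ to $\mathrm{bc}'[m]$ for $m\in\mathrm{cls}(u)$. For $m\in\mathrm{cls}(v)$ add $R(u)/\mathrm{ident}(v)$ to $\mathrm{reach}(m)$ and add $\bigl(\mathrm{reach}(m)-1+\frac{T-R(v)}{\mathrm{ident}(v)}\bigr)R(u)$ to $\mathrm{bc}'[m]$. 4. *Side vertex $u$ (its neighbours form a clique).* Remove $u$. Add $(\mathrm{reach}(m)-1)\sum_{x\in C\setminus\{u\}}R(x)$ to $\mathrm{bc}'[m]$ for $m\in\mathrm{cls}(u)$. For $w\in C\setminus\{u\}$ and $m\in\mathrm{cls}(w)$ add $R(u)\,\delta_u[m]+R(u)\bigl(\delta_u[m]-(\mathrm{reach}(m)-1)\bigr)$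 to $\mathrm{bc}'[m]$. 5. *Identical vertices.* Let $I$ be a non-empty set of vertices of one component of $G'$ that is either type-I identical ($\Gamma(a)=\Gamma(b)$ for all $a,b\in I$) or type-II identical ($\Gamma(a)\cup\{a\}=\Gamma(b)\cup\{b\}$ for all $a,b\in I$). Choose $v\in I$, remove all other vertices of $I$ from $G'$, and let the new class of $v$ be $\bigcup_{a\in I}\mathrm{cls}(a)$. For $a\in I$ and $m\in\mathrm{cls}(a)$ add $(\mathrm{reach}(m)-1)\sum_{b\in I\setminus\{a\}}R(b)$ to $\mathrm{bc}'[m]$ (this is $0$ if all reach values on $I$ are $1$). If $I$ is type-I, moreover distribute $\sum_{a\neq b\in I}R(a)R(b)$ (which is $|I|(|I|-1)$ if all reach and ident values on $I$ are $1$) equally over the scores of all copies in the classes of the common neighbours of $I$. **Final scores.** In the state reached at the end, the final score $\mathrm{bc}'[c]$ of a copy $c$ is its accumulated score plus $\sum_{s}R(s)\,\delta_s[c]$ over the vertices $s\ne w$ of the component of $w$, if $c\in\mathrm{cls}(w)$ for a vertex $w$ of $G'$. It is the accumulated score alone if $c$ lies in no class of a vertex of $G'$. **Claim.** After any finite sequence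 of these operations, in any order, for every $v\in V$ $$\mathrm{bc}[v]=\sum_{c\,:\,\mathrm{org}(c)=v}\mathrm{bc}'[c],$$ where the sum is over all copies of $v$ ever made. -/

import Mathlib

namespace BCNet

/-! ### Betweenness centrality of a graph -/

section Betweenness

variable {V : Type*}

/-- `σ_{st}`: the number of shortest paths from `s` to `t` (it is `0` if `t` is not reachable). -/
noncomputable def numShortest (G : SimpleGraph V) (s t : V) : ℕ :=
  Set.ncard {p : G.Walk s t | p.length = G.dist s t}

/-- `σ_{st}(v)`: the number of shortest paths from `s` to `t` that pass through `v`. -/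
noncomputable def numShortestThrough (G : SimpleGraph V) (s t v : V) : ℕ :=
  Set.ncard {p : G.Walk s t | p.length = G.dist s t ∧ v ∈ p.support}

/-- The pair dependency `δ_{st}(v) = σ_{st}(v) / σ_{st}` (it is `0` if `t` is not reachable
from `s`). -/
noncomputable def pairDep (G : SimpleGraph V) (s t v : V) : ℚ :=
  (numShortestThrough G s t v : ℚ) / (numShortest G s t : ℚ)

open Classical in
/-- Freeman's betweenness centrality `bc[v] = ∑_{s ≠ v ≠ t} δ_{st}(v)`, over ordered pairs. -/
noncomputable def bc [Fintype V] (G : SimpleGraph V) (v : V) : ℚ :=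
  ∑ s : V, ∑ t : V, if s ≠ v ∧ t ≠ v then pairDep G s t v else 0

end Betweenness

/-! ### States of the preprocessing -/

/-- A copy `(v, i)` of the vertex `v` of the initial graph, with label `i`. The map `org` from
copies to original vertices is the first projection. -/
abbrev Copy (V : Type*) := V × ℕ

/-- A state of the preprocessing.
* `copies`: all copies of vertices made so far, including those no longer in the graph;
* `live`, `graph`: the vertices and the edges of the current graph;
* `cls u`: for a vertex `u` of the current graph, the copies that have been merged into `u`
  (`u` itself and the list of removed identical copies associated with it);
* `reach c`: the reach value of the copy `c`;
* `score c`: the part of `bc'[c]` that has been accumulated during the preprocessing. -/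
structure State (V : Type*) where
  copies : Finset (Copy V)
  live : Finset (Copy V)
  graph : SimpleGraph (Copy V)
  cls : Copy V → Finset (Copy V)
  reach : Copy V → ℚ
  score : Copy V → ℚ

namespace State

variable {V : Type*}

/-- The initial state: one copy of each vertex, with reach `1`, ident `1` and score `0`. -/
noncomputable def init [Fintype V] (G : SimpleGraph V) : State V where
  copies := Finset.univ.map ⟨fun v => (v, 0), fun _ _ h => congrArg Prod.fst h⟩
  live := Finset.univ.map ⟨fun v => (v, 0), fun _ _ h => congrArg Prod.fst h⟩
  graph := G.map (fun v => (v, 0))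
  cls := fun c => {c}
  reach := fun _ => 1
  score := fun _ => 0

/-- `ident(u)`: the number of copies merged into `u`. -/
def ident (S : State V) (u : Copy V) : ℕ := (S.cls u).card

/-- The number of original vertices represented by `u`: the total reach of the copies merged
into `u`. -/
def weight (S : State V) (u : Copy V) : ℚ := ∑ m ∈ S.cls u, S.reach m

open Classical in
/-- The vertices of the current graph reachable from `u` along edges of `H`. -/
noncomputable def comp (S : State V) (H : SimpleGraph (Copy V)) (u : Copy V) :
    Finset (Copy V) :=
  S.live.filter (fun x => H.Reachable u x)

/-- The current graph after removing the vertices in `D` and their edges. -/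
def deleteVerts (S : State V) (D : Finset (Copy V)) : SimpleGraph (Copy V) where
  Adj a b := S.graph.Adj a b ∧ a ∉ D ∧ b ∉ D
  symm := ⟨fun _ _ h => ⟨h.1.symm, h.2.2, h.2.1⟩⟩
  loopless := ⟨fun _ h => h.1.ne rfl⟩

/-! ### The two phases for a source, weighted by `ident` and `reach` -/

open Classical in
/-- `P_s(w)`: the predecessors of `w` on the shortest paths from `s`. -/
noncomputable def preds (S : State V) (s w : Copy V) : Finset (Copy V) :=
  S.live.filter (fun v => S.graph.Adj v w ∧ S.graph.dist s w = S.graph.dist s v + 1)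

open Classical in
/-- The vertices `w` with `v ∈ P_s(w)`. -/
noncomputable def succs (S : State V) (s v : Copy V) : Finset (Copy V) :=
  S.live.filter (fun w => S.graph.Adj v w ∧ S.graph.dist s w = S.graph.dist s v + 1)

open Classical in
/-- The path counts of the first phase: `σ[s] = 1`, and each edge from a predecessor `v` of `w`
contributes `σ[v] * ident(v)` to `σ[w]` if `v ≠ s`, and `σ[v]` if `v = s`. -/
noncomputable def sigma (S : State V) (s w : Copy V) : ℚ :=
  if w = s then 1
  else ∑ v ∈ (S.preds s w).attach,
    sigma S s v.1 * (if v.1 = s then 1 else (S.ident v.1 : ℚ))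
termination_by S.graph.dist s w
decreasing_by
  have h := v.2
  simp only [preds, Finset.mem_filter] at h
  omega

/-- The dependency propagated to (each copy merged into) `v` in the second phase. The dependency
of a copy `m` merged into `w` is `δ[m] = (reach(m) - 1) + dep s w`, and each edge from `v` to a
vertex `w` with `v ∈ P_s(w)` propagates `(σ[v] / σ[w]) * (1 + δ[m])` for every copy `m` merged
into `w`, which is `(σ[v] / σ[w]) * ident(w) * (1 + δ[w])` if these have the same reach. -/
noncomputable def dep (S : State V) (s v : Copy V) : ℚ :=
  ∑ w ∈ (S.succs s v).attach,
    S.sigma s v / S.sigma s w.1 * ∑ m ∈ S.cls w.1, (1 + ((S.reach m - 1) + dep S s w.1))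
termination_by S.live.sup (S.graph.dist s) - S.graph.dist s v
decreasing_by
  have h := w.2
  simp only [succs, Finset.mem_filter] at h
  have := Finset.le_sup (f := S.graph.dist s) h.1
  omega

/-- `δ_s[m]`: the dependency of the copy `m`, merged into the vertex `w`, on the source `s`. -/
noncomputable def delta (S : State V) (s w m : Copy V) : ℚ :=
  (S.reach m - 1) + S.dep s w

open Classical in
/-- The final score `bc'[c]`: what was accumulated during the preprocessing, plus, from each
source `s` of the current graph, the number of vertices represented by `s` (which is
`ident(s) * reach(s)` if the copies merged into `s` have the same reach) times the dependency of
`c` on `s`, if `c` is merged into a vertex `w ≠ s` of the component of `s`. -/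
noncomputable def finalScore (S : State V) (c : Copy V) : ℚ :=
  S.score c + ∑ s ∈ S.live, ∑ w ∈ (S.comp S.graph s).erase s,
    if c ∈ S.cls w then S.weight s * S.delta s w c else 0

open Classical in
/-- The sum of `bc'[c]` over all copies `c` of the original vertex `v`. -/
noncomputable def totalScore (S : State V) (v : V) : ℚ :=
  ∑ c ∈ S.copies.filter (fun c => c.1 = v), S.finalScore c

/-! ### Shattering at an articulation vertex -/

open Classical in
/-- Removing `u` from the current graph increases the number of connected components. -/
def IsArticulation (S : State V) (u : Copy V) : Prop :=
  u ∈ S.live ∧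
    Nat.card (S.graph.induce (S.live : Set (Copy V))).ConnectedComponent <
      Nat.card (S.graph.induce ((S.live.erase u : Finset (Copy V)) : Set (Copy V))).ConnectedComponent

/-- The connected components of `C - u`, where `C` is the component of `u`. -/
def parts (S : State V) (u : Copy V) : Set (S.deleteVerts {u}).ConnectedComponent :=
  {κ | ∃ x ∈ S.comp S.graph u, x ≠ u ∧ (S.deleteVerts {u}).connectedComponentMk x = κ}

open Classical in
/-- The total weight of the vertices of `C - u` outside the part `κ`, where `C` is the component
of `u`. -/
noncomputable def outside (S : State V) (u : Copy V)
    (κ : (S.deleteVerts {u}).ConnectedComponent) : ℚ :=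
  ∑ x ∈ ((S.comp S.graph u).erase u).filter
    (fun x => (S.deleteVerts {u}).connectedComponentMk x ≠ κ), S.weight x

/-- `S'` results from `S` by removing `u` and adding to each part `κ` of `C - u` a local copy
`cp κ u` of `u`, connected to the neighbours of `u` in `κ`. Along with `u`, each copy `m` that was
merged into `u` gets the local copy `cp κ m`. The reach of the local copies accounts for
everything that `u` represents and for all vertices of `C - u` outside `κ`; the latter are shared
equally among the copies merged into `u`. -/
structure ShattersTo (S : State V) (u : Copy V)
    (cp : (S.deleteVerts {u}).ConnectedComponent → Copy V → Copy V) (S' : State V) : Prop where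
  fresh : ∀ κ ∈ S.parts u, ∀ m ∈ S.cls u, cp κ m ∉ S.copies
  org : ∀ κ ∈ S.parts u, ∀ m ∈ S.cls u, (cp κ m).1 = m.1
  inj : ∀ κ ∈ S.parts u, ∀ κ' ∈ S.parts u, ∀ m ∈ S.cls u, ∀ m' ∈ S.cls u,
    cp κ m = cp κ' m' → κ = κ' ∧ m = m'
  copies : ∀ c, c ∈ S'.copies ↔ c ∈ S.copies ∨ ∃ κ ∈ S.parts u, ∃ m ∈ S.cls u, c = cp κ m
  live : ∀ c, c ∈ S'.live ↔ (c ∈ S.live ∧ c ≠ u) ∨ ∃ κ ∈ S.parts u, c = cp κ u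
  adj : ∀ a b, S'.graph.Adj a b ↔ (S.deleteVerts {u}).Adj a b ∨
    (∃ κ ∈ S.parts u, a = cp κ u ∧ S.graph.Adj u b ∧
      (S.deleteVerts {u}).connectedComponentMk b = κ) ∨
    (∃ κ ∈ S.parts u, b = cp κ u ∧ S.graph.Adj u a ∧
      (S.deleteVerts {u}).connectedComponentMk a = κ)
  cls_old : ∀ c ∈ S.live, c ≠ u → S'.cls c = S.cls c
  cls_new : ∀ κ ∈ S.parts u, ∀ c, c ∈ S'.cls (cp κ u) ↔ ∃ m ∈ S.cls u, c = cp κ m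
  reach_old : ∀ c ∈ S.copies, S'.reach c = S.reach c
  reach_new : ∀ κ ∈ S.parts u, ∀ m ∈ S.cls u,
    S'.reach (cp κ m) = S.reach m + S.outside u κ / S.ident u
  score_old : ∀ c ∈ S.copies, S'.score c = S.score c
  score_new : ∀ κ ∈ S.parts u, ∀ m ∈ S.cls u, S'.score (cp κ m) = 0

/-! ### Shattering with a bridge -/

/-- The total weight of the component of `u` after the edge `{u, v}` is removed. -/
noncomputable def sideWeight (S : State V) (u v : Copy V) : ℚ :=
  ∑ x ∈ S.comp (S.graph.deleteEdges {s(u, v)}) u, S.weight x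

open Classical in
/-- Removing the bridge `{u, v}`. The vertices on the other side of the bridge are added to the
reach of each endpoint, shared equally among the copies merged into it. The scores of these copies
receive the dependencies of the sources on the other side on the endpoint. -/
noncomputable def removeBridge (S : State V) (u v : Copy V) : State V :=
  { S with
    graph := S.graph.deleteEdges {s(u, v)}
    reach := fun c =>
      if c ∈ S.cls u then S.reach c + S.sideWeight v u / S.ident u
      else if c ∈ S.cls v then S.reach c + S.sideWeight u v / S.ident v
      else S.reach c
    score := fun c =>
      if c ∈ S.cls u then S.score c +
        ((S.reach c - 1) + (S.sideWeight u v - S.weight u) / S.ident u) * S.sideWeight v u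
      else if c ∈ S.cls v then S.score c +
        ((S.reach c - 1) + (S.sideWeight v u - S.weight v) / S.ident v) * S.sideWeight u v
      else S.score c }

/-! ### Compression with degree-1 and side vertices -/

/-- The total weight of `C - u`, where `C` is the component of `u`. -/
noncomputable def restWeight (S : State V) (u : Copy V) : ℚ :=
  open Classical in ∑ x ∈ (S.comp S.graph u).erase u, S.weight x

open Classical in
/-- Removing the degree-1 vertex `u` whose only neighbour is `v`. -/
noncomputable def removeDegreeOne (S : State V) (u v : Copy V) : State V :=
  { S with
    live := S.live.erase u
    graph := S.deleteVerts {u}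
    reach := fun c => if c ∈ S.cls v then S.reach c + S.weight u / S.ident v else S.reach c
    score := fun c =>
      if c ∈ S.cls u then S.score c + (S.reach c - 1) * S.restWeight u
      else if c ∈ S.cls v then S.score c +
        ((S.reach c - 1) + (S.restWeight u - S.weight v) / S.ident v) * S.weight u
      else S.score c }

open Classical in
/-- Removing the side vertex `u`, after one search with source `u` in the current graph. -/
noncomputable def removeSide (S : State V) (u : Copy V) : State V :=
  { S with
    live := S.live.erase u
    graph := S.deleteVerts {u}
    score := fun c => S.score c
      + (if c ∈ S.cls u then (S.reach c - 1) * S.restWeight u else 0)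
      + ∑ w ∈ (S.comp S.graph u).erase u, if c ∈ S.cls w then
          S.weight u * S.delta u w c + S.weight u * (S.delta u w c - (S.reach c - 1)) else 0 }

/-! ### Compression with identical vertices -/

/-- `I` is a set of type-I identical vertices of one component: `Γ(a) = Γ(b)`. -/
def IsTypeI (S : State V) (I : Finset (Copy V)) : Prop :=
  I ⊆ S.live ∧ ∀ a ∈ I, ∀ b ∈ I,
    S.graph.Reachable a b ∧ S.graph.neighborSet a = S.graph.neighborSet b

/-- `I` is a set of type-II identical vertices: `Γ(a) ∪ {a} = Γ(b) ∪ {b}`. -/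
def IsTypeII (S : State V) (I : Finset (Copy V)) : Prop :=
  I ⊆ S.live ∧ ∀ a ∈ I, ∀ b ∈ I,
    insert a (S.graph.neighborSet a) = insert b (S.graph.neighborSet b)

open Classical in
/-- The weight of the pairs of original vertices represented by two different vertices of `I`;
it is `|I| * (|I| - 1)` if all reach and ident values on `I` are `1`. -/
noncomputable def pairWeight (S : State V) (I : Finset (Copy V)) : ℚ :=
  ∑ a ∈ I, ∑ b ∈ I.erase a, S.weight a * S.weight b

open Classical in
/-- The dependency of the copy `c` in the class of a member `a` of `I` that is due to sources
represented by the other members of `I` and to targets represented by `c` itself; it is `0` if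
`reach(c) = 1`. -/
noncomputable def endpointCorrection (S : State V) (I : Finset (Copy V)) (c : Copy V) : ℚ :=
  ∑ a ∈ I, if c ∈ S.cls a then (S.reach c - 1) * ∑ b ∈ I.erase a, S.weight b else 0

open Classical in
/-- The correction for the paths between the vertices of a type-I identical set `I ∋ v`: it is
distributed equally among the neighbours of `I`, counted with `ident`. -/
noncomputable def neighbourCorrection (S : State V) (I : Finset (Copy V)) (v c : Copy V) : ℚ :=
  ∑ x ∈ S.live.filter (fun x => S.graph.Adj v x), if c ∈ S.cls x then
    S.pairWeight I / ∑ y ∈ S.live.filter (fun y => S.graph.Adj v y), (S.ident y : ℚ) else 0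

open Classical in
/-- Merging the set `I` of identical vertices into its element `v`, and adding `corr` to the
scores. The ident value of the remaining vertex becomes the sum of those on `I`. -/
noncomputable def mergeInto (S : State V) (I : Finset (Copy V)) (v : Copy V)
    (corr : Copy V → ℚ) : State V :=
  { S with
    live := S.live \ I.erase v
    graph := S.deleteVerts (I.erase v)
    cls := fun c => if c = v then I.biUnion S.cls else S.cls c
    score := fun c => S.score c + corr c }

end State

/-! ### The preprocessing -/

open State in
/-- One operation of the preprocessing. -/
inductive Step {V : Type*} : State V → State V → Prop
  | articulation (S S' : State V) (u : Copy V)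
      (cp : (S.deleteVerts {u}).ConnectedComponent → Copy V → Copy V)
      (hu : S.IsArticulation u) (h : S.ShattersTo u cp S') : Step S S'
  | bridge (S : State V) (u v : Copy V) (hadj : S.graph.Adj u v)
      (hbridge : S.graph.IsBridge s(u, v)) : Step S (S.removeBridge u v)
  | degreeOne (S : State V) (u v : Copy V) (hu : S.graph.neighborSet u = {v}) :
      Step S (S.removeDegreeOne u v)
  | sideVertex (S : State V) (u : Copy V) (hu : u ∈ S.live)
      (hclique : S.graph.IsClique (S.graph.neighborSet u)) : Step S (S.removeSide u)
  | typeI (S : State V) (I : Finset (Copy V)) (v : Copy V) (hv : v ∈ I) (hI : S.IsTypeI I) :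
      Step S (S.mergeInto I v
        (fun c => S.endpointCorrection I c + S.neighbourCorrection I v c))
  | typeII (S : State V) (I : Finset (Copy V)) (v : Copy V) (hv : v ∈ I) (hI : S.IsTypeII I) :
      Step S (S.mergeInto I v (S.endpointCorrection I))

/-- `S` is obtained from the initial graph by finitely many operations, in any order. -/
def Preprocessed {V : Type*} [Fintype V] (G : SimpleGraph V) (S : State V) : Prop :=
  Relation.ReflTransGen Step (State.init G) S

end BCNet

/-! The sum of the final scores over all copies of an original vertex is an invariant of the
operations, and in the initial state it equals `bc`.

To prove the invariance, the final scores are first expressed without any search. A vertex `w` of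
the current graph stands for `ident w` interchangeable copies (its multiplicity in a `Net`) and
represents `weight w` original vertices. Let `frac s w t` be the proportion of the shortest `s`–`t`
paths that use one fixed copy of `w`. Unrolling the recursions of `sigma` and `dep`
(`Valid.sigma_eq`, `Valid.dep_eq`) gives, for `c` in the class of `w` (`Valid.finalScore_of_mem`),
`finalScore c = score c + (reach c - 1) * rest w + btw w`, where `rest w` is the weight of the other
vertices of the component and `btw w` is the sum of `weight s * weight t * frac s w t` over ordered
pairs of vertices different from `w`. The middle term counts the pairs whose target lies behind `c`.
Pairs whose source lies behind `c` are recorded elsewhere: in the accumulated score or at another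
local copy.

It remains to compare this formula before and after an operation. The path counts are compared by
`Net.shp_transfer`, the distances by `dist_eq_of_contractions`. A side vertex is inside no shortest
path, so only the pairs that have it as an endpoint are lost. At a bridge or an articulation vertex,
a set `X` hangs on the rest through a single vertex (`Net.Gate`). The vertices of `X` other than
this gate see only the total weight of the outside, which may be placed on the gate. At the gate
itself, every pair that crosses contributes `1 / ident` to each copy. Removing a degree-1 vertex is
removing a bridge and then an isolated side vertex. Merging identical vertices (`Net.Merges`)
rescales path counts by ratios of multiplicities that cancel in `frac`, so only the pairs inside the
merged set have to be corrected. -/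

namespace BCNet

/-! ### Vertex-weighted graphs and weighted counts of shortest paths -/

/-- A graph whose edges join finitely many vertices of positive multiplicity. -/
structure Net (α : Type*) where
  graph : SimpleGraph α
  verts : Finset α
  mult : α → ℚ
  adj_mem : ∀ a b, graph.Adj a b → a ∈ verts
  mult_pos : ∀ a ∈ verts, 0 < mult a

namespace Net

variable {α β : Type*} (N : Net α) (M : Net β)

theorem mem_of_reachable {s t : α} (hs : s ∈ N.verts) (h : N.graph.Reachable s t) :
    t ∈ N.verts := by
  obtain ⟨p⟩ := h
  induction p with
  | nil => exact hs
  | cons h p ih => exact ih (N.adj_mem _ _ h.symm)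

theorem adj_mem' {a b : α} (h : N.graph.Adj a b) : b ∈ N.verts := N.adj_mem b a h.symm

open Classical in
/-- The number of walks of length `n` from `s` to `t`, each counted with the product of the
multiplicities of its vertices. -/
noncomputable def cnt : ℕ → α → α → ℚ
  | 0, s, t => if s = t then N.mult s else 0
  | n + 1, s, t => N.mult t * ∑ v ∈ N.verts with N.graph.Adj v t, cnt n s v

theorem cnt_zero (s t : α) [Decidable (s = t)] :
    N.cnt 0 s t = if s = t then N.mult s else 0 := by
  rw [cnt]; congr

open Classical in
theorem cnt_succ (n : ℕ) (s t : α) :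
    N.cnt (n + 1) s t = N.mult t * ∑ v ∈ N.verts with N.graph.Adj v t, N.cnt n s v := by
  rw [cnt]

open Classical in
theorem cnt_succ' (n : ℕ) (s t : α) :
    N.cnt (n + 1) s t = N.mult s * ∑ v ∈ N.verts with N.graph.Adj s v, N.cnt n v t := by
  induction n generalizing t with
  | zero =>
    rw [cnt_succ]
    simp only [cnt_zero, Finset.sum_ite_eq, Finset.sum_ite_eq', Finset.mem_filter]
    by_cases h : N.graph.Adj s t
    · simp [h, N.adj_mem _ _ h, N.adj_mem' h, mul_comm]
    · simp [h]
  | succ n ih =>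
    rw [cnt_succ]
    simp only [ih, cnt_succ N n _ t, ← Finset.mul_sum]
    rw [Finset.sum_comm]
    ring

theorem cnt_comm (n : ℕ) (s t : α) : N.cnt n s t = N.cnt n t s := by
  classical
  induction n generalizing s t with
  | zero => by_cases h : s = t <;> simp [cnt_zero, h, eq_comm]
  | succ n ih =>
    rw [cnt_succ, cnt_succ']
    simp only [ih s, N.graph.adj_comm t]

theorem exists_walk_of_cnt_ne_zero {n : ℕ} {s t : α} (h : N.cnt n s t ≠ 0) :
    ∃ p : N.graph.Walk s t, p.length = n := by
  classical
  induction n generalizing t with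
  | zero =>
    rw [cnt_zero] at h
    obtain rfl : s = t := by by_contra hne; simp [hne] at h
    exact ⟨.nil, rfl⟩
  | succ n ih =>
    rw [cnt_succ] at h
    obtain ⟨v, hv, hv'⟩ := Finset.exists_ne_zero_of_sum_ne_zero (right_ne_zero_of_mul h)
    obtain ⟨p, hp⟩ := ih hv'
    exact ⟨p.concat (Finset.mem_filter.1 hv).2, by simp [hp]⟩

theorem cnt_nonneg (n : ℕ) {s t : α} (hs : s ∈ N.verts) (ht : t ∈ N.verts) :
    0 ≤ N.cnt n s t := by
  classical
  induction n generalizing t with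
  | zero => rw [cnt_zero]; split_ifs; exacts [(N.mult_pos s hs).le, le_rfl]
  | succ n ih =>
    rw [cnt_succ]
    exact mul_nonneg (N.mult_pos t ht).le
      (Finset.sum_nonneg fun v hv => ih (Finset.mem_filter.1 hv).1)

theorem cnt_pos {s t : α} (hs : s ∈ N.verts) (p : N.graph.Walk s t) :
    0 < N.cnt p.length s t := by
  classical
  induction p with
  | nil => simpa [cnt_zero] using N.mult_pos _ hs
  | cons h p ih =>
    rename_i u v w
    have hv := N.adj_mem' h
    have hw : w ∈ N.verts := N.mem_of_reachable hv ⟨p⟩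
    rw [SimpleGraph.Walk.length_cons, cnt_succ']
    refine mul_pos (N.mult_pos _ hs) (Finset.sum_pos' (fun x hx => ?_)
      ⟨v, by simp [hv, h], ih hv⟩)
    exact N.cnt_nonneg _ (Finset.mem_filter.1 hx).1 hw

/-- The weighted number of shortest paths from `s` to `t`; each path counts with the product of
the multiplicities of its vertices, endpoints included. -/
noncomputable def shp (s t : α) : ℚ := N.cnt (N.graph.dist s t) s t

theorem shp_self (s : α) : N.shp s s = N.mult s := by
  classical simp [shp, cnt_zero]

theorem shp_comm (s t : α) : N.shp s t = N.shp t s := by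
  rw [shp, shp, cnt_comm, SimpleGraph.dist_comm]

theorem shp_of_not_reachable {s t : α} (h : ¬ N.graph.Reachable s t) : N.shp s t = 0 := by
  by_contra h'
  obtain ⟨p, -⟩ := N.exists_walk_of_cnt_ne_zero h'
  exact h ⟨p⟩

theorem shp_pos {s t : α} (hs : s ∈ N.verts) (h : N.graph.Reachable s t) : 0 < N.shp s t := by
  obtain ⟨p, hp⟩ := h.exists_walk_length_eq_dist
  rw [shp, ← hp]
  exact N.cnt_pos hs p

theorem dist_le_succ {G : SimpleGraph α} {s v t : α} (hv : G.Reachable s v) (h : G.Adj v t) :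
    G.dist s t ≤ G.dist s v + 1 := by
  obtain ⟨p, hp⟩ := hv.exists_walk_length_eq_dist
  have := SimpleGraph.dist_le (p.concat h)
  rwa [SimpleGraph.Walk.length_concat, hp] at this

open Classical in
theorem shp_eq_sum_preds {s t : α} (h : s ≠ t) :
    N.shp s t = N.mult t * ∑ v ∈ N.verts with
      N.graph.Adj v t ∧ N.graph.dist s t = N.graph.dist s v + 1, N.shp s v := by
  rcases hd : N.graph.dist s t with _ | n
  -- Here `t` is unreachable and the distance is the default `0`: there is no walk of length `0`,
  -- and no vertex qualifies as a predecessor.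
  · simp [shp, hd, cnt_zero, h]
  · rw [shp, hd, cnt_succ]
    congr 1
    rw [← Finset.filter_filter, Finset.sum_filter (p := fun v => n + 1 = N.graph.dist s v + 1)]
    refine Finset.sum_congr rfl fun v hv => ?_
    split_ifs with hn
    · rw [shp, ← Nat.succ.inj hn]
    -- A walk of length `n` to a neighbour of `t` gives distance at most `n`, and less than `n`
    -- would bring `t` nearer than `n + 1`. Hence the other neighbours contribute nothing.
    · by_contra hc
      obtain ⟨p, hp⟩ := N.exists_walk_of_cnt_ne_zero hc
      have h1 := SimpleGraph.dist_le p
      have h2 := dist_le_succ ⟨p⟩ (Finset.mem_filter.1 hv).2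
      omega

open Classical in
theorem shp_eq_sum_succs {s t : α} (h : s ≠ t) :
    N.shp s t = N.mult s * ∑ v ∈ N.verts with
      N.graph.Adj s v ∧ N.graph.dist s t = N.graph.dist v t + 1, N.shp v t := by
  rw [shp_comm, N.shp_eq_sum_preds h.symm]
  congr 1
  refine Finset.sum_congr ?_ fun v _ => N.shp_comm _ _
  ext v
  simp only [Finset.mem_filter, N.graph.adj_comm v s, N.graph.dist_comm (v := s),
    N.graph.dist_comm (v := v)]

/-- Counts of shortest paths are compatible with a map that preserves the distances from `s`, the
predecessors on shortest paths from `s` and the multiplicities, summed over fibres. -/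
theorem shp_transfer (φ : α → β) (X : Finset α) (s : α) [DecidableEq β]
    (hX : X ⊆ N.verts) (hφ : ∀ x ∈ X, φ x ∈ M.verts)
    (hsf : ∀ x ∈ X, φ x = φ s → x = s)
    (hmult : ∀ x ∈ X, M.mult (φ x) = ∑ y ∈ X with φ y = φ x, N.mult y)
    (hd : ∀ x ∈ X, M.graph.dist (φ s) (φ x) = N.graph.dist s x)
    (hadj : ∀ x ∈ X, ∀ t ∈ X, N.graph.dist s t = N.graph.dist s x + 1 →
      (N.graph.Adj x t ↔ M.graph.Adj (φ x) (φ t)))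
    (hcl : ∀ x ∈ N.verts, ∀ t ∈ X, N.graph.Adj x t →
      N.graph.dist s t = N.graph.dist s x + 1 → x ∈ X)
    (hcl' : ∀ y ∈ M.verts, ∀ t ∈ X, M.graph.Adj y (φ t) →
      M.graph.dist (φ s) (φ t) = M.graph.dist (φ s) y + 1 → ∃ x ∈ X, φ x = y)
    {t : α} (ht : t ∈ X) :
    M.mult (φ t) * N.shp s t = N.mult t * M.shp (φ s) (φ t) := by
  classical
  -- The statement says that `shp` divided by the multiplicity of the endpoint is unchanged by `φ`.
  -- In this form it can be summed over a fibre, where the multiplicities add up.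
  induction hn : N.graph.dist s t using Nat.strong_induction_on generalizing t with
  | _ n ih =>
  subst hn
  by_cases hst : s = t
  · subst hst; rw [shp_self, shp_self, mul_comm]
  have hst' : φ s ≠ φ t := fun h => hst (hsf t ht h.symm).symm
  rw [N.shp_eq_sum_preds hst, M.shp_eq_sum_preds hst', mul_left_comm]
  congr 2
  -- The predecessors of `t` are grouped by their images. A fibre inside `X` consists of
  -- predecessors as soon as its image is one, because distances and edges agree.
  rw [← Finset.sum_fiberwise_of_maps_to (g := φ)
    (t := M.verts.filter fun v => M.graph.Adj v (φ t) ∧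
      M.graph.dist (φ s) (φ t) = M.graph.dist (φ s) v + 1)]
  · refine Finset.sum_congr rfl fun y hy => ?_
    obtain ⟨hyM, hya, hyd⟩ := Finset.mem_filter.1 hy
    obtain ⟨x₀, hx₀, rfl⟩ := hcl' y hyM t ht hya hyd
    have hfib : ((N.verts.filter fun v => N.graph.Adj v t ∧
        N.graph.dist s t = N.graph.dist s v + 1).filter fun x => φ x = φ x₀) =
        X.filter fun x => φ x = φ x₀ := by
      ext x
      simp only [Finset.mem_filter]
      constructor
      · rintro ⟨⟨h1, h2, h3⟩, h4⟩
        exact ⟨hcl x h1 t ht h2 h3, h4⟩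
      · rintro ⟨h1, h4⟩
        have h3 : N.graph.dist s t = N.graph.dist s x + 1 := by
          rw [← hd t ht, ← hd x h1, h4, hyd]
        exact ⟨⟨hX h1, (hadj x h1 t ht h3).2 (h4 ▸ hya), h3⟩, h4⟩
    rw [hfib]
    have hpos := (M.mult_pos _ (hφ x₀ hx₀)).ne'
    apply mul_left_cancel₀ hpos
    rw [Finset.mul_sum]
    nth_rw 2 [hmult x₀ hx₀]
    rw [Finset.sum_mul]
    refine Finset.sum_congr rfl fun x hx => ?_
    obtain ⟨h1, h4⟩ := Finset.mem_filter.1 hx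
    have h3 : N.graph.dist s t = N.graph.dist s x + 1 := by
      rw [← hd t ht, ← hd x h1, h4, hyd]
    have := ih _ (by omega) h1 rfl
    rwa [h4] at this
  · intro x hx
    obtain ⟨h1, h2, h3⟩ := Finset.mem_filter.1 hx
    have hx' := hcl x h1 t ht h2 h3
    exact Finset.mem_filter.2 ⟨hφ x hx', (hadj x hx' t ht h3).1 h2, by
      rw [hd t ht, hd x hx', h3]⟩

/-- The case of `shp_transfer` of an injective map. -/
theorem shp_transfer_of_injOn (φ : α → β) (X : Finset α) (s : α)
    (hX : X ⊆ N.verts) (hφ : ∀ x ∈ X, φ x ∈ M.verts) (hs : s ∈ X)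
    (hinj : Set.InjOn φ X)
    (hmult : ∀ x ∈ X, M.mult (φ x) = N.mult x)
    (hd : ∀ x ∈ X, M.graph.dist (φ s) (φ x) = N.graph.dist s x)
    (hadj : ∀ x ∈ X, ∀ t ∈ X, N.graph.Adj x t ↔ M.graph.Adj (φ x) (φ t))
    (hcl : ∀ x ∈ N.verts, ∀ t ∈ X, N.graph.Adj x t →
      N.graph.dist s t = N.graph.dist s x + 1 → x ∈ X)
    (hcl' : ∀ y ∈ M.verts, ∀ t ∈ X, M.graph.Adj y (φ t) →
      M.graph.dist (φ s) (φ t) = M.graph.dist (φ s) y + 1 → ∃ x ∈ X, φ x = y)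
    {t : α} (ht : t ∈ X) :
    M.shp (φ s) (φ t) = N.shp s t := by
  classical
  have := N.shp_transfer M φ X s hX hφ (fun x hx h => hinj hx hs h) (fun x hx => ?_) hd
    (fun x hx t ht _ => hadj x hx t ht) hcl hcl' ht
  · rw [hmult t ht] at this
    exact (mul_left_cancel₀ (N.mult_pos _ (hX ht)).ne' this).symm
  · rw [hmult x hx]
    have : (X.filter fun y => φ y = φ x) = {x} := by
      ext y
      simp only [Finset.mem_filter, Finset.mem_singleton]
      exact ⟨fun h => hinj h.1 hx h.2, by rintro rfl; exact ⟨hx, rfl⟩⟩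
    rw [this, Finset.sum_singleton]

open Classical in
/-- The fraction of the shortest paths from `s` to `t` that pass through one given copy of
`w`. -/
noncomputable def frac (s w t : α) : ℚ :=
  if N.graph.dist s w + N.graph.dist w t = N.graph.dist s t then
    -- The product of the counts contains the multiplicity of `w` twice. One factor `mult w`
    -- corrects this, the other selects a single copy. If a distance is a default `0`, a count
    -- vanishes and the value is `0` as well.
    N.shp s w * N.shp w t / (N.mult w ^ 2 * N.shp s t) else 0

theorem frac_comm (s w t : α) : N.frac s w t = N.frac t w s := by
  rw [frac, frac, N.shp_comm t w, N.shp_comm w s, N.shp_comm t s,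
    N.graph.dist_comm (u := t) (v := w),
    N.graph.dist_comm (u := w) (v := s), N.graph.dist_comm (u := t) (v := s),
    add_comm (N.graph.dist w t), mul_comm (N.shp w t)]

theorem reachable_of_frac_ne_zero {s w t : α} (h : N.frac s w t ≠ 0) :
    N.graph.Reachable s w ∧ N.graph.Reachable w t ∧
      N.graph.dist s w + N.graph.dist w t = N.graph.dist s t := by
  unfold frac at h
  split_ifs at h with hd
  · refine ⟨?_, ?_, hd⟩ <;> by_contra hc <;> simp [N.shp_of_not_reachable hc] at h
  · exact absurd rfl h

theorem frac_self_right {s w : α} (hs : s ∈ N.verts) (hw : w ∈ N.verts)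
    (h : N.graph.Reachable s w) : N.frac s w w = 1 / N.mult w := by
  have h1 := (N.shp_pos hs h).ne'
  have h2 := (N.mult_pos w hw).ne'
  simp only [frac, SimpleGraph.dist_self, add_zero, if_true, shp_self]
  field_simp

theorem frac_endpoints_eq {s w : α} (h : s ≠ w) : N.frac s w s = 0 := by
  by_contra hc
  obtain ⟨h1, -, h3⟩ := N.reachable_of_frac_ne_zero hc
  have := h1.pos_dist_of_ne h
  rw [SimpleGraph.dist_self] at h3
  omega

open Classical in
/-- The contribution to the centrality of each copy of `w` by the pairs of endpoints `≠ w`, which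
are counted with their weights. -/
noncomputable def btw (R : α → ℚ) (w : α) : ℚ :=
  ∑ s ∈ N.verts.erase w, ∑ t ∈ N.verts.erase w, R s * R t * N.frac s w t

open Classical in
/-- The total weight of the other vertices of the component of `w`. -/
noncomputable def rest (R : α → ℚ) (w : α) : ℚ :=
  ∑ s ∈ (N.verts.filter fun x => N.graph.Reachable w x).erase w, R s

theorem btw_eq [DecidableEq α] (R : α → ℚ) (w : α) : N.btw R w =
    ∑ s ∈ N.verts.erase w, ∑ t ∈ N.verts.erase w, R s * R t * N.frac s w t := by
  unfold btw; congr!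

theorem rest_eq [DecidableEq α] (R : α → ℚ) (w : α)
    [DecidablePred fun x => N.graph.Reachable w x] : N.rest R w =
    ∑ s ∈ (N.verts.filter fun x => N.graph.Reachable w x).erase w, R s := by
  unfold rest; congr!

end Net

/-- A map that sends edges to edges or to vertices does not increase distances. -/
theorem dist_map_le_of_contraction {α β : Type*} {G : SimpleGraph α} {H : SimpleGraph β}
    (r : α → β) (hr : ∀ a b, G.Adj a b → r a = r b ∨ H.Adj (r a) (r b)) {a b : α}
    (h : G.Reachable a b) :
    H.Reachable (r a) (r b) ∧ H.dist (r a) (r b) ≤ G.dist a b := by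
  suffices ∀ p : G.Walk a b, ∃ q : H.Walk (r a) (r b), q.length ≤ p.length by
    obtain ⟨p, hp⟩ := h.exists_walk_length_eq_dist
    obtain ⟨q, hq⟩ := this p
    exact ⟨⟨q⟩, (SimpleGraph.dist_le q).trans (hp ▸ hq)⟩
  intro p
  induction p with
  | nil => exact ⟨.nil, le_rfl⟩
  | cons hadj p ih =>
    obtain ⟨q, hq⟩ := ih ⟨p⟩
    rcases hr _ _ hadj with h' | h'
    · exact ⟨q.copy h'.symm rfl, by simp; omega⟩
    · exact ⟨.cons h' q, by simpa using hq⟩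

end BCNet

/-! ### Dependencies and final scores as sums over pairs of endpoints. -/

namespace BCNet

namespace Net

variable {α : Type*} (N : Net α)

open Classical in
/-- The dependency on `s` of a vertex is collected from its successors. -/
theorem sum_succs_frac {s v t : α} (hs : s ∈ N.verts) (hr : N.graph.Reachable s v) :
    ∑ w ∈ N.verts with N.graph.Adj v w ∧ N.graph.dist s w = N.graph.dist s v + 1,
      N.shp s v * N.mult w / (N.shp s w * N.mult v) * (N.mult w * N.frac s w t) =
    if t = v then 0 else N.frac s v t := by
  have hv := N.mem_of_reachable hs hr
  have hvm := (N.mult_pos v hv).ne'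
  -- The factors `shp s w` and `mult w` cancel; what is left depends on `w` only through `shp w t`.
  have hterm : ∀ w ∈ N.verts.filter fun w =>
      N.graph.Adj v w ∧ N.graph.dist s w = N.graph.dist s v + 1,
      N.shp s v * N.mult w / (N.shp s w * N.mult v) * (N.mult w * N.frac s w t) =
      if N.graph.dist s w + N.graph.dist w t = N.graph.dist s t then
        N.shp s v / (N.mult v * N.shp s t) * N.shp w t else 0 := by
    intro w hw
    obtain ⟨h1, h2, h3⟩ := Finset.mem_filter.1 hw
    have h4 := (N.mult_pos w h1).ne'
    have h5 := (N.shp_pos hs (hr.trans h2.reachable)).ne'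
    unfold frac
    split_ifs
    · field_simp
    · simp
  rw [Finset.sum_congr rfl hterm, ← Finset.sum_filter, Finset.filter_filter, ← Finset.mul_sum]
  by_cases htv : t = v
  · subst htv
    rw [if_pos rfl, Finset.filter_false_of_mem, Finset.sum_empty, mul_zero]
    rintro w - ⟨⟨-, h1⟩, h2⟩
    omega
  rw [if_neg htv]
  by_cases hrt : N.graph.Reachable v t
  · have hrst := hr.trans hrt
    unfold frac
    split_ifs with hd
    · rw [N.shp_eq_sum_succs (Ne.symm htv) (s := v)]
      -- Since `v` lies on a shortest path to `t`, the successors of `v` on such paths are the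
      -- second vertices of the shortest `v`–`t` paths, over which `shp_eq_sum_succs` sums.
      have hset : (N.verts.filter fun w =>
          (N.graph.Adj v w ∧ N.graph.dist s w = N.graph.dist s v + 1) ∧
            N.graph.dist s w + N.graph.dist w t = N.graph.dist s t) =
          N.verts.filter fun w => N.graph.Adj v w ∧
            N.graph.dist v t = N.graph.dist w t + 1 := by
        refine Finset.filter_congr fun w _ => ?_
        constructor
        · rintro ⟨⟨h1, h2⟩, h3⟩
          exact ⟨h1, by omega⟩
        · rintro ⟨h1, h2⟩
          have h3 := dist_le_succ hr h1
          have h4 := (hr.trans h1.reachable).dist_triangle_left t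
          exact ⟨⟨h1, by omega⟩, by omega⟩
      rw [hset]
      have := (N.shp_pos hs hrst).ne'
      field_simp
    -- If a successor of `v` were on a shortest path to `t`, then so would `v` be, by the triangle
    -- inequality.
    · rw [Finset.filter_false_of_mem, Finset.sum_empty, mul_zero]
      rintro w - ⟨⟨h1, h2⟩, h3⟩
      have h4 := hr.dist_triangle_left t
      have h5 := h1.reachable.dist_triangle_left t
      have h6 := SimpleGraph.dist_eq_one_iff_adj.2 h1
      omega
  · have h0 : N.frac s v t = 0 := by
      by_contra h
      exact hrt (N.reachable_of_frac_ne_zero h).2.1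
    rw [h0, Finset.sum_eq_zero, mul_zero]
    intro w hw
    obtain ⟨-, ⟨h1, -⟩, -⟩ := Finset.mem_filter.1 hw
    exact N.shp_of_not_reachable fun h => hrt (h1.reachable.trans h)

end Net

namespace State

variable {V : Type*} (S : State V)

/-- The properties of a state that are preserved by the operations. -/
structure Valid : Prop where
  adj_mem : ∀ a b, S.graph.Adj a b → a ∈ S.live
  mem_cls : ∀ u ∈ S.live, u ∈ S.cls u
  disj : ∀ u ∈ S.live, ∀ w ∈ S.live, ∀ c, c ∈ S.cls u → c ∈ S.cls w → u = w
  cls_sub : ∀ u ∈ S.live, S.cls u ⊆ S.copies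

variable {S}

/-- The current graph, with `ident` as multiplicity. -/
def Valid.net (h : S.Valid) : Net (Copy V) where
  graph := S.graph
  verts := S.live
  mult := fun u => S.ident u
  adj_mem := h.adj_mem
  mult_pos := fun u hu => by
    have := Finset.card_pos.2 ⟨u, h.mem_cls u hu⟩
    exact_mod_cast this

-- `sigma` leaves out the multiplicities of both endpoints, while `shp` includes them; for `w = s`
-- there is just one endpoint to restore.
open Classical in
theorem Valid.sigma_eq (h : S.Valid) (s w : Copy V) :
    h.net.shp s w = (if w = s then 1 else h.net.mult w) * (h.net.mult s * S.sigma s w) := by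
  induction hn : S.graph.dist s w using Nat.strong_induction_on generalizing w with
  | _ n ih =>
  subst hn
  by_cases hws : w = s
  · subst hws
    rw [sigma]
    simp [Net.shp_self]
  · rw [h.net.shp_eq_sum_preds (Ne.symm hws), sigma]
    simp only [hws, if_false]
    rw [Finset.sum_attach (M := ℚ) (S.preds s w)
      (fun v : Copy V => (sigma S s v * (if v = s then 1 else (S.ident v : ℚ)) : ℚ))]
    congr 1
    rw [Finset.mul_sum]
    refine Finset.sum_congr ?_ fun v hv => ?_
    · rfl
    · have h3 := (Finset.mem_filter.1 hv).2.2
      have h3 : S.graph.dist s w = S.graph.dist s v + 1 := h3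
      rw [ih _ (by omega) v rfl]
      change _ = h.net.mult s * (S.sigma s v * if v = s then 1 else h.net.mult v)
      ring

-- A class enters only through its size and its total reach, because all its copies receive the same
-- propagated dependency.
open Classical in
theorem dep_eq_sum_succs (s v : Copy V) : S.dep s v =
    ∑ w ∈ S.succs s v, S.sigma s v / S.sigma s w *
      (S.weight w + S.ident w * S.dep s w) := by
  rw [dep, Finset.sum_attach (S.succs s v) (fun w : Copy V => S.sigma s v / S.sigma s w *
    ∑ m ∈ S.cls w, (1 + ((S.reach m - 1) + dep S s w)))]
  refine Finset.sum_congr rfl fun w _ => ?_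
  congr 1
  simp only [Finset.sum_add_distrib, Finset.sum_sub_distrib, Finset.sum_const, weight, ident,
    nsmul_eq_mul]
  ring

-- Induction from the vertices farthest from `s` inwards, with `Net.sum_succs_frac` as the inductive
-- step. The term `t = v` is left out because `delta` accounts for the targets represented by a copy
-- through `reach - 1`.
open Classical in
theorem Valid.dep_eq (h : S.Valid) {s v : Copy V} (hs : s ∈ S.live) (hvs : v ≠ s)
    (hr : S.graph.Reachable s v) :
    S.dep s v = ∑ t ∈ S.live.erase v, S.weight t * h.net.frac s v t := by
  induction hn : S.live.sup (S.graph.dist s) - S.graph.dist s v using Nat.strong_induction_on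
    generalizing v with
  | _ n ih =>
  subst hn
  have hv : v ∈ S.live := h.net.mem_of_reachable hs hr
  have hms := (h.net.mult_pos s hs).ne'
  have hmv := (h.net.mult_pos v hv).ne'
  rw [dep_eq_sum_succs]
  have hterm : ∀ w ∈ S.succs s v, S.sigma s v / S.sigma s w *
      (S.weight w + S.ident w * S.dep s w) =
      ∑ t ∈ S.live, S.weight t * (h.net.shp s v * h.net.mult w / (h.net.shp s w * h.net.mult v) *
        (h.net.mult w * h.net.frac s w t)) := by
    intro w hw
    obtain ⟨h1, h2, h3⟩ := Finset.mem_filter.1 hw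
    have hrw := hr.trans h2.reachable
    have hws : w ≠ s := by rintro rfl; simp at h3
    have hmw := (h.net.mult_pos w h1).ne'
    have hsw := (h.net.shp_pos hs hrw).ne'
    have hlt : S.live.sup (S.graph.dist s) - S.graph.dist s w <
        S.live.sup (S.graph.dist s) - S.graph.dist s v := by
      have := Finset.le_sup (f := S.graph.dist s) h1
      omega
    rw [ih _ hlt hws hrw rfl]
    have e1 : S.sigma s v / S.sigma s w =
        h.net.shp s v * h.net.mult w / (h.net.shp s w * h.net.mult v) := by
      have e2 := h.sigma_eq s v
      have e3 := h.sigma_eq s w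
      rw [if_neg hvs] at e2
      rw [if_neg hws] at e3
      have : S.sigma s w ≠ 0 := by
        intro h0; rw [h0] at e3; simp at e3; exact hsw e3
      rw [e2, e3]
      field_simp
    -- The summand `weight w` is the missing term `t = w`, since `frac s w w = 1 / ident w`.
    have e4 : S.weight w + S.ident w * ∑ t ∈ S.live.erase w, S.weight t * h.net.frac s w t =
        h.net.mult w * ∑ t ∈ S.live, S.weight t * h.net.frac s w t := by
      rw [← Finset.add_sum_erase _ _ h1, h.net.frac_self_right hs h1 hrw, mul_add]
      change _ + h.net.mult w * _ = _
      field_simp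
    rw [e1, e4, Finset.mul_sum, Finset.mul_sum]
    exact Finset.sum_congr rfl fun t _ => by ring
  rw [Finset.sum_congr rfl hterm, Finset.sum_comm, Finset.sum_erase_eq_sub hv]
  simp only [← Finset.mul_sum]
  have e5 : ∀ t ∈ S.live, S.weight t * ∑ w ∈ S.succs s v,
      h.net.shp s v * h.net.mult w / (h.net.shp s w * h.net.mult v) *
        (h.net.mult w * h.net.frac s w t) =
      S.weight t * h.net.frac s v t - if t = v then S.weight v * h.net.frac s v v else 0 := by
    intro t _
    have h6 := h.net.sum_succs_frac (t := t) hs hr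
    have h7 : S.succs s v = h.net.verts.filter fun w => h.net.graph.Adj v w ∧
        h.net.graph.dist s w = h.net.graph.dist s v + 1 := by
      rfl
    rw [h7, h6]
    split_ifs with htv
    · subst htv; ring
    · ring
  rw [Finset.sum_congr rfl e5, Finset.sum_sub_distrib]
  simp [hv]

open Classical in
/-- The final score in terms of pairs of endpoints. -/
theorem Valid.finalScore_eq (h : S.Valid) (c : Copy V) :
    S.finalScore c = S.score c + ∑ w ∈ S.live, if c ∈ S.cls w then
      (S.reach c - 1) * h.net.rest S.weight w + h.net.btw S.weight w else 0 := by
  rw [finalScore]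
  congr 1
  have hswap : ∀ s ∈ S.live, (∑ w ∈ (S.comp S.graph s).erase s,
      if c ∈ S.cls w then S.weight s * S.delta s w c else 0) =
      ∑ w ∈ S.live, if c ∈ S.cls w then (if w ≠ s ∧ S.graph.Reachable w s then
        S.weight s * S.delta s w c else 0) else 0 := by
    intro s _
    have : (S.comp S.graph s).erase s =
        S.live.filter fun w => w ≠ s ∧ S.graph.Reachable w s := by
      ext w
      simp only [comp, Finset.mem_erase, Finset.mem_filter, SimpleGraph.reachable_comm (u := w)]
      tauto
    rw [this, Finset.sum_filter]
    refine Finset.sum_congr rfl fun w _ => ?_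
    split_ifs <;> rfl
  rw [Finset.sum_congr rfl hswap, Finset.sum_comm]
  refine Finset.sum_congr rfl fun w hw => ?_
  by_cases hc : c ∈ S.cls w
  swap
  · simp [hc]
  simp only [hc, if_true]
  rw [← Finset.sum_filter]
  have hset : (S.live.filter fun s => w ≠ s ∧ S.graph.Reachable w s) =
      (S.live.filter fun s => S.graph.Reachable w s).erase w := by
    ext s
    simp only [Finset.mem_erase, Finset.mem_filter, ne_comm (a := w)]
    tauto
  rw [hset]
  have hd : ∀ s ∈ (S.live.filter fun s => S.graph.Reachable w s).erase w,
      S.weight s * S.delta s w c = (S.reach c - 1) * S.weight s +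
        ∑ t ∈ S.live.erase w, S.weight s * S.weight t * h.net.frac s w t := by
    intro s hs
    obtain ⟨h1, h2⟩ := Finset.mem_erase.1 hs
    obtain ⟨h3, h4⟩ := Finset.mem_filter.1 h2
    rw [delta, h.dep_eq h3 (Ne.symm h1) h4.symm, mul_add, Finset.mul_sum]
    congr 1
    · ring
    · exact Finset.sum_congr rfl fun t _ => by ring
  rw [Finset.sum_congr rfl hd, Finset.sum_add_distrib, ← Finset.mul_sum]
  congr 1
  · rw [Net.rest_eq]; rfl
  rw [Net.btw_eq]
  refine Finset.sum_subset (Finset.erase_subset_erase _ (Finset.filter_subset _ _)) ?_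
  intro s hs hs'
  -- Sources outside the component of `w` contribute nothing, so both sums may run over all live
  -- vertices.
  refine Finset.sum_eq_zero fun t _ => ?_
  have : h.net.frac s w t = 0 := by
    by_contra h0
    have h1 := (h.net.reachable_of_frac_ne_zero h0).1
    obtain ⟨h2, h3⟩ := Finset.mem_erase.1 hs
    exact hs' (Finset.mem_erase.2 ⟨h2, Finset.mem_filter.2 ⟨h3, h1.symm⟩⟩)
  rw [this, mul_zero]

theorem Valid.finalScore_of_mem (h : S.Valid) {c w : Copy V} (hw : w ∈ S.live)
    (hc : c ∈ S.cls w) : S.finalScore c = S.score c +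
      ((S.reach c - 1) * h.net.rest S.weight w + h.net.btw S.weight w) := by
  classical
  rw [h.finalScore_eq, Finset.sum_eq_single w, if_pos hc]
  · intro x hx hxw
    rw [if_neg fun hcx => hxw (h.disj x hx w hw c hcx hc)]
  · exact fun h' => absurd hw h'

theorem finalScore_of_notMem {c : Copy V} (hc : ∀ w ∈ S.live, c ∉ S.cls w) :
    S.finalScore c = S.score c := by
  classical
  rw [finalScore, add_eq_left]
  refine Finset.sum_eq_zero fun s _ => Finset.sum_eq_zero fun w hw => if_neg (hc w ?_)
  exact (Finset.mem_filter.1 (Finset.mem_of_mem_erase hw)).1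

end State

end BCNet

namespace BCNet

/-! ### The initial state -/

/-- Distances are preserved by a contraction with a left inverse that is a contraction. -/
theorem dist_eq_of_contractions {α β : Type*} {G : SimpleGraph α} {H : SimpleGraph β}
    (r : α → β) (h : β → α) (hr : ∀ a b, G.Adj a b → r a = r b ∨ H.Adj (r a) (r b))
    (hh : ∀ a b, H.Adj a b → h a = h b ∨ G.Adj (h a) (h b)) {a b : α}
    (ha : h (r a) = a) (hb : h (r b) = b) :
    (H.Reachable (r a) (r b) ↔ G.Reachable a b) ∧ H.dist (r a) (r b) = G.dist a b := by
  have h1 : H.Reachable (r a) (r b) → G.Reachable a b ∧ G.dist a b ≤ H.dist (r a) (r b) := by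
    intro h'
    have := dist_map_le_of_contraction h hh h'
    rwa [ha, hb] at this
  have h2 := fun h' => dist_map_le_of_contraction (a := a) (b := b) r hr h'
  refine ⟨⟨fun h' => (h1 h').1, fun h' => (h2 h').1⟩, ?_⟩
  -- Reachability is preserved in both directions, so the default value `0` agrees too.
  by_cases hab : G.Reachable a b
  · exact le_antisymm (h2 hab).2 (h1 (h2 hab).1).2
  · rw [SimpleGraph.dist_eq_zero_of_not_reachable hab,
      SimpleGraph.dist_eq_zero_of_not_reachable fun h' => hab (h1 h').1]

/-! ### Betweenness of a plain graph as `btw` with all multiplicities and weights `1`. -/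

section Counting

variable {V : Type*} (G : SimpleGraph V)

/-- A finite graph with multiplicities `1`. -/
noncomputable def unitNet [Fintype V] : Net V where
  graph := G
  verts := Finset.univ
  mult := fun _ => 1
  adj_mem := fun a _ _ => Finset.mem_univ a
  mult_pos := fun _ _ => one_pos

theorem unitNet_cnt [Fintype V] (n : ℕ) (s t : V) :
    (unitNet G).cnt n s t = Set.ncard {p : G.Walk s t | p.length = n} := by
  classical
  rw [← Nat.card_coe_set_eq, Nat.card_eq_fintype_card,
    ← SimpleGraph.adjMatrix_pow_apply_eq_card_walk (α := ℚ)]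
  induction n generalizing t with
  | zero => rw [Net.cnt_zero, pow_zero, Matrix.one_apply]; rfl
  | succ n ih =>
    rw [Net.cnt_succ, pow_succ, Matrix.mul_apply, Finset.sum_filter]
    simp only [ih, SimpleGraph.adjMatrix_apply, mul_ite, mul_one, mul_zero]
    exact one_mul _

theorem unitNet_shp [Fintype V] (s t : V) : (unitNet G).shp s t = numShortest G s t :=
  unitNet_cnt G _ s t

/-- Concatenation is a bijection from pairs of shortest paths to the shortest paths through `v`. -/
theorem numShortestThrough_eq (s t v : V) (hd : G.dist s v + G.dist v t = G.dist s t) :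
    numShortestThrough G s t v = numShortest G s v * numShortest G v t := by
  classical
  rw [numShortest, numShortest, ← Set.ncard_prod, numShortestThrough]
  symm
  refine Set.BijOn.ncard_eq (f := fun pq : G.Walk s v × G.Walk v t => pq.1.append pq.2)
    ⟨?_, ?_, ?_⟩
  · rintro ⟨p, q⟩ ⟨hp, hq⟩
    simp only [Set.mem_ofPred_eq] at hp hq ⊢
    refine ⟨by rw [SimpleGraph.Walk.length_append, hp, hq, hd], ?_⟩
    rw [SimpleGraph.Walk.mem_support_append_iff]
    exact Or.inl p.end_mem_support
  · rintro ⟨p, q⟩ ⟨hp, hq⟩ ⟨p', q'⟩ ⟨hp', hq'⟩ h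
    simp only [Set.mem_ofPred_eq] at hp hq hp' hq' h
    have h1 := congrArg SimpleGraph.Walk.support h
    rw [SimpleGraph.Walk.support_append, SimpleGraph.Walk.support_append] at h1
    -- The first halves have equal length, so equal vertex lists split at the same place.
    obtain ⟨h2, h3⟩ := List.append_inj h1 (by simp [hp, hp'])
    refine Prod.ext (SimpleGraph.Walk.ext_support h2) (SimpleGraph.Walk.ext_support ?_)
    rw [← q.cons_tail_support, ← q'.cons_tail_support, h3]
  -- Cutting a shortest path at `v` gives two pieces whose lengths sum to the two distances, so both
  -- are shortest.
  · rintro p ⟨hp, hv⟩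
    have h1 := congrArg SimpleGraph.Walk.length (p.take_spec hv)
    rw [SimpleGraph.Walk.length_append] at h1
    have h2 := SimpleGraph.dist_le (p.takeUntil v hv)
    have h3 := SimpleGraph.dist_le (p.dropUntil v hv)
    refine ⟨(p.takeUntil v hv, p.dropUntil v hv), ⟨?_, ?_⟩, p.take_spec hv⟩ <;>
      simp only [Set.mem_ofPred_eq] <;> omega

theorem numShortestThrough_eq_zero (s t v : V) (hd : G.dist s v + G.dist v t ≠ G.dist s t) :
    numShortestThrough G s t v = 0 := by
  classical
  rw [numShortestThrough]
  convert Set.ncard_empty (G.Walk s t)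
  refine Set.eq_empty_iff_forall_notMem.2 ?_
  rintro p ⟨hp, hv⟩
  have h1 := congrArg SimpleGraph.Walk.length (p.take_spec hv)
  rw [SimpleGraph.Walk.length_append] at h1
  have h2 := SimpleGraph.dist_le (p.takeUntil v hv)
  have h3 := SimpleGraph.dist_le (p.dropUntil v hv)
  have h4 := (SimpleGraph.Walk.reachable (p.takeUntil v hv)).dist_triangle_left t
  omega

theorem pairDep_eq_frac [Fintype V] (s t v : V) : pairDep G s t v = (unitNet G).frac s v t := by
  unfold Net.frac
  change _ = if G.dist s v + G.dist v t = G.dist s t then _ else _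
  rw [pairDep, unitNet_shp, unitNet_shp, unitNet_shp]
  split_ifs with hd
  · rw [numShortestThrough_eq G s t v hd]
    simp [unitNet]
  · rw [numShortestThrough_eq_zero G s t v hd]
    simp

theorem bc_eq_btw [Fintype V] (v : V) : bc G v = (unitNet G).btw (fun _ => 1) v := by
  classical
  rw [bc, Net.btw_eq]
  change _ = ∑ s ∈ Finset.univ.erase v, ∑ t ∈ Finset.univ.erase v, _
  simp only [← Finset.filter_ne', Finset.sum_filter, one_mul, pairDep_eq_frac]
  refine Finset.sum_congr rfl fun s _ => ?_
  split_ifs with h <;> simp [h]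

end Counting

/-! ### The scores of the initial state. -/

section Init

variable {V : Type*} [Fintype V] (G : SimpleGraph V)

open State

theorem init_adj_iff (a b : Copy V) :
    (State.init G).graph.Adj a b ↔ G.Adj a.1 b.1 ∧ a.2 = 0 ∧ b.2 = 0 := by
  obtain ⟨a, i⟩ := a
  obtain ⟨b, j⟩ := b
  rw [State.init, SimpleGraph.map_adj']
  constructor
  · rintro ⟨h, x, y, hxy, hx, hy⟩
    simp only [Prod.mk.injEq] at hx hy
    exact ⟨hx.1 ▸ hy.1 ▸ hxy, hx.2.symm, hy.2.symm⟩
  · rintro ⟨h, rfl, rfl⟩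
    exact ⟨fun h' => h.ne (congrArg Prod.fst h'), a, b, h, rfl, rfl⟩

theorem mem_init_live (a : Copy V) : a ∈ (State.init G).live ↔ a.2 = 0 := by
  rw [State.init, Finset.mem_map]
  constructor
  · rintro ⟨x, -, rfl⟩; rfl
  · intro h; exact ⟨a.1, Finset.mem_univ _, Prod.ext rfl h.symm⟩

theorem init_valid : (State.init G).Valid where
  adj_mem a b h := (mem_init_live G a).2 ((init_adj_iff G a b).1 h).2.1
  mem_cls u _ := Finset.mem_singleton_self u
  disj _ _ _ _ _ hu hw := (Finset.mem_singleton.1 hu).symm.trans (Finset.mem_singleton.1 hw)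
  cls_sub _ hu := Finset.singleton_subset_iff.2 hu

theorem init_dist (s t : V) : (State.init G).graph.dist (s, 0) (t, 0) = G.dist s t :=
  (dist_eq_of_contractions (fun v : V => ((v, 0) : Copy V)) Prod.fst
    (fun _ _ h => Or.inr ((init_adj_iff G _ _).2 ⟨h, rfl, rfl⟩))
    (fun _ _ h => Or.inr ((init_adj_iff G _ _).1 h).1) rfl rfl).2

theorem init_shp (s t : V) :
    (init_valid G).net.shp (s, 0) (t, 0) = (unitNet G).shp s t := by
  refine (unitNet G).shp_transfer_of_injOn (init_valid G).net (fun v : V => ((v, 0) : Copy V))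
    Finset.univ s (Finset.subset_univ _) (fun x _ => (mem_init_live G _).2 rfl)
    (Finset.mem_univ s) (fun _ _ _ _ h => congrArg Prod.fst h) (fun x _ => ?_)
    (fun x _ => init_dist G s x) (fun x _ t _ => ?_) (fun _ _ _ _ _ _ => Finset.mem_univ _)
    (fun y hy _ _ _ _ => ?_) (Finset.mem_univ t)
  · simp [Valid.net, unitNet, ident, State.init]
  · exact ⟨fun h => (init_adj_iff G _ _).2 ⟨h, rfl, rfl⟩, fun h => ((init_adj_iff G _ _).1 h).1⟩
  · exact ⟨y.1, Finset.mem_univ _, Prod.ext rfl ((mem_init_live G y).1 hy).symm⟩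

theorem init_frac (s v t : V) :
    (init_valid G).net.frac (s, 0) (v, 0) (t, 0) = (unitNet G).frac s v t := by
  unfold Net.frac
  rw [init_shp, init_shp, init_shp]
  change (if (State.init G).graph.dist (s, 0) (v, 0) + (State.init G).graph.dist (v, 0) (t, 0) =
    (State.init G).graph.dist (s, 0) (t, 0) then _ else _) = _
  rw [init_dist, init_dist, init_dist]
  simp [Valid.net, unitNet, ident, State.init]

theorem totalScore_init (v : V) : (State.init G).totalScore v = bc G v := by
  classical
  have hset : (State.init G).copies.filter (fun c => c.1 = v) = {((v, 0) : Copy V)} := by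
    ext ⟨a, i⟩
    rw [Finset.mem_filter, Finset.mem_singleton, Prod.mk.injEq]
    change (a, i) ∈ (State.init G).live ∧ a = v ↔ _
    rw [mem_init_live, and_comm]
  have hlive : (State.init G).live.erase (v, 0) =
      (Finset.univ.erase v).image fun v : V => ((v, 0) : Copy V) := by
    ext ⟨a, i⟩
    rw [Finset.mem_erase, mem_init_live]
    simp only [Finset.mem_image, Finset.mem_erase, Prod.mk.injEq, Finset.mem_univ]
    constructor
    · rintro ⟨h, rfl⟩; exact ⟨a, ⟨fun h' => h (by rw [h']), trivial⟩, rfl, rfl⟩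
    · rintro ⟨x, ⟨h, -⟩, rfl, rfl⟩; exact ⟨fun h' => h (congrArg Prod.fst h'), rfl⟩
  have hw : (State.init G).weight = fun _ => 1 := by
    funext c; simp [weight, State.init]
  have hinj : Set.InjOn (fun v : V => ((v, 0) : Copy V)) (Finset.univ.erase v : Finset V) :=
    fun _ _ _ _ h => congrArg Prod.fst h
  rw [totalScore]
  convert_to ∑ c ∈ {((v, 0) : Copy V)}, (State.init G).finalScore c = _
  · exact Finset.sum_congr (by convert hset) fun _ _ => rfl
  rw [Finset.sum_singleton, (init_valid G).finalScore_of_mem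
    ((mem_init_live G (v, 0)).2 rfl) (Finset.mem_singleton_self _), bc_eq_btw,
    Net.btw_eq, Net.btw_eq]
  change _ + (_ + ∑ s ∈ (State.init G).live.erase (v, 0),
    ∑ t ∈ (State.init G).live.erase (v, 0), _) =
    ∑ s ∈ Finset.univ.erase v, ∑ t ∈ Finset.univ.erase v, _
  rw [hlive, Finset.sum_image hinj]
  have h0 : (State.init G).score (v, 0) = 0 := rfl
  have h1 : (State.init G).reach (v, 0) = 1 := rfl
  rw [h0, h1, sub_self, zero_mul, zero_add, zero_add]
  refine Finset.sum_congr rfl fun s _ => ?_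
  rw [Finset.sum_image hinj]
  refine Finset.sum_congr rfl fun t _ => ?_
  rw [init_frac, hw]

end Init

end BCNet

/-! ### Side vertices. -/

namespace BCNet

namespace Net

variable {α β : Type*} (N : Net α) (M : Net β)

theorem exists_pred {G : SimpleGraph α} {s t : α} (h : G.Reachable s t) (hne : s ≠ t) :
    ∃ x, G.Adj x t ∧ G.Reachable s x ∧ G.dist s t = G.dist s x + 1 := by
  obtain ⟨p, hp⟩ := h.symm.exists_walk_length_eq_dist
  cases p with
  | nil => exact absurd rfl hne
  | cons hadj q =>
    rename_i x
    have h1 := SimpleGraph.dist_le q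
    have h2 := dist_le_succ ⟨q.reverse⟩ hadj.symm
    rw [SimpleGraph.Walk.length_cons, G.dist_comm] at hp
    rw [G.dist_comm] at h1
    exact ⟨x, hadj.symm, ⟨q.reverse⟩, by omega⟩

theorem frac_congr {s w t : α} {s' w' t' : β}
    (d1 : M.graph.dist s' w' = N.graph.dist s w) (d2 : M.graph.dist w' t' = N.graph.dist w t)
    (d3 : M.graph.dist s' t' = N.graph.dist s t) (e1 : M.shp s' w' = N.shp s w)
    (e2 : M.shp w' t' = N.shp w t) (e3 : M.shp s' t' = N.shp s t)
    (hm : M.mult w' = N.mult w) : M.frac s' w' t' = N.frac s w t := by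
  unfold frac
  rw [d1, d2, d3, e1, e2, e3, hm]

/-- A vertex whose neighbours form a clique is not inside a shortest path. -/
theorem dist_lt_of_isClique {G : SimpleGraph α} {s u t : α} (hc : G.IsClique (G.neighborSet u))
    (hsu : s ≠ u) (htu : t ≠ u) (hs : G.Reachable s u) (ht : G.Reachable u t) :
    G.dist s t < G.dist s u + G.dist u t := by
  obtain ⟨x, hx, hx1, hx2⟩ := exists_pred hs hsu
  obtain ⟨y, hy, hy1, hy2⟩ := exists_pred ht.symm htu
  -- The neighbours `x`, `y` of `u` towards `s` and `t` are equal or adjacent, so a path through `u`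
  -- can be shortened by passing from `x` to `y`.
  have h1 : G.dist s y ≤ G.dist s x + 1 := by
    by_cases hxy : x = y
    · subst hxy; omega
    · exact dist_le_succ hx1 (hc hx.symm hy.symm hxy)
  have h2 := (hx1.trans (hx.reachable.trans hy.symm.reachable)).dist_triangle_left t
  rw [G.dist_comm (u := t), G.dist_comm (u := t)] at hy2
  omega

theorem frac_eq_zero_of_isClique {s u t : α}
    (hc : N.graph.IsClique (N.graph.neighborSet u)) (hsu : s ≠ u) (htu : t ≠ u) :
    N.frac s u t = 0 := by
  by_contra h
  obtain ⟨h1, h2, h3⟩ := N.reachable_of_frac_ne_zero h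
  exact (dist_lt_of_isClique hc hsu htu h1 h2).ne' h3

end Net

namespace State

variable {V : Type*} {S : State V}

/-- Sending `u` to one of its neighbours `y` is a contraction onto the graph without `u`, because
every other neighbour of `u` is adjacent to `y`. If `u` is isolated, nothing is deleted. -/
theorem dist_deleteVerts_of_isClique {u : Copy V}
    (hc : S.graph.IsClique (S.graph.neighborSet u)) {a b : Copy V} (ha : a ≠ u) (hb : b ≠ u) :
    ((S.deleteVerts {u}).Reachable a b ↔ S.graph.Reachable a b) ∧
      (S.deleteVerts {u}).dist a b = S.graph.dist a b := by
  classical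
  by_cases hn : ∃ y, S.graph.Adj u y
  · obtain ⟨y, hy⟩ := hn
    have key : ∀ b, S.graph.Adj u b → y = b ∨ (S.deleteVerts {u}).Adj y b := by
      intro b hb
      by_cases hyb : y = b
      · exact Or.inl hyb
      · exact Or.inr ⟨hc hy hb hyb, by simpa using hy.ne', by simpa using hb.ne'⟩
    have := dist_eq_of_contractions (G := S.graph) (H := S.deleteVerts {u})
      (fun x => if x = u then y else x) id (a := a) (b := b) ?_ (fun _ _ h => Or.inr h.1)
      (by simp [ha]) (by simp [hb])
    · simpa [ha, hb] using this
    · intro a b hab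
      by_cases hau : a = u
      · subst hau
        simpa [hab.ne'] using key b hab
      · by_cases hbu : b = u
        · subst hbu
          simpa [hau, eq_comm, SimpleGraph.adj_comm] using key a hab.symm
        · simp only [hau, hbu, if_false]
          exact Or.inr ⟨hab, by simpa using hau, by simpa using hbu⟩
  · have : S.deleteVerts {u} = S.graph := by
      ext a b
      refine ⟨fun h => h.1, fun h => ⟨h, ?_, ?_⟩⟩ <;> rw [Finset.mem_singleton]
      · rintro rfl; exact hn ⟨_, h⟩
      · rintro rfl; exact hn ⟨_, h.symm⟩
    rw [this]
    exact ⟨Iff.rfl, rfl⟩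

open Classical in
theorem Valid.removeSide (h : S.Valid) (u : Copy V) : (S.removeSide u).Valid where
  adj_mem a b hab := by
    refine Finset.mem_erase.2 ⟨?_, h.adj_mem a b hab.1⟩
    simpa using hab.2.1
  mem_cls w hw := h.mem_cls w (Finset.mem_of_mem_erase hw)
  disj w hw x hx := h.disj w (Finset.mem_of_mem_erase hw) x (Finset.mem_of_mem_erase hx)
  cls_sub w hw := h.cls_sub w (Finset.mem_of_mem_erase hw)

-- No shortest path between other vertices passes through `u`, so distances and path counts among
-- them survive its removal.
open Classical in
theorem Valid.removeSide_frac (h : S.Valid) {u : Copy V}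
    (hc : S.graph.IsClique (S.graph.neighborSet u)) {s w t : Copy V}
    (hs : s ∈ S.live.erase u) (hw : w ∈ S.live.erase u) (ht : t ∈ S.live.erase u) :
    (h.removeSide u).net.frac s w t = h.net.frac s w t := by
  classical
  have hd : ∀ a ∈ S.live.erase u, ∀ b ∈ S.live.erase u,
      (h.removeSide u).net.graph.dist a b = h.net.graph.dist a b := fun a ha b hb =>
    (dist_deleteVerts_of_isClique hc (Finset.ne_of_mem_erase ha) (Finset.ne_of_mem_erase hb)).2
  have hshp : ∀ a ∈ S.live.erase u, ∀ b ∈ S.live.erase u,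
      (h.removeSide u).net.shp a b = h.net.shp a b := by
    intro a ha b hb
    refine h.net.shp_transfer_of_injOn (h.removeSide u).net id (S.live.erase u) a
      (Finset.erase_subset _ _) (fun x hx => hx) ha (fun _ _ _ _ hxy => hxy) (fun _ _ => rfl)
      (fun x hx => hd a ha x hx) ?_ ?_ (fun y hy _ _ _ _ => ⟨y, hy, rfl⟩) hb
    · intro x hx y hy
      refine ⟨fun hxy => ⟨hxy, ?_, ?_⟩, fun hxy => hxy.1⟩
      · simpa using Finset.ne_of_mem_erase hx
      · simpa using Finset.ne_of_mem_erase hy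
    · intro x hx y hy hxy hdist
      refine Finset.mem_erase.2 ⟨?_, hx⟩
      rintro rfl
      have hay : h.net.graph.Reachable a y :=
        SimpleGraph.Reachable.of_dist_ne_zero (by omega)
      have hax := hay.trans hxy.symm.reachable
      have := Net.dist_lt_of_isClique hc (Finset.ne_of_mem_erase ha) (Finset.ne_of_mem_erase hy)
        hax hxy.reachable
      have h1 := SimpleGraph.dist_eq_one_iff_adj.2 hxy
      change h.net.graph.dist a y < h.net.graph.dist a x + h.net.graph.dist x y at this
      omega
  exact h.net.frac_congr _ (hd s hs w hw) (hd w hw t ht) (hd s hs t ht) (hshp s hs w hw)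
    (hshp w hw t ht) (hshp s hs t ht) rfl

theorem sum_sum_erase {α : Type*} [DecidableEq α] {A : Finset α} {u : α} (hu : u ∈ A)
    (f : α → α → ℚ) : ∑ s ∈ A, ∑ t ∈ A, f s t =
      f u u + ∑ t ∈ A.erase u, f u t + ∑ s ∈ A.erase u, f s u +
        ∑ s ∈ A.erase u, ∑ t ∈ A.erase u, f s t := by
  rw [← Finset.add_sum_erase A _ hu, ← Finset.add_sum_erase A (f u) hu, add_assoc (f u u + _),
    ← Finset.sum_add_distrib]
  congr 1
  exact Finset.sum_congr rfl fun s _ => (Finset.add_sum_erase A (f s) hu).symm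

theorem Valid.restWeight_eq (h : S.Valid) (u : Copy V) :
    S.restWeight u = h.net.rest S.weight u := by
  classical
  rw [Net.rest_eq]; rfl

/-- Only pairs with `u` as an endpoint are lost. With `u` as source, a copy loses `weight u * delta
u w c`. With `u` as target it loses the same without the part `reach c - 1`, which belongs to
targets behind `c`. -/
theorem Valid.finalScore_removeSide (h : S.Valid) {u : Copy V} (hu : u ∈ S.live)
    (hc : S.graph.IsClique (S.graph.neighborSet u)) (c : Copy V) :
    (S.removeSide u).finalScore c = S.finalScore c := by
  classical
  have h' := h.removeSide u
  have hscore : (S.removeSide u).score c = S.score c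
      + (if c ∈ S.cls u then (S.reach c - 1) * S.restWeight u else 0)
      + ∑ w ∈ (S.comp S.graph u).erase u, if c ∈ S.cls w then
          S.weight u * S.delta u w c + S.weight u * (S.delta u w c - (S.reach c - 1)) else 0 := rfl
  by_cases hcu : c ∈ S.cls u
  · rw [finalScore_of_notMem, h.finalScore_of_mem hu hcu, hscore, if_pos hcu,
      Finset.sum_eq_zero, add_zero, h.restWeight_eq]
    -- For the copies merged into `u` only the targets behind them remain.
    · have : h.net.btw S.weight u = 0 := by
        rw [Net.btw_eq]
        refine Finset.sum_eq_zero fun s hs => Finset.sum_eq_zero fun t ht => ?_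
        rw [h.net.frac_eq_zero_of_isClique hc (Finset.ne_of_mem_erase hs)
          (Finset.ne_of_mem_erase ht), mul_zero]
      rw [this, add_zero]
    · intro w hw
      obtain ⟨h1, h2⟩ := Finset.mem_erase.1 hw
      exact if_neg fun hcw => h1 (h.disj w (Finset.mem_filter.1 h2).1 u hu c hcw hcu)
    · intro w hw hcw
      obtain ⟨h1, h2⟩ := Finset.mem_erase.1 hw
      exact h1 (h.disj w h2 u hu c hcw hcu)
  rw [if_neg hcu, add_zero] at hscore
  by_cases hex : ∃ w ∈ S.live, c ∈ S.cls w
  swap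
  · push Not at hex
    rw [finalScore_of_notMem (S := S.removeSide u) fun w hw => hex w (Finset.mem_of_mem_erase hw),
      finalScore_of_notMem hex, hscore, Finset.sum_eq_zero, add_zero]
    intro w hw
    exact if_neg (hex w (Finset.mem_filter.1 (Finset.mem_of_mem_erase hw)).1)
  obtain ⟨w, hw, hcw⟩ := hex
  have hwu : w ≠ u := by rintro rfl; exact hcu hcw
  have hw' : w ∈ S.live.erase u := Finset.mem_erase.2 ⟨hwu, hw⟩
  rw [h.finalScore_of_mem hw hcw, h'.finalScore_of_mem hw' hcw, hscore]
  have hreach : (S.removeSide u).reach c = S.reach c := rfl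
  have hweight : (S.removeSide u).weight = S.weight := rfl
  have hrest : h.net.rest S.weight w = h'.net.rest S.weight w +
      if S.graph.Reachable w u then S.weight u else 0 := by
    rw [Net.rest_eq, Net.rest_eq]
    have hset : ((h'.net.verts.filter fun x => h'.net.graph.Reachable w x).erase w) =
        ((h.net.verts.filter fun x => h.net.graph.Reachable w x).erase w).erase u := by
      ext x
      simp only [Finset.mem_erase, Finset.mem_filter]
      change x ≠ w ∧ x ∈ S.live.erase u ∧ (S.deleteVerts {u}).Reachable w x ↔
        x ≠ u ∧ x ≠ w ∧ x ∈ S.live ∧ S.graph.Reachable w x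
      rw [Finset.mem_erase]
      by_cases hxu : x = u
      · simp [hxu]
      · rw [(dist_deleteVerts_of_isClique hc hwu hxu).1]; tauto
    rw [hset]
    by_cases hr : S.graph.Reachable w u
    · rw [if_pos hr, Finset.sum_erase_add]
      exact Finset.mem_erase.2 ⟨hwu.symm, Finset.mem_filter.2 ⟨hu, hr⟩⟩
    · have hnot : u ∉ (h.net.verts.filter fun x => h.net.graph.Reachable w x).erase w :=
        fun hx => hr (Finset.mem_filter.1 (Finset.mem_of_mem_erase hx)).2
      rw [if_neg hr, add_zero, Finset.erase_eq_of_notMem hnot]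
  -- By symmetry of `frac`, the pairs with source `u` and those with target `u` contribute equally,
  -- whence the `2`.
  have hbtw : h.net.btw S.weight w = h'.net.btw S.weight w +
      2 * (S.weight u * ∑ t ∈ S.live.erase w, S.weight t * h.net.frac u w t) := by
    rw [Net.btw_eq, Net.btw_eq]
    have huw : u ∈ S.live.erase w := Finset.mem_erase.2 ⟨hwu.symm, hu⟩
    change ∑ s ∈ S.live.erase w, ∑ t ∈ S.live.erase w, _ =
      ∑ s ∈ (S.live.erase u).erase w, ∑ t ∈ (S.live.erase u).erase w, _ + _
    rw [sum_sum_erase huw, ← Finset.add_sum_erase (S.live.erase w) _ huw,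
      h.net.frac_endpoints_eq hwu.symm, Finset.erase_right_comm]
    have e1 : ∀ s ∈ (S.live.erase u).erase w, ∀ t ∈ (S.live.erase u).erase w,
        S.weight s * S.weight t * h'.net.frac s w t =
        S.weight s * S.weight t * h.net.frac s w t := fun s hs t ht =>
      congrArg _ (h.removeSide_frac hc (Finset.mem_of_mem_erase hs) hw' (Finset.mem_of_mem_erase ht))
    rw [Finset.sum_congr rfl fun s hs => Finset.sum_congr rfl (e1 s hs)]
    have e2 : ∑ s ∈ (S.live.erase u).erase w, S.weight s * S.weight u * h.net.frac s w u =
        ∑ t ∈ (S.live.erase u).erase w, S.weight u * S.weight t * h.net.frac u w t :=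
      Finset.sum_congr rfl fun s _ => by rw [h.net.frac_comm s w u]; ring
    rw [e2]
    simp only [mul_assoc (S.weight u), ← Finset.mul_sum]
    ring
  have hextra : (∑ w ∈ (S.comp S.graph u).erase u, if c ∈ S.cls w then
      S.weight u * S.delta u w c + S.weight u * (S.delta u w c - (S.reach c - 1)) else 0) =
      (S.reach c - 1) * (if S.graph.Reachable w u then S.weight u else 0) +
      2 * (S.weight u * ∑ t ∈ S.live.erase w, S.weight t * h.net.frac u w t) := by
    have huniq : ∀ x ∈ (S.comp S.graph u).erase u, x ≠ w → c ∉ S.cls x := fun x hx hxw hcx =>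
      hxw (h.disj x (Finset.mem_filter.1 (Finset.mem_of_mem_erase hx)).1 w hw c hcx hcw)
    by_cases hr : S.graph.Reachable w u
    · rw [Finset.sum_eq_single w (fun x hx hxw => if_neg (huniq x hx hxw)), if_pos hcw, if_pos hr,
        delta, h.dep_eq hu hwu hr.symm]
      · ring
      · intro hx
        exact absurd (Finset.mem_erase.2 ⟨hwu, Finset.mem_filter.2 ⟨hw, hr.symm⟩⟩) hx
    · rw [Finset.sum_eq_zero, if_neg hr, Finset.sum_eq_zero]
      · ring
      · intro t _
        have : h.net.frac u w t = 0 := by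
          by_contra h0
          exact hr (h.net.reachable_of_frac_ne_zero h0).1.symm
        rw [this, mul_zero]
      · intro x hx
        refine if_neg (huniq x hx ?_)
        rintro rfl
        exact hr (Finset.mem_filter.1 (Finset.mem_of_mem_erase hx)).2.symm
  rw [hreach, hweight, hrest, hbtw, hextra]
  ring

end State

end BCNet

namespace BCNet

namespace Net

variable {α β : Type*}

/-! ### Parts of a graph that are attached through one vertex -/

/-- The set `X` is connected to the rest of `N` only through its element `g`, and `f` identifies
the graph induced on `X` with a component of `M`. -/
structure Gate (N : Net α) (M : Net β) (X : Finset α) (g : α) (f : α → β) (k : β → α) : Prop where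
  subset : X ⊆ N.verts
  mem : g ∈ X
  conn : ∀ x ∈ X, N.graph.Reachable g x
  gate : ∀ x ∈ X, ∀ y, y ∉ X → N.graph.Adj x y → x = g
  map_mem : ∀ x ∈ X, f x ∈ M.verts
  left_inv : ∀ x ∈ X, k (f x) = x
  adj : ∀ x ∈ X, ∀ y ∈ X, (N.graph.Adj x y ↔ M.graph.Adj (f x) (f y))
  closed : ∀ x ∈ X, ∀ b, M.graph.Adj (f x) b → ∃ y ∈ X, f y = b
  mult : ∀ x ∈ X, M.mult (f x) = N.mult x

namespace Gate

variable {N : Net α} {M : Net β} {X : Finset α} {g : α} {f : α → β} {k : β → α}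

theorem injOn (hG : Gate N M X g f k) : Set.InjOn f X := fun x hx y hy h => by
  rw [← hG.left_inv x hx, ← hG.left_inv y hy, h]

/-- Collapsing everything outside `X` onto `g` is a contraction, since edges leave `X` only at `g`;
the same collapse works outside `f '' X`. -/
theorem dist_eq (hG : Gate N M X g f k) {a b : α} (ha : a ∈ X) (hb : b ∈ X) :
    (M.graph.Reachable (f a) (f b) ↔ N.graph.Reachable a b) ∧
      M.graph.dist (f a) (f b) = N.graph.dist a b := by
  classical
  have := dist_eq_of_contractions (G := N.graph) (H := M.graph)
    (fun x => if x ∈ X then f x else f g) (fun y => if ∃ x ∈ X, f x = y then k y else g)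
    (a := a) (b := b) ?_ ?_ ?_ ?_
  · simpa [ha, hb] using this
  · intro x y hxy
    by_cases hx : x ∈ X <;> by_cases hy : y ∈ X <;> simp only [hx, hy, if_true, if_false]
    · exact Or.inr ((hG.adj x hx y hy).1 hxy)
    · exact Or.inl (by rw [hG.gate x hx y hy hxy])
    · exact Or.inl (by rw [hG.gate y hy x hx hxy.symm])
    · exact Or.inl trivial
  · intro x y hxy
    by_cases hx : ∃ x' ∈ X, f x' = x
    · obtain ⟨x', hx', rfl⟩ := hx
      obtain ⟨y', hy', rfl⟩ := hG.closed x' hx' y hxy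
      right
      rw [if_pos ⟨x', hx', rfl⟩, if_pos ⟨y', hy', rfl⟩, hG.left_inv x' hx', hG.left_inv y' hy']
      exact (hG.adj x' hx' y' hy').2 hxy
    · have hy : ¬ ∃ y' ∈ X, f y' = y := by
        rintro ⟨y', hy', rfl⟩
        exact hx (hG.closed y' hy' x hxy.symm)
      left
      rw [if_neg hx, if_neg hy]
  · simp only [ha, if_true]
    rw [if_pos ⟨a, ha, rfl⟩, hG.left_inv a ha]
  · simp only [hb, if_true]
    rw [if_pos ⟨b, hb, rfl⟩, hG.left_inv b hb]

/-- A walk that leaves `X` visits `g`. -/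
theorem dist_add (hG : Gate N M X g f k) {s t : α} (hs : s ∈ X) (ht : t ∉ X)
    (h : N.graph.Reachable s t) :
    N.graph.dist s t = N.graph.dist s g + N.graph.dist g t := by
  have hsg := (hG.conn s hs).symm
  refine le_antisymm (hsg.dist_triangle_left t) ?_
  obtain ⟨p, hp⟩ := h.exists_walk_length_eq_dist
  rw [← hp]
  clear hp h hsg
  induction p with
  | nil => exact absurd hs ht
  | cons hadj p ih =>
    rename_i x y z
    rw [SimpleGraph.Walk.length_cons]
    by_cases hy : y ∈ X
    · have h1 := ih hy ht
      have h2 := hadj.reachable.dist_triangle_left g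
      have h3 := SimpleGraph.dist_eq_one_iff_adj.2 hadj
      omega
    · obtain rfl := hG.gate x hs y hy hadj
      have := SimpleGraph.dist_le (SimpleGraph.Walk.cons hadj p)
      rw [SimpleGraph.Walk.length_cons] at this
      simpa using this

theorem ne_gate (hG : Gate N M X g f k) {t : α} (ht : t ∉ X) : g ≠ t := by
  rintro rfl; exact ht hG.mem

/-- A path from `X` to `X` through an outside vertex would visit `g` twice. -/
theorem frac_eq_zero_of_notMem (hG : Gate N M X g f k) {s w t : α} (hs : s ∈ X) (hw : w ∉ X)
    (ht : t ∈ X) : N.frac s w t = 0 := by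
  by_contra h
  obtain ⟨h1, h2, h3⟩ := N.reachable_of_frac_ne_zero h
  have h4 := hG.dist_add hs hw h1
  have h5 := hG.dist_add ht hw h2.symm
  have h6 := ((hG.conn s hs).trans h1).pos_dist_of_ne (hG.ne_gate hw)
  have h7 := (hG.conn s hs).symm.dist_triangle_left t
  rw [N.graph.dist_comm (u := t), N.graph.dist_comm (u := t)] at h5
  omega

theorem shp_eq (hG : Gate N M X g f k) {s t : α} (hs : s ∈ X) (ht : t ∈ X) :
    M.shp (f s) (f t) = N.shp s t := by
  refine N.shp_transfer_of_injOn M f X s hG.subset hG.map_mem hs hG.injOn hG.mult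
    (fun x hx => (hG.dist_eq hs hx).2) hG.adj ?_ ?_ ht
  · intro x hx t ht hxt hd
    by_contra hxX
    obtain rfl := hG.gate t ht x hxX hxt.symm
    have := hG.dist_add hs hxX ((hG.conn s hs).symm.trans hxt.symm.reachable)
    omega
  · intro y _ t ht hyt _
    exact hG.closed t ht y hyt.symm

theorem frac_eq (hG : Gate N M X g f k) {s w t : α} (hs : s ∈ X) (hw : w ∈ X) (ht : t ∈ X) :
    M.frac (f s) (f w) (f t) = N.frac s w t :=
  N.frac_congr M (hG.dist_eq hs hw).2 (hG.dist_eq hw ht).2 (hG.dist_eq hs ht).2 (hG.shp_eq hs hw)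
    (hG.shp_eq hw ht) (hG.shp_eq hs ht) (hG.mult w hw)

/-- Shortest paths to the outside split at `g`; the product on the right contains the multiplicity
of `g` twice. -/
theorem shp_mul (hG : Gate N M X g f k) {s t : α} (hs : s ∈ X) (ht : t ∉ X)
    (h : N.graph.Reachable g t) : N.shp s t * N.mult g = N.shp s g * N.shp g t := by
  classical
  have hsg := (hG.conn s hs).symm
  induction hn : N.graph.dist g t using Nat.strong_induction_on generalizing t with
  | _ n ih =>
  subst hn
  have hst : s ≠ t := by rintro rfl; exact ht hs
  rw [N.shp_eq_sum_preds hst, N.shp_eq_sum_preds (hG.ne_gate ht)]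
  -- All distances from `s` to the outside exceed those from `g` by the same constant, so `t` has
  -- the same predecessors for both sources.
  have hset : (N.verts.filter fun v => N.graph.Adj v t ∧
        N.graph.dist s t = N.graph.dist s v + 1) =
      N.verts.filter fun v => N.graph.Adj v t ∧ N.graph.dist g t = N.graph.dist g v + 1 := by
    refine Finset.filter_congr fun v _ => and_congr_right fun hv => ?_
    have h1 := hG.dist_add hs ht (hsg.trans h)
    by_cases hvX : v ∈ X
    · obtain rfl := hG.gate v hvX t ht hv
      rw [SimpleGraph.dist_self]
      omega
    · have h2 := hG.dist_add hs hvX (hsg.trans (h.trans hv.symm.reachable))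
      omega
  rw [hset, mul_assoc, mul_left_comm (N.shp s g)]
  congr 1
  rw [Finset.sum_mul, Finset.mul_sum]
  refine Finset.sum_congr rfl fun v hv => ?_
  obtain ⟨-, h1, h2⟩ := Finset.mem_filter.1 hv
  by_cases hvX : v ∈ X
  · obtain rfl := hG.gate v hvX t ht h1
    rw [N.shp_self]
  · exact ih _ (by omega) hvX (h.trans h1.symm.reachable) rfl

/-- By `shp_mul`, the counts from `s` and from `w` to `t` carry the same factor `shp g t / mult g`,
which cancels. An outside endpoint can therefore be replaced by `g`. -/
theorem frac_eq_gate (hG : Gate N M X g f k) {s w t : α} (hs : s ∈ X) (hw : w ∈ X)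
    (ht : t ∉ X) (h : N.graph.Reachable g t) : N.frac s w t = N.frac s w g := by
  have hg := (N.mult_pos g (hG.subset hG.mem)).ne'
  have hgt := (N.shp_pos (hG.subset hG.mem) h).ne'
  have e1 := hG.shp_mul hs ht h
  have e2 := hG.shp_mul hw ht h
  have d1 := hG.dist_add hs ht ((hG.conn s hs).symm.trans h)
  have d2 := hG.dist_add hw ht ((hG.conn w hw).symm.trans h)
  have hsg := (N.shp_pos (hG.subset hs) (hG.conn s hs).symm).ne'
  have hst := (N.shp_pos (hG.subset hs) ((hG.conn s hs).symm.trans h)).ne'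
  have hww := (N.mult_pos w (hG.subset hw)).ne'
  unfold frac
  have hiff : N.graph.dist s w + N.graph.dist w t = N.graph.dist s t ↔
      N.graph.dist s w + N.graph.dist w g = N.graph.dist s g := by omega
  by_cases hc : N.graph.dist s w + N.graph.dist w g = N.graph.dist s g
  · rw [if_pos (hiff.2 hc), if_pos hc, div_eq_div_iff (by positivity) (by positivity)]
    apply mul_right_cancel₀ hg
    linear_combination (N.shp s w * N.mult w ^ 2 * N.shp s g) * e2 -
      (N.shp s w * N.shp w g * N.mult w ^ 2) * e1
  · rw [if_neg fun h => hc (hiff.1 h), if_neg hc]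

theorem frac_gate (hG : Gate N M X g f k) {s t : α} (hs : s ∈ X)
    (ht : t ∉ X) (h : N.graph.Reachable g t) : N.frac s g t = 1 / N.mult g := by
  rw [hG.frac_eq_gate hs hG.mem ht h,
    N.frac_self_right (hG.subset hs) (hG.subset hG.mem) (hG.conn s hs).symm]

theorem frac_eq_zero (hG : Gate N M X g f k) {s w t : α} (hs : s ∉ X) (hw : w ∈ X)
    (hwg : w ≠ g) (ht : t ∉ X) : N.frac s w t = 0 := by
  by_contra h
  obtain ⟨h1, h2, h3⟩ := N.reachable_of_frac_ne_zero h
  have hgs := (hG.conn w hw).trans h1.symm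
  have h4 := hG.dist_add hw hs h1.symm
  have h5 := hG.dist_add hw ht h2
  have h6 := (hG.conn w hw).symm.pos_dist_of_ne hwg
  have h7 := hgs.symm.dist_triangle_left t
  rw [N.graph.dist_comm (u := w), N.graph.dist_comm (u := g) (v := s)] at h4
  omega

end Gate

theorem btw_eq_of_subset [DecidableEq α] (N : Net α) (R : α → ℚ) {w : α} {B : Finset α}
    (hB : B ⊆ N.verts) (hw : ∀ x ∈ N.verts, N.graph.Reachable w x → x ∈ B) : N.btw R w =
    ∑ s ∈ B.erase w, ∑ t ∈ B.erase w, R s * R t * N.frac s w t := by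
  rw [btw_eq]
  have hsub := Finset.erase_subset_erase w hB
  have hz : ∀ s ∈ N.verts.erase w, s ∉ B.erase w → ∀ t, N.frac s w t = 0 := by
    intro s hs hs' t
    by_contra h
    have h1 := (N.reachable_of_frac_ne_zero h).1
    obtain ⟨h2, h3⟩ := Finset.mem_erase.1 hs
    exact hs' (Finset.mem_erase.2 ⟨h2, hw s h3 h1.symm⟩)
  symm
  rw [← Finset.sum_subset hsub fun s hs hs' =>
    Finset.sum_eq_zero fun t _ => by rw [hz s hs hs', mul_zero]]
  refine Finset.sum_congr rfl fun s _ => Finset.sum_subset hsub fun t ht ht' => ?_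
  rw [frac_comm, hz t ht ht', mul_zero]

theorem rest_eq_of_mem [DecidableEq α] (N : Net α) (R : α → ℚ) {w : α} {B : Finset α}
    (hB : ∀ x, x ∈ B ↔ x ∈ N.verts ∧ N.graph.Reachable w x) :
    N.rest R w = ∑ s ∈ B.erase w, R s := by
  classical
  rw [rest_eq]
  refine Finset.sum_congr (congrArg (fun B => Finset.erase B w) ?_) fun _ _ => rfl
  ext x
  rw [Finset.mem_filter, hB]

namespace Gate

variable {N : Net α} {M : Net β} {X : Finset α} {g : α} {f : α → β} {k : β → α}

theorem reachable_iff (hG : Gate N M X g f k) [DecidableEq β] {w : α} (hw : w ∈ X) (y : β) :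
    y ∈ X.image f ↔ y ∈ M.verts ∧ M.graph.Reachable (f w) y := by
  constructor
  · intro hy
    obtain ⟨x, hx, rfl⟩ := Finset.mem_image.1 hy
    exact ⟨hG.map_mem x hx, (hG.dist_eq hw hx).1.2 ((hG.conn w hw).symm.trans (hG.conn x hx))⟩
  · rintro ⟨-, ⟨p⟩⟩
    suffices ∀ a b, M.graph.Walk a b → a ∈ X.image f → b ∈ X.image f from
      this _ _ p (Finset.mem_image_of_mem f hw)
    intro a b p
    induction p with
    | nil => exact id
    | cons h p ih =>
      intro ha
      obtain ⟨x, hx, rfl⟩ := Finset.mem_image.1 ha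
      obtain ⟨y, hy, rfl⟩ := hG.closed x hx _ h
      exact ih (Finset.mem_image_of_mem f hy)

theorem map_btw_eq [DecidableEq α] (hG : Gate N M X g f k) (R' : β → ℚ) {w : α} (hw : w ∈ X) :
    M.btw R' (f w) =
    ∑ s ∈ X.erase w, ∑ t ∈ X.erase w, R' (f s) * R' (f t) * N.frac s w t := by
  classical
  rw [M.btw_eq_of_subset R' (B := X.image f) (Finset.image_subset_iff.2 hG.map_mem)
    fun x hx h => (hG.reachable_iff hw x).2 ⟨hx, h⟩]
  have hset : (X.image f).erase (f w) = (X.erase w).image f := by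
    ext y
    simp only [Finset.mem_erase, Finset.mem_image]
    constructor
    · rintro ⟨h, x, hx, rfl⟩
      exact ⟨x, ⟨fun h' => h (by rw [h']), hx⟩, rfl⟩
    · rintro ⟨x, ⟨hxw, hx⟩, rfl⟩
      exact ⟨fun h' => hxw (hG.injOn hx hw h'), x, hx, rfl⟩
  have hinj : Set.InjOn f (X.erase w : Finset α) :=
    hG.injOn.mono (Finset.coe_subset.2 (Finset.erase_subset _ _))
  rw [hset, Finset.sum_image hinj]
  refine Finset.sum_congr rfl fun s hs => ?_
  rw [Finset.sum_image hinj]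
  exact Finset.sum_congr rfl fun t ht => by
    rw [hG.frac_eq (Finset.mem_of_mem_erase hs) hw (Finset.mem_of_mem_erase ht)]

theorem map_rest_eq [DecidableEq α] (hG : Gate N M X g f k) (R' : β → ℚ) {w : α} (hw : w ∈ X) :
    M.rest R' (f w) = ∑ s ∈ X.erase w, R' (f s) := by
  classical
  rw [M.rest_eq_of_mem R' (hG.reachable_iff hw)]
  have hset : (X.image f).erase (f w) = (X.erase w).image f := by
    ext y
    simp only [Finset.mem_erase, Finset.mem_image]
    constructor
    · rintro ⟨h, x, hx, rfl⟩
      exact ⟨x, ⟨fun h' => h (by rw [h']), hx⟩, rfl⟩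
    · rintro ⟨x, ⟨hxw, hx⟩, rfl⟩
      exact ⟨fun h' => hxw (hG.injOn hx hw h'), x, hx, rfl⟩
  rw [hset, Finset.sum_image
    (hG.injOn.mono (Finset.coe_subset.2 (Finset.erase_subset _ _)))]

section Outside

variable [DecidableEq α] {O : Finset α}

theorem disjoint_outside
    (hO : ∀ x, x ∈ O ↔ x ∈ N.verts ∧ x ∉ X ∧ N.graph.Reachable g x) (w : α) :
    Disjoint (X.erase w) O :=
  Finset.disjoint_left.2 fun x hx hx' => ((hO x).1 hx').2.1 (Finset.mem_of_mem_erase hx)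

theorem erase_union_outside
    (hO : ∀ x, x ∈ O ↔ x ∈ N.verts ∧ x ∉ X ∧ N.graph.Reachable g x) {w : α} (hw : w ∈ X) :
    (X ∪ O).erase w = X.erase w ∪ O := by
  rw [Finset.erase_union_distrib, Finset.erase_eq_of_notMem (s := O)]
  exact fun h => ((hO w).1 h).2.1 hw

theorem mem_union_iff (hG : Gate N M X g f k)
    (hO : ∀ x, x ∈ O ↔ x ∈ N.verts ∧ x ∉ X ∧ N.graph.Reachable g x) {w : α} (hw : w ∈ X) (x : α) :
    x ∈ X ∪ O ↔ x ∈ N.verts ∧ N.graph.Reachable w x := by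
  rw [Finset.mem_union, hO]
  constructor
  · rintro (h | ⟨h1, h2, h3⟩)
    · exact ⟨hG.subset h, (hG.conn w hw).symm.trans (hG.conn x h)⟩
    · exact ⟨h1, (hG.conn w hw).symm.trans h3⟩
  · rintro ⟨h1, h2⟩
    by_cases hx : x ∈ X
    · exact Or.inl hx
    · exact Or.inr ⟨h1, hx, (hG.conn w hw).trans h2⟩

theorem rest_eq (hG : Gate N M X g f k)
    (hO : ∀ x, x ∈ O ↔ x ∈ N.verts ∧ x ∉ X ∧ N.graph.Reachable g x) (R : α → ℚ) {w : α}
    (hw : w ∈ X) : N.rest R w = ∑ s ∈ X.erase w, R s + ∑ s ∈ O, R s := by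
  rw [N.rest_eq_of_mem R (hG.mem_union_iff hO hw), erase_union_outside hO hw,
    Finset.sum_union (disjoint_outside hO w)]

/-- `O` is the part of the component outside `X`. The pairs are sorted by the side of each endpoint;
in the two mixed sums the outside endpoint is replaced by `g`. -/
theorem btw_eq (hG : Gate N M X g f k)
    (hO : ∀ x, x ∈ O ↔ x ∈ N.verts ∧ x ∉ X ∧ N.graph.Reachable g x) (R : α → ℚ) {w : α}
    (hw : w ∈ X) : N.btw R w =
      ∑ s ∈ X.erase w, ∑ t ∈ X.erase w, R s * R t * N.frac s w t +
      2 * ((∑ t ∈ O, R t) * ∑ s ∈ X.erase w, R s * N.frac s w g) +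
      ∑ s ∈ O, ∑ t ∈ O, R s * R t * N.frac s w t := by
  rw [N.btw_eq_of_subset R (B := X ∪ O)
    (fun x hx => ((hG.mem_union_iff hO hw x).1 hx).1)
    (fun x hx h => (hG.mem_union_iff hO hw x).2 ⟨hx, h⟩), erase_union_outside hO hw,
    Finset.sum_union (disjoint_outside hO w)]
  simp only [Finset.sum_union (disjoint_outside hO w), Finset.sum_add_distrib]
  have e : ∑ s ∈ X.erase w, ∑ t ∈ O, R s * R t * N.frac s w t =
      (∑ t ∈ O, R t) * ∑ s ∈ X.erase w, R s * N.frac s w g := by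
    rw [Finset.sum_mul_sum, Finset.sum_comm]
    refine Finset.sum_congr rfl fun t ht => Finset.sum_congr rfl fun s hs => ?_
    obtain ⟨-, h1, h2⟩ := (hO t).1 ht
    rw [hG.frac_eq_gate (Finset.mem_of_mem_erase hs) hw h1 h2]
    ring
  have e' : ∑ s ∈ O, ∑ t ∈ X.erase w, R s * R t * N.frac s w t =
      ∑ s ∈ X.erase w, ∑ t ∈ O, R s * R t * N.frac s w t := by
    rw [Finset.sum_comm]
    refine Finset.sum_congr rfl fun t _ => Finset.sum_congr rfl fun s _ => ?_
    rw [N.frac_comm]; ring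
  rw [e', e]
  ring

/-- Away from the gate, all that matters of the vertices outside is their total weight. -/
theorem btw_map (hG : Gate N M X g f k)
    (hO : ∀ x, x ∈ O ↔ x ∈ N.verts ∧ x ∉ X ∧ N.graph.Reachable g x) {R : α → ℚ} {R' : β → ℚ}
    (hR : ∀ x ∈ X, x ≠ g → R' (f x) = R x) (hRg : R' (f g) = R g + ∑ s ∈ O, R s) {w : α}
    (hw : w ∈ X) (hwg : w ≠ g) : M.btw R' (f w) = N.btw R w := by
  have hg : g ∈ X.erase w := Finset.mem_erase.2 ⟨hwg.symm, hG.mem⟩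
  -- A shortest path between outside vertices enters `X` at most in `g`, and `w ≠ g`.
  have hOO : ∑ s ∈ O, ∑ t ∈ O, R s * R t * N.frac s w t = 0 :=
    Finset.sum_eq_zero fun s hs => Finset.sum_eq_zero fun t ht => by
      rw [hG.frac_eq_zero ((hO s).1 hs).2.1 hw hwg ((hO t).1 ht).2.1, mul_zero]
  have hR' : ∀ x ∈ (X.erase w).erase g, R' (f x) = R x := fun x hx =>
    hR x (Finset.mem_of_mem_erase (Finset.mem_of_mem_erase hx)) (Finset.ne_of_mem_erase hx)
  -- With the endpoint `g` isolated, the weight of `O` that was added to `f g` reproduces the mixed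
  -- sums; the pair of `g` with itself contributes nothing.
  rw [hG.map_btw_eq R' hw, hG.btw_eq hO R hw, hOO, State.sum_sum_erase hg,
    State.sum_sum_erase hg, N.frac_endpoints_eq hwg.symm, ← Finset.add_sum_erase _ _ hg,
    N.frac_endpoints_eq hwg.symm, hRg]
  have e1 : ∀ Q : ℚ, ∑ t ∈ (X.erase w).erase g, Q * R' (f t) * N.frac g w t =
      Q * ∑ t ∈ (X.erase w).erase g, R t * N.frac t w g := fun Q => by
    rw [Finset.mul_sum]
    exact Finset.sum_congr rfl fun t ht => by rw [hR' t ht, N.frac_comm]; ring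
  have e1' : ∀ Q : ℚ, ∑ t ∈ (X.erase w).erase g, Q * R t * N.frac g w t =
      Q * ∑ t ∈ (X.erase w).erase g, R t * N.frac t w g := fun Q => by
    rw [Finset.mul_sum]
    exact Finset.sum_congr rfl fun t ht => by rw [N.frac_comm]; ring
  have e2 : ∀ Q : ℚ, ∑ t ∈ (X.erase w).erase g, R' (f t) * Q * N.frac t w g =
      Q * ∑ t ∈ (X.erase w).erase g, R t * N.frac t w g := fun Q => by
    rw [Finset.mul_sum]
    exact Finset.sum_congr rfl fun t ht => by rw [hR' t ht]; ring
  have e2' : ∀ Q : ℚ, ∑ t ∈ (X.erase w).erase g, R t * Q * N.frac t w g =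
      Q * ∑ t ∈ (X.erase w).erase g, R t * N.frac t w g := fun Q => by
    rw [Finset.mul_sum]
    exact Finset.sum_congr rfl fun t ht => by ring
  rw [e1, e1', e2, e2', Finset.sum_congr rfl fun s hs => Finset.sum_congr rfl fun t ht => by
    rw [hR' s hs, hR' t ht]]
  ring

theorem rest_map (hG : Gate N M X g f k)
    (hO : ∀ x, x ∈ O ↔ x ∈ N.verts ∧ x ∉ X ∧ N.graph.Reachable g x) {R : α → ℚ} {R' : β → ℚ}
    (hR : ∀ x ∈ X, x ≠ g → R' (f x) = R x) (hRg : R' (f g) = R g + ∑ s ∈ O, R s) {w : α}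
    (hw : w ∈ X) (hwg : w ≠ g) : M.rest R' (f w) = N.rest R w := by
  have hg : g ∈ X.erase w := Finset.mem_erase.2 ⟨hwg.symm, hG.mem⟩
  rw [hG.map_rest_eq R' hw, hG.rest_eq hO R hw, ← Finset.add_sum_erase _ _ hg,
    ← Finset.add_sum_erase _ R hg, hRg, Finset.sum_congr rfl fun x hx =>
      hR x (Finset.mem_of_mem_erase (Finset.mem_of_mem_erase hx)) (Finset.ne_of_mem_erase hx)]
  ring

/-- The gate itself: the shortest paths that start and end in `X`. -/
theorem btw_map_gate (hG : Gate N M X g f k) {R : α → ℚ} {R' : β → ℚ}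
    (hR : ∀ x ∈ X, x ≠ g → R' (f x) = R x) : M.btw R' (f g) =
    ∑ s ∈ X.erase g, ∑ t ∈ X.erase g, R s * R t * N.frac s g t := by
  rw [hG.map_btw_eq R' hG.mem]
  exact Finset.sum_congr rfl fun s hs => Finset.sum_congr rfl fun t ht => by
    rw [hR s (Finset.mem_of_mem_erase hs) (Finset.ne_of_mem_erase hs),
      hR t (Finset.mem_of_mem_erase ht) (Finset.ne_of_mem_erase ht)]

theorem rest_map_gate (hG : Gate N M X g f k) {R : α → ℚ} {R' : β → ℚ}
    (hR : ∀ x ∈ X, x ≠ g → R' (f x) = R x) : M.rest R' (f g) = ∑ s ∈ X.erase g, R s := by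
  rw [hG.map_rest_eq R' hG.mem]
  exact Finset.sum_congr rfl fun s hs =>
    hR s (Finset.mem_of_mem_erase hs) (Finset.ne_of_mem_erase hs)

end Outside

/-- A whole component. -/
theorem btw_map_of_closed (hG : Gate N M X g f k) (hX : ∀ x ∈ X, ∀ y, N.graph.Adj x y → y ∈ X)
    {R : α → ℚ} {R' : β → ℚ} (hR : ∀ x ∈ X, R' (f x) = R x) :
    M.btw R' (f g) = N.btw R g ∧ M.rest R' (f g) = N.rest R g := by
  classical
  have hr : ∀ y, N.graph.Reachable g y → y ∈ X := by
    rintro y ⟨p⟩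
    suffices ∀ a b, N.graph.Walk a b → a ∈ X → b ∈ X from this _ _ p hG.mem
    intro a b p
    induction p with
    | nil => exact id
    | cons h p ih => exact fun ha => ih (hX _ ha _ h)
  -- Nothing lies outside, so any vertex of the component can serve as gate.
  have hO : ∀ x, x ∈ (∅ : Finset α) ↔ x ∈ N.verts ∧ x ∉ X ∧ N.graph.Reachable g x := fun x =>
    ⟨fun h => absurd h (Finset.notMem_empty x), fun h => absurd (hr x h.2.2) h.2.1⟩
  rw [hG.btw_eq hO R hG.mem, hG.rest_eq hO R hG.mem,
    hG.btw_map_gate fun x hx _ => hR x hx, hG.rest_map_gate fun x hx _ => hR x hx]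
  simp

end Gate

end Net

end BCNet

namespace BCNet

namespace State

variable {V : Type*} {S : State V}

/-! ### Bridges -/

theorem mem_comp {H : SimpleGraph (Copy V)} {u x : Copy V} :
    x ∈ S.comp H u ↔ x ∈ S.live ∧ H.Reachable u x := by
  classical exact Finset.mem_filter

theorem Valid.removeBridge (h : S.Valid) (u v : Copy V) : (S.removeBridge u v).Valid where
  adj_mem a b hab := h.adj_mem a b (SimpleGraph.deleteEdges_le _ hab)
  mem_cls := h.mem_cls
  disj := h.disj
  cls_sub := h.cls_sub

/-- The two classes are disjoint, so the order of the case distinction is immaterial. This reduces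
the side of `v` to the side of `u`. -/
theorem Valid.removeBridge_comm (h : S.Valid) {u v : Copy V} (hadj : S.graph.Adj u v) :
    S.removeBridge u v = S.removeBridge v u := by
  have hd : ∀ c, c ∈ S.cls u → c ∉ S.cls v := fun c hu hv =>
    hadj.ne (h.disj u (h.adj_mem _ _ hadj) v (h.adj_mem _ _ hadj.symm) c hu hv)
  unfold State.removeBridge
  congr 1
  · rw [Sym2.eq_swap]
  · funext c
    by_cases hu : c ∈ S.cls u <;> by_cases hv : c ∈ S.cls v <;> simp only [hu, hv, if_true, if_false]
    exact absurd hv (hd c hu)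
  · funext c
    by_cases hu : c ∈ S.cls u <;> by_cases hv : c ∈ S.cls v <;> simp only [hu, hv, if_true, if_false]
    exact absurd hv (hd c hu)

theorem removeBridge_adj (u v a b : Copy V) : (S.graph.deleteEdges {s(u, v)}).Adj a b ↔
    S.graph.Adj a b ∧ ¬ (a = u ∧ b = v ∨ a = v ∧ b = u) := by
  rw [SimpleGraph.deleteEdges_adj, Set.mem_singleton_iff, Sym2.eq_iff]

theorem reachable_bridge (u v : Copy V) {a x : Copy V} (h : S.graph.Reachable a x)
    (ha : (S.graph.deleteEdges {s(u, v)}).Reachable u a ∨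
      (S.graph.deleteEdges {s(u, v)}).Reachable v a) :
    (S.graph.deleteEdges {s(u, v)}).Reachable u x ∨
      (S.graph.deleteEdges {s(u, v)}).Reachable v x := by
  obtain ⟨p⟩ := h
  induction p with
  | nil => exact ha
  | cons hadj p ih =>
    rename_i a b x
    refine ih ?_
    by_cases hab : (S.graph.deleteEdges {s(u, v)}).Adj a b
    · exact ha.imp (fun h => h.trans hab.reachable) fun h => h.trans hab.reachable
    · rw [removeBridge_adj, not_and, not_not] at hab
      rcases hab hadj with ⟨-, rfl⟩ | ⟨-, rfl⟩
      · exact Or.inr .rfl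
      · exact Or.inl .rfl

theorem Valid.gate_bridge (h : S.Valid) {u v : Copy V} (hadj : S.graph.Adj u v)
    (hb : S.graph.IsBridge s(u, v)) :
    Net.Gate h.net (h.removeBridge u v).net (S.comp (S.graph.deleteEdges {s(u, v)}) u) u id id where
  subset x hx := (mem_comp.1 hx).1
  mem := mem_comp.2 ⟨h.adj_mem _ _ hadj, .rfl⟩
  conn x hx := (mem_comp.1 hx).2.mono (SimpleGraph.deleteEdges_le _)
  gate x hx y hy hxy := by
    by_contra hne
    have hx' := (mem_comp.1 hx).2
    refine hy (mem_comp.2 ⟨h.net.adj_mem' hxy, hx'.trans (SimpleGraph.Adj.reachable ?_)⟩)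
    refine (removeBridge_adj u v x y).2 ⟨hxy, ?_⟩
    rintro (⟨rfl, -⟩ | ⟨rfl, -⟩)
    · exact hne rfl
    · exact hb hx'
  map_mem x hx := (mem_comp.1 hx).1
  left_inv _ _ := rfl
  adj x hx y hy := by
    refine ⟨fun hxy => (removeBridge_adj u v x y).2 ⟨hxy, ?_⟩,
      fun hxy => ((removeBridge_adj u v x y).1 hxy).1⟩
    rintro (⟨-, rfl⟩ | ⟨rfl, -⟩)
    · exact hb (mem_comp.1 hy).2
    · exact hb (mem_comp.1 hx).2
  closed x hx y hxy := ⟨y, mem_comp.2 ⟨(h.removeBridge u v).net.adj_mem' hxy,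
    (mem_comp.1 hx).2.trans (SimpleGraph.Adj.reachable hxy)⟩, rfl⟩
  mult _ _ := rfl

theorem Valid.mem_bridge_outside (h : S.Valid) {u v : Copy V} (hadj : S.graph.Adj u v)
    (hb : S.graph.IsBridge s(u, v)) (x : Copy V) :
    x ∈ S.comp (S.graph.deleteEdges {s(u, v)}) v ↔ x ∈ h.net.verts ∧
      x ∉ S.comp (S.graph.deleteEdges {s(u, v)}) u ∧ h.net.graph.Reachable u x := by
  rw [mem_comp, mem_comp]
  constructor
  · rintro ⟨h1, h2⟩
    exact ⟨h1, fun h3 => hb (h3.2.trans h2.symm),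
      hadj.reachable.trans (h2.mono (SimpleGraph.deleteEdges_le _))⟩
  · rintro ⟨h1, h2, h3⟩
    refine ⟨h1, (reachable_bridge u v h3 (Or.inl .rfl)).resolve_left fun h4 => h2 ⟨h1, h4⟩⟩

theorem Valid.removeBridge_weight (h : S.Valid) {u v : Copy V} (hu : u ∈ S.live) :
    (S.removeBridge u v).weight u = S.weight u + S.sideWeight v u := by
  classical
  have e : ∀ m ∈ S.cls u, (S.removeBridge u v).reach m =
      S.reach m + S.sideWeight v u / S.ident u := fun m hm => if_pos hm
  have h0 := (h.net.mult_pos u hu).ne'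
  change (S.ident u : ℚ) ≠ 0 at h0
  rw [weight]
  change ∑ m ∈ S.cls u, _ = _
  rw [Finset.sum_congr rfl e, Finset.sum_add_distrib, Finset.sum_const, nsmul_eq_mul, weight]
  change _ + (S.ident u : ℚ) * _ = _
  field_simp

theorem Valid.removeBridge_weight_of_ne (h : S.Valid) {u v w : Copy V} (hu : u ∈ S.live)
    (hv : v ∈ S.live) (hw : w ∈ S.live) (hwu : w ≠ u) (hwv : w ≠ v) :
    (S.removeBridge u v).weight w = S.weight w := by
  rw [weight, weight]
  refine Finset.sum_congr rfl fun m hm => ?_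
  have h1 : m ∉ S.cls u := fun h' => hwu (h.disj w hw u hu m hm h')
  have h2 : m ∉ S.cls v := fun h' => hwv (h.disj w hw v hv m hm h')
  simp only [State.removeBridge, h1, h2, if_false]

/-- The scores of the copies on the side of `u`. -/
theorem Valid.finalScore_removeBridge_side (h : S.Valid) {u v : Copy V}
    (hadj : S.graph.Adj u v) (hb : S.graph.IsBridge s(u, v)) {w c : Copy V}
    (hw : w ∈ S.comp (S.graph.deleteEdges {s(u, v)}) u) (hc : c ∈ S.cls w) :
    (S.removeBridge u v).finalScore c = S.finalScore c := by
  classical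
  have hu := h.adj_mem _ _ hadj
  have hv := h.net.adj_mem' hadj
  have hG := h.gate_bridge hadj hb
  have hO := h.mem_bridge_outside hadj hb
  have hwl : w ∈ S.live := (mem_comp.1 hw).1
  have hT : S.sideWeight v u = ∑ x ∈ S.comp (S.graph.deleteEdges {s(u, v)}) v, S.weight x := by
    rw [sideWeight, Sym2.eq_swap]
  have hvX : ∀ x ∈ S.comp (S.graph.deleteEdges {s(u, v)}) u, x ≠ v := by
    rintro x hx rfl
    exact hb (mem_comp.1 hx).2
  have hR : ∀ x ∈ S.comp (S.graph.deleteEdges {s(u, v)}) u, x ≠ u →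
      (S.removeBridge u v).weight (id x) = S.weight x := fun x hx hxu =>
    h.removeBridge_weight_of_ne hu hv (mem_comp.1 hx).1 hxu (hvX x hx)
  have hRg : (S.removeBridge u v).weight (id u) = S.weight u +
      ∑ x ∈ S.comp (S.graph.deleteEdges {s(u, v)}) v, S.weight x := by
    rw [← hT]; exact h.removeBridge_weight hu
  rw [h.finalScore_of_mem hwl hc,
    (h.removeBridge u v).finalScore_of_mem (S := S.removeBridge u v) hwl hc]
  have hcv : c ∉ S.cls v := fun h' => hvX w hw (h.disj w hwl v hv c hc h')
  -- Away from `u`, the weight beyond the bridge acts as if placed on `u`, so nothing changes.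
  by_cases hwu : w = u
  swap
  · have hcu : c ∉ S.cls u := fun h' => hwu (h.disj w hwl u hu c hc h')
    have e1 := hG.btw_map hO hR hRg hw hwu
    have e2 := hG.rest_map hO hR hRg hw hwu
    rw [id] at e1 e2
    rw [e1, e2]
    simp only [State.removeBridge, hcu, hcv, if_false]
  · subst hwu
    have e1 := hG.btw_map_gate hR
    have e2 := hG.rest_map_gate hR
    rw [id] at e1 e2
    rw [e1, e2, hG.rest_eq hO S.weight hw, hG.btw_eq hO S.weight hw, ← hT]
    -- Seen from the other side, with gate `v`, the endpoint `w` is outside; hence no shortest path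
    -- between two vertices beyond the bridge meets it.
    have hG' : Net.Gate h.net ((h.removeBridge v w).net)
        (S.comp (S.graph.deleteEdges {s(w, v)}) v) v id id := by
      have := h.gate_bridge hadj.symm (by rwa [Sym2.eq_swap])
      rwa [Sym2.eq_swap] at this
    have e3 : ∑ s ∈ S.comp (S.graph.deleteEdges {s(w, v)}) v,
        ∑ t ∈ S.comp (S.graph.deleteEdges {s(w, v)}) v,
          S.weight s * S.weight t * h.net.frac s w t = 0 :=
      Finset.sum_eq_zero fun s hs => Finset.sum_eq_zero fun t ht => by
        rw [hG'.frac_eq_zero_of_notMem hs (fun hw' => ((hO w).1 hw').2.1 hw) ht, mul_zero]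
    have e4 : ∑ s ∈ (S.comp (S.graph.deleteEdges {s(w, v)}) w).erase w,
        S.weight s * h.net.frac s w w =
        (∑ s ∈ (S.comp (S.graph.deleteEdges {s(w, v)}) w).erase w, S.weight s) / S.ident w := by
      rw [Finset.sum_div]
      refine Finset.sum_congr rfl fun s hs => ?_
      have hs' := Finset.mem_of_mem_erase hs
      rw [h.net.frac_self_right (hG.subset hs') hwl (hG.conn s hs').symm, mul_one_div]
      rfl
    have e5 : S.sideWeight w v - S.weight w =
        ∑ s ∈ (S.comp (S.graph.deleteEdges {s(w, v)}) w).erase w, S.weight s := by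
      rw [sideWeight, ← Finset.add_sum_erase _ _ hw, add_sub_cancel_left]
    have e6 : (S.removeBridge w v).score c = S.score c + ((S.reach c - 1) +
        (S.sideWeight w v - S.weight w) / S.ident w) * S.sideWeight v w := if_pos hc
    have e7 : (S.removeBridge w v).reach c = S.reach c + S.sideWeight v w / S.ident w :=
      if_pos hc
    rw [e3, e4, e6, e5, e7]
    -- Of the two equal mixed sums, the one with sources beyond the bridge is in the new score, and
    -- the one with targets there comes from the increased reach times the remaining `rest`. The
    -- pairs from beyond the bridge to targets already behind `c` are in the score too.
    ring

theorem Valid.finalScore_removeBridge (h : S.Valid) {u v : Copy V}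
    (hadj : S.graph.Adj u v) (hb : S.graph.IsBridge s(u, v)) (c : Copy V) :
    (S.removeBridge u v).finalScore c = S.finalScore c := by
  classical
  have hu := h.adj_mem _ _ hadj
  have hv := h.net.adj_mem' hadj
  by_cases hex : ∃ w ∈ S.live, c ∈ S.cls w
  swap
  · push Not at hex
    rw [finalScore_of_notMem (S := S.removeBridge u v) hex, finalScore_of_notMem hex]
    have h1 := hex u hu
    have h2 := hex v hv
    simp only [State.removeBridge, h1, h2, if_false]
  obtain ⟨w, hw, hc⟩ := hex
  by_cases hwu : w ∈ S.comp (S.graph.deleteEdges {s(u, v)}) u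
  · exact h.finalScore_removeBridge_side hadj hb hwu hc
  by_cases hwv : w ∈ S.comp (S.graph.deleteEdges {s(u, v)}) v
  · rw [h.removeBridge_comm hadj]
    rw [Sym2.eq_swap] at hwv hb
    exact h.finalScore_removeBridge_side hadj.symm hb hwv hc
  have hnot : ∀ x ∈ S.comp S.graph w, x ≠ u ∧ x ≠ v := by
    intro x hx
    have hxw := (mem_comp.1 hx).2.symm
    have key := fun h' => (reachable_bridge u v hxw h').elim
      (fun h' => hwu (mem_comp.2 ⟨hw, h'⟩)) fun h' => hwv (mem_comp.2 ⟨hw, h'⟩)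
    constructor
    · rintro rfl; exact key (Or.inl .rfl)
    · rintro rfl; exact key (Or.inr .rfl)
  have hclosed : ∀ x ∈ S.comp S.graph w, ∀ y, S.graph.Adj x y → y ∈ S.comp S.graph w :=
    fun x hx y hxy => mem_comp.2 ⟨h.net.adj_mem' hxy, (mem_comp.1 hx).2.trans hxy.reachable⟩
  have hww : w ∈ S.comp S.graph w := mem_comp.2 ⟨hw, .rfl⟩
  have hG : Net.Gate h.net (h.removeBridge u v).net (S.comp S.graph w) w id id :=
    { subset := fun x hx => (mem_comp.1 hx).1
      mem := hww
      conn := fun x hx => (mem_comp.1 hx).2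
      gate := fun x hx y hy hxy => absurd (hclosed x hx y hxy) hy
      map_mem := fun x hx => (mem_comp.1 hx).1
      left_inv := fun _ _ => rfl
      adj := fun x hx y hy => ⟨fun hxy => (removeBridge_adj u v x y).2 ⟨hxy, by
          rintro (⟨h1, -⟩ | ⟨h1, -⟩)
          · exact (hnot x hx).1 h1
          · exact (hnot x hx).2 h1⟩, fun hxy => ((removeBridge_adj u v x y).1 hxy).1⟩
      closed := fun x hx y hxy => ⟨y, hclosed x hx y ((removeBridge_adj u v x y).1 hxy).1, rfl⟩
      mult := fun _ _ => rfl }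
  obtain ⟨e1, e2⟩ := hG.btw_map_of_closed hclosed (R := S.weight)
    (R' := (S.removeBridge u v).weight) fun x hx =>
      h.removeBridge_weight_of_ne hu hv (mem_comp.1 hx).1 (hnot x hx).1 (hnot x hx).2
  rw [id] at e1 e2
  have h1 : c ∉ S.cls u := fun h' => (hnot w hww).1 (h.disj w hw u hu c hc h')
  have h2 : c ∉ S.cls v := fun h' => (hnot w hww).2 (h.disj w hw v hv c hc h')
  rw [h.finalScore_of_mem hw hc, (h.removeBridge u v).finalScore_of_mem (S := S.removeBridge u v)
    hw hc, e1, e2]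
  simp only [State.removeBridge, h1, h2, if_false]

/-! ### Degree-1 vertices -/

theorem Valid.removeDegreeOne (h : S.Valid) (u v : Copy V) : (S.removeDegreeOne u v).Valid := by
  classical
  have := h.removeSide u
  exact ⟨this.adj_mem, this.mem_cls, this.disj, this.cls_sub⟩

/-- Reach values matter only on the classes of live vertices. Two routes to the same graph may thus
differ in the reach of removed copies. -/
theorem finalScore_congr {S T : State V} (hS : S.Valid) (hT : T.Valid) (hl : T.live = S.live)
    (hg : T.graph = S.graph) (hcls : T.cls = S.cls)
    (hr : ∀ w ∈ S.live, ∀ c ∈ S.cls w, T.reach c = S.reach c) {c : Copy V}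
    (hs : T.score c = S.score c) : T.finalScore c = S.finalScore c := by
  classical
  have hw : ∀ w ∈ S.live, T.weight w = S.weight w := fun w hw => by
    rw [weight, weight, hcls]; exact Finset.sum_congr rfl (hr w hw)
  obtain ⟨_, live, graph, cls, reach, score⟩ := S
  obtain ⟨_, live', graph', cls', reach', score'⟩ := T
  dsimp only at hl hg hcls hr hs
  subst hl hg hcls
  rw [hS.finalScore_eq, hT.finalScore_eq]
  congr 1
  refine Finset.sum_congr rfl fun w hwl => ?_
  dsimp only at hwl ⊢
  split_ifs with hc
  · have e1 : ∀ (R R' : Copy V → ℚ), (∀ x ∈ live', R' x = R x) →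
        hT.net.btw R' w = hS.net.btw R w := by
      intro R R' hR
      rw [Net.btw_eq, Net.btw_eq]
      refine Finset.sum_congr rfl fun s hs => Finset.sum_congr rfl fun t ht => ?_
      rw [hR s (Finset.mem_of_mem_erase hs), hR t (Finset.mem_of_mem_erase ht)]
      rfl
    have e2 : ∀ (R R' : Copy V → ℚ), (∀ x ∈ live', R' x = R x) →
        hT.net.rest R' w = hS.net.rest R w := by
      intro R R' hR
      rw [Net.rest_eq, Net.rest_eq]
      exact Finset.sum_congr rfl fun s hs =>
        hR s (Finset.mem_filter.1 (Finset.mem_of_mem_erase hs)).1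
    rw [e1 _ _ hw, e2 _ _ hw, hr w hwl c hc]
  · rfl

/-- The edge at `u` is a bridge. Removing it isolates `u`, which is then a side vertex whose removal
adds no score. -/
theorem Valid.finalScore_removeDegreeOne (h : S.Valid) {u v : Copy V}
    (hu : S.graph.neighborSet u = {v}) (c : Copy V) :
    (S.removeDegreeOne u v).finalScore c = S.finalScore c := by
  classical
  have hadj : S.graph.Adj u v := by
    rw [← SimpleGraph.mem_neighborSet, hu]; rfl
  have hN : ∀ x, S.graph.Adj u x → x = v := fun x hx => by
    rw [← SimpleGraph.mem_neighborSet, hu] at hx; exact hx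
  have hul := h.adj_mem _ _ hadj
  have hiso : ∀ x, ¬ (S.graph.deleteEdges {s(u, v)}).Adj u x := by
    intro x hx
    obtain ⟨h1, h2⟩ := (removeBridge_adj u v u x).1 hx
    exact h2 (Or.inl ⟨rfl, hN x h1⟩)
  have hreach : ∀ x, (S.graph.deleteEdges {s(u, v)}).Reachable u x → x = u := by
    rintro x ⟨p⟩
    cases p with
    | nil => rfl
    | cons h' _ => exact absurd h' (hiso _)
  have hb : S.graph.IsBridge s(u, v) := fun h' => hadj.ne (hreach v h').symm
  have hB := h.removeBridge u v
  have hcompu : ∀ T : State V, T.live = S.live →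
      T.comp (S.graph.deleteEdges {s(u, v)}) u = {u} := by
    intro T hT
    ext x
    rw [mem_comp, hT, Finset.mem_singleton]
    exact ⟨fun h' => hreach x h'.2, by rintro rfl; exact ⟨hul, .rfl⟩⟩
  have hswu : S.sideWeight u v = S.weight u := by
    rw [sideWeight, hcompu S rfl, Finset.sum_singleton]
  have hswv : S.sideWeight v u = S.restWeight u := by
    rw [sideWeight, restWeight, Sym2.eq_swap]
    refine Finset.sum_congr ?_ fun _ _ => rfl
    ext x
    rw [h.mem_bridge_outside hadj hb, hcompu S rfl, Finset.mem_erase, Finset.mem_singleton,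
      mem_comp]
    exact ⟨fun h' => ⟨h'.2.1, h'.1, h'.2.2⟩, fun h' => ⟨h'.2.1, h'.1, h'.2.2⟩⟩
  have hempty : ((S.removeBridge u v).comp (S.removeBridge u v).graph u).erase u = ∅ := by
    rw [show (S.removeBridge u v).graph = S.graph.deleteEdges {s(u, v)} from rfl,
      hcompu (S.removeBridge u v) rfl, Finset.erase_singleton]
  have hrw0 : (S.removeBridge u v).restWeight u = 0 := by
    rw [restWeight]
    convert Finset.sum_empty
  rw [← h.finalScore_removeBridge hadj hb c, ← hB.finalScore_removeSide (u := u) hul ?_ c]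
  · refine finalScore_congr (hB.removeSide u) (h.removeDegreeOne u v) rfl ?_ rfl ?_ ?_
    · ext a b
      change (S.graph.Adj a b ∧ _) ↔ ((S.graph.deleteEdges {s(u, v)}).Adj a b ∧ _)
      rw [removeBridge_adj]
      simp only [Finset.mem_singleton]
      constructor
      · rintro ⟨h1, h2, h3⟩
        exact ⟨⟨h1, fun h' => h'.elim (fun h' => h2 h'.1) fun h' => h3 h'.2⟩, h2, h3⟩
      · rintro ⟨⟨h1, -⟩, h2⟩
        exact ⟨h1, h2⟩
    · intro w hw c hc
      obtain ⟨hwu, hwl⟩ := Finset.mem_erase.1 hw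
      have hcu : c ∉ S.cls u := fun h' => hwu (h.disj w hwl u hul c hc h')
      simp only [State.removeDegreeOne, State.removeSide, State.removeBridge, hcu, if_false, hswu]
    · have e : ((S.removeBridge u v).removeSide u).score c = (S.removeBridge u v).score c := by
        have : ((S.removeBridge u v).removeSide u).score c = (S.removeBridge u v).score c
          + (if c ∈ (S.removeBridge u v).cls u then
              ((S.removeBridge u v).reach c - 1) * (S.removeBridge u v).restWeight u else 0)
          + ∑ w ∈ ((S.removeBridge u v).comp (S.removeBridge u v).graph u).erase u,
            if c ∈ (S.removeBridge u v).cls w then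
            (S.removeBridge u v).weight u * (S.removeBridge u v).delta u w c +
            (S.removeBridge u v).weight u * ((S.removeBridge u v).delta u w c -
              ((S.removeBridge u v).reach c - 1)) else 0 := rfl
        rw [this, hempty, hrw0]
        simp
      rw [e]
      simp only [State.removeDegreeOne, State.removeBridge, hswu, hswv, sub_self, zero_div,
        add_zero]
  · intro x hx
    exact absurd hx (hiso x)

end State

end BCNet

namespace BCNet

namespace State

variable {V : Type*} {S S' : State V} {u : Copy V}
  {cp : (S.deleteVerts {u}).ConnectedComponent → Copy V → Copy V}

/-! ### Articulation vertices -/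

theorem Valid.live_sub_copies (h : S.Valid) {c : Copy V} (hc : c ∈ S.live) : c ∈ S.copies :=
  h.cls_sub c hc (h.mem_cls c hc)

theorem deleteVerts_singleton_adj (a b : Copy V) :
    (S.deleteVerts {u}).Adj a b ↔ S.graph.Adj a b ∧ a ≠ u ∧ b ≠ u := by
  simp [deleteVerts]

theorem ShattersTo.cp_ne (hs : S.ShattersTo u cp S')
    {κ : (S.deleteVerts {u}).ConnectedComponent} (hκ : κ ∈ S.parts u) {m c : Copy V}
    (hm : m ∈ S.cls u) (hc : c ∈ S.copies) : c ≠ cp κ m := by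
  rintro rfl
  exact hs.fresh κ hκ m hm hc

theorem ShattersTo.valid (h : S.Valid) (hu : u ∈ S.live) (hs : S.ShattersTo u cp S') :
    S'.Valid where
  adj_mem a b hab := by
    rw [hs.live]
    rcases (hs.adj a b).1 hab with h' | ⟨κ, hκ, rfl, -, -⟩ | ⟨κ, hκ, rfl, h', -⟩
    · obtain ⟨h1, h2, -⟩ := (deleteVerts_singleton_adj a b).1 h'
      exact Or.inl ⟨h.adj_mem _ _ h1, h2⟩
    · exact Or.inr ⟨κ, hκ, rfl⟩
    · exact Or.inl ⟨h.net.adj_mem' h', h'.ne'⟩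
  mem_cls c hc := by
    rcases (hs.live c).1 hc with ⟨h1, h2⟩ | ⟨κ, hκ, rfl⟩
    · rw [hs.cls_old c h1 h2]; exact h.mem_cls c h1
    · exact (hs.cls_new κ hκ _).2 ⟨u, h.mem_cls u hu, rfl⟩
  disj a ha b hb c hca hcb := by
    rcases (hs.live a).1 ha with ⟨h1, h2⟩ | ⟨κ, hκ, rfl⟩ <;>
      rcases (hs.live b).1 hb with ⟨h3, h4⟩ | ⟨κ', hκ', rfl⟩
    · rw [hs.cls_old a h1 h2] at hca
      rw [hs.cls_old b h3 h4] at hcb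
      exact h.disj a h1 b h3 c hca hcb
    · rw [hs.cls_old a h1 h2] at hca
      obtain ⟨m, hm, rfl⟩ := (hs.cls_new κ' hκ' c).1 hcb
      exact absurd (h.cls_sub a h1 hca) (hs.fresh κ' hκ' m hm)
    · rw [hs.cls_old b h3 h4] at hcb
      obtain ⟨m, hm, rfl⟩ := (hs.cls_new κ hκ c).1 hca
      exact absurd (h.cls_sub b h3 hcb) (hs.fresh κ hκ m hm)
    · obtain ⟨m, hm, rfl⟩ := (hs.cls_new κ hκ c).1 hca
      obtain ⟨m', hm', he⟩ := (hs.cls_new κ' hκ' _).1 hcb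
      rw [(hs.inj κ hκ κ' hκ' m hm m' hm' he).1]
  cls_sub a ha c hc := by
    rw [hs.copies]
    rcases (hs.live a).1 ha with ⟨h1, h2⟩ | ⟨κ, hκ, rfl⟩
    · rw [hs.cls_old a h1 h2] at hc
      exact Or.inl (h.cls_sub a h1 hc)
    · obtain ⟨m, hm, rfl⟩ := (hs.cls_new κ hκ c).1 hc
      exact Or.inr ⟨κ, hκ, m, hm, rfl⟩

open Classical in
/-- The vertices of the part `κ`. -/
noncomputable def partVerts (S : State V) (u : Copy V)
    (κ : (S.deleteVerts {u}).ConnectedComponent) : Finset (Copy V) :=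
  ((S.comp S.graph u).erase u).filter
    fun x => (S.deleteVerts {u}).connectedComponentMk x = κ

theorem mem_partVerts {κ : (S.deleteVerts {u}).ConnectedComponent} {x : Copy V} :
    x ∈ S.partVerts u κ ↔ (x ∈ S.live ∧ x ≠ u ∧ S.graph.Reachable u x) ∧
      (S.deleteVerts {u}).connectedComponentMk x = κ := by
  classical
  rw [partVerts, Finset.mem_filter, Finset.mem_erase, mem_comp]
  tauto

theorem mem_partVerts_of_mem_parts {κ : (S.deleteVerts {u}).ConnectedComponent}
    (hκ : κ ∈ S.parts u) {x : Copy V} (hx : x ∈ S.live) (hxu : x ≠ u)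
    (hxκ : (S.deleteVerts {u}).connectedComponentMk x = κ) : x ∈ S.partVerts u κ := by
  refine mem_partVerts.2 ⟨⟨hx, hxu, ?_⟩, hxκ⟩
  obtain ⟨y, hy, -, hyκ⟩ := hκ
  have h1 := SimpleGraph.ConnectedComponent.exact (hyκ.trans hxκ.symm)
  exact (mem_comp.1 hy).2.trans (h1.mono (show S.deleteVerts {u} ≤ S.graph from fun _ _ hab => hab.1))

theorem mk_mem_parts {x : Copy V} (hx : x ∈ S.live) (hxu : x ≠ u) (hr : S.graph.Reachable u x) :
    (S.deleteVerts {u}).connectedComponentMk x ∈ S.parts u :=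
  ⟨x, mem_comp.2 ⟨hx, hr⟩, hxu, rfl⟩

theorem mk_eq_of_adj {x y : Copy V} (h : (S.deleteVerts {u}).Adj x y) :
    (S.deleteVerts {u}).connectedComponentMk x = (S.deleteVerts {u}).connectedComponentMk y :=
  SimpleGraph.ConnectedComponent.sound h.reachable

theorem ShattersTo.adj_old (h : S.Valid) (hu : u ∈ S.live) (hs : S.ShattersTo u cp S')
    {a b : Copy V} (ha : a ∈ S.copies) (hb : b ∈ S.copies) :
    S'.graph.Adj a b ↔ (S.deleteVerts {u}).Adj a b := by
  rw [hs.adj]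
  refine ⟨?_, Or.inl⟩
  rintro (h' | ⟨κ, hκ, h', -⟩ | ⟨κ, hκ, h', -⟩)
  · exact h'
  · exact absurd h' (hs.cp_ne hκ (h.mem_cls u hu) ha)
  · exact absurd h' (hs.cp_ne hκ (h.mem_cls u hu) hb)

theorem ShattersTo.adj_new (h : S.Valid) (hu : u ∈ S.live) (hs : S.ShattersTo u cp S')
    {κ : (S.deleteVerts {u}).ConnectedComponent} (hκ : κ ∈ S.parts u) (b : Copy V) :
    S'.graph.Adj (cp κ u) b ↔ S.graph.Adj u b ∧
      (S.deleteVerts {u}).connectedComponentMk b = κ := by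
  have hmu := h.mem_cls u hu
  rw [hs.adj]
  constructor
  · rintro (h' | ⟨κ', hκ', h', h2⟩ | ⟨κ', hκ', -, h2, -⟩)
    · exact absurd rfl (hs.cp_ne hκ hmu (h.live_sub_copies (h.adj_mem _ _ h'.1)))
    · rw [(hs.inj κ hκ κ' hκ' u hmu u hmu h').1]; exact h2
    · exact absurd rfl (hs.cp_ne hκ hmu (h.live_sub_copies (h.net.adj_mem' h2)))
  · rintro ⟨h1, h2⟩
    exact Or.inr (Or.inl ⟨κ, hκ, rfl, h1, h2⟩)

theorem ShattersTo.cls_eq_image [DecidableEq (Copy V)] (hs : S.ShattersTo u cp S')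
    {κ : (S.deleteVerts {u}).ConnectedComponent} (hκ : κ ∈ S.parts u) :
    S'.cls (cp κ u) = (S.cls u).image (cp κ) := by
  ext c
  rw [hs.cls_new κ hκ, Finset.mem_image]
  exact ⟨fun ⟨m, hm, he⟩ => ⟨m, hm, he.symm⟩, fun ⟨m, hm, he⟩ => ⟨m, hm, he.symm⟩⟩

theorem ShattersTo.cp_injOn (hs : S.ShattersTo u cp S')
    {κ : (S.deleteVerts {u}).ConnectedComponent} (hκ : κ ∈ S.parts u) :
    Set.InjOn (cp κ) (S.cls u) := fun m hm m' hm' he =>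
  (hs.inj κ hκ κ hκ m hm m' hm' he).2

-- A part together with `u` is attached to the rest only through `u`, and in the new graph it is a
-- component in which `cp κ u` plays the role of `u`.
open Classical in
theorem ShattersTo.gate (h : S.Valid) (hu : u ∈ S.live) (hs : S.ShattersTo u cp S')
    {κ : (S.deleteVerts {u}).ConnectedComponent} (hκ : κ ∈ S.parts u) :
    Net.Gate h.net (hs.valid h hu).net (insert u (S.partVerts u κ)) u
      (fun x => if x = u then cp κ u else x) (fun y => if y = cp κ u then u else y) := by
  have hmu := h.mem_cls u hu
  have hne : ∀ x ∈ S.live, x ≠ cp κ u := fun x hx =>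
    hs.cp_ne hκ hmu (h.live_sub_copies hx)
  have hmem : ∀ x, x ∈ insert u (S.partVerts u κ) → x ≠ u → x ∈ S.partVerts u κ :=
    fun x hx hxu => (Finset.mem_insert.1 hx).resolve_left hxu
  have hX : ∀ x ∈ insert u (S.partVerts u κ), x ∈ S.live := by
    intro x hx
    rcases Finset.mem_insert.1 hx with rfl | hx
    · exact hu
    · exact (mem_partVerts.1 hx).1.1
  refine ⟨hX, Finset.mem_insert_self _ _, ?_, ?_, ?_, ?_, ?_, ?_, ?_⟩
  · intro x hx
    rcases Finset.mem_insert.1 hx with rfl | hx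
    · exact .rfl
    · exact (mem_partVerts.1 hx).1.2.2
  · intro x hx y hy hxy
    by_contra hxu
    have hyu : y ≠ u := by rintro rfl; exact hy (Finset.mem_insert_self _ _)
    have hd := (deleteVerts_singleton_adj x y).2 ⟨hxy, hxu, hyu⟩
    exact hy (Finset.mem_insert_of_mem (mem_partVerts_of_mem_parts hκ (h.net.adj_mem' hxy) hyu
      ((mk_eq_of_adj hd).symm.trans (mem_partVerts.1 (hmem x hx hxu)).2)))
  · intro x hx
    refine (hs.live _).2 ?_
    by_cases hxu : x = u
    · rw [if_pos hxu]; exact Or.inr ⟨κ, hκ, rfl⟩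
    · rw [if_neg hxu]; exact Or.inl ⟨hX x hx, hxu⟩
  · intro x hx
    by_cases hxu : x = u
    · simp [hxu]
    · simp [hxu, hne x (hX x hx)]
  · intro x hx y hy
    change S.graph.Adj x y ↔ S'.graph.Adj _ _
    by_cases hxu : x = u <;> by_cases hyu : y = u <;> simp only [hxu, hyu, if_true, if_false]
    · simp
    · rw [hs.adj_new h hu hκ, (mem_partVerts.1 (hmem y hy hyu)).2]
      exact ⟨fun h' => ⟨h', rfl⟩, fun h' => h'.1⟩
    · rw [SimpleGraph.adj_comm, SimpleGraph.adj_comm _ x, hs.adj_new h hu hκ,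
        (mem_partVerts.1 (hmem x hx hxu)).2]
      exact ⟨fun h' => ⟨h', rfl⟩, fun h' => h'.1⟩
    · rw [hs.adj_old h hu (h.live_sub_copies (hX x hx)) (h.live_sub_copies (hX y hy)),
        deleteVerts_singleton_adj]
      exact ⟨fun h' => ⟨h', hxu, hyu⟩, fun h' => h'.1⟩
  · intro x hx b hxb
    change S'.graph.Adj _ b at hxb
    by_cases hxu : x = u <;> simp only [hxu, if_true, if_false] at hxb
    · obtain ⟨h1, h2⟩ := (hs.adj_new h hu hκ b).1 hxb
      exact ⟨b, Finset.mem_insert_of_mem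
        (mem_partVerts_of_mem_parts hκ (h.net.adj_mem' h1) h1.ne' h2), if_neg h1.ne'⟩
    · have hxκ := (mem_partVerts.1 (hmem x hx hxu)).2
      rcases (hs.live b).1 ((hs.valid h hu).net.adj_mem' hxb) with ⟨h1, h2⟩ | ⟨κ', hκ', rfl⟩
      · have hd := (hs.adj_old h hu (h.live_sub_copies (hX x hx)) (h.live_sub_copies h1)).1 hxb
        exact ⟨b, Finset.mem_insert_of_mem (mem_partVerts_of_mem_parts hκ h1 h2
          ((mk_eq_of_adj hd).symm.trans hxκ)), if_neg h2⟩
      · obtain ⟨h1, h2⟩ := (hs.adj_new h hu hκ' x).1 hxb.symm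
        refine ⟨u, Finset.mem_insert_self _ _, ?_⟩
        rw [if_pos rfl, ← h2, hxκ]
  · intro x hx
    change (S'.ident _ : ℚ) = S.ident x
    by_cases hxu : x = u
    · subst hxu
      rw [if_pos rfl, ident, hs.cls_eq_image hκ, Finset.card_image_of_injOn (hs.cp_injOn hκ),
        ident]
    · rw [if_neg hxu, ident, hs.cls_old x (hX x hx) hxu, ident]

open Classical in
theorem outside_eq (κ : (S.deleteVerts {u}).ConnectedComponent) : S.outside u κ =
    ∑ x ∈ (S.comp S.graph u).erase u with (S.deleteVerts {u}).connectedComponentMk x ≠ κ,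
      S.weight x := rfl

open Classical in
theorem mem_outside (κ : (S.deleteVerts {u}).ConnectedComponent) (h : S.Valid) (x : Copy V) :
    x ∈ ((S.comp S.graph u).erase u).filter
      (fun x => (S.deleteVerts {u}).connectedComponentMk x ≠ κ) ↔
    x ∈ h.net.verts ∧ x ∉ insert u (S.partVerts u κ) ∧ h.net.graph.Reachable u x := by
  rw [Finset.mem_filter, Finset.mem_erase, mem_comp, Finset.mem_insert, mem_partVerts]
  change _ ↔ x ∈ S.live ∧ _ ∧ S.graph.Reachable u x
  tauto

theorem ShattersTo.weight_old (h : S.Valid) (hs : S.ShattersTo u cp S') {x : Copy V}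
    (hx : x ∈ S.live) (hxu : x ≠ u) : S'.weight x = S.weight x := by
  rw [weight, weight, hs.cls_old x hx hxu]
  exact Finset.sum_congr rfl fun m hm => hs.reach_old m (h.cls_sub x hx hm)

theorem ShattersTo.weight_new (h : S.Valid) (hu : u ∈ S.live) (hs : S.ShattersTo u cp S')
    {κ : (S.deleteVerts {u}).ConnectedComponent} (hκ : κ ∈ S.parts u) :
    S'.weight (cp κ u) = S.weight u + S.outside u κ := by
  classical
  have h0 := (h.net.mult_pos u hu).ne'
  change (S.ident u : ℚ) ≠ 0 at h0
  rw [weight, hs.cls_eq_image hκ, Finset.sum_image (hs.cp_injOn hκ),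
    Finset.sum_congr rfl (hs.reach_new κ hκ), Finset.sum_add_distrib, Finset.sum_const,
    nsmul_eq_mul, weight]
  change _ + (S.ident u : ℚ) * _ = _
  field_simp

open Classical in
theorem ShattersTo.weight_map (h : S.Valid) (hs : S.ShattersTo u cp S')
    {κ : (S.deleteVerts {u}).ConnectedComponent} {x : Copy V}
    (hx : x ∈ insert u (S.partVerts u κ)) (hxu : x ≠ u) :
    S'.weight (if x = u then cp κ u else x) = S.weight x := by
  rw [if_neg hxu]
  exact hs.weight_old h (mem_partVerts.1 ((Finset.mem_insert.1 hx).resolve_left hxu)).1.1 hxu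

/-- The scores of the copies that are not merged into `u`. -/
theorem ShattersTo.finalScore_old (h : S.Valid) (hu : u ∈ S.live) (hs : S.ShattersTo u cp S')
    {c : Copy V} (hc : c ∈ S.copies) (hcu : c ∉ S.cls u) :
    S'.finalScore c = S.finalScore c := by
  classical
  have h' := hs.valid h hu
  have hnew : ∀ κ ∈ S.parts u, c ∉ S'.cls (cp κ u) := fun κ hκ hcκ => by
    obtain ⟨m, hm, rfl⟩ := (hs.cls_new κ hκ c).1 hcκ
    exact hs.fresh κ hκ m hm hc
  by_cases hex : ∃ w ∈ S.live, c ∈ S.cls w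
  swap
  · push Not at hex
    rw [finalScore_of_notMem hex, finalScore_of_notMem, hs.score_old c hc]
    intro w hw
    rcases (hs.live w).1 hw with ⟨h1, h2⟩ | ⟨κ, hκ, rfl⟩
    · rw [hs.cls_old w h1 h2]; exact hex w h1
    · exact hnew κ hκ
  obtain ⟨w, hw, hcw⟩ := hex
  have hwu : w ≠ u := by rintro rfl; exact hcu hcw
  rw [h.finalScore_of_mem hw hcw, h'.finalScore_of_mem ((hs.live w).2 (Or.inl ⟨hw, hwu⟩))
    (by rwa [hs.cls_old w hw hwu]), hs.score_old c hc, hs.reach_old c hc]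
  by_cases hr : S.graph.Reachable u w
  · have hκ := mk_mem_parts hw hwu hr
    have hG := hs.gate h hu hκ
    have hwX : w ∈ insert u (S.partVerts u ((S.deleteVerts {u}).connectedComponentMk w)) :=
      Finset.mem_insert_of_mem (mem_partVerts.2 ⟨⟨hw, hwu, hr⟩, rfl⟩)
    have hRg : S'.weight (if u = u then cp ((S.deleteVerts {u}).connectedComponentMk w) u else u) =
        S.weight u + ∑ x ∈ (S.comp S.graph u).erase u with
          (S.deleteVerts {u}).connectedComponentMk x ≠
            (S.deleteVerts {u}).connectedComponentMk w, S.weight x := by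
      rw [if_pos rfl, hs.weight_new h hu hκ, outside_eq]
    have e1 := hG.btw_map (mem_outside _ h) (fun x hx hxu => hs.weight_map h hx hxu) hRg hwX hwu
    have e2 := hG.rest_map (mem_outside _ h) (fun x hx hxu => hs.weight_map h hx hxu) hRg hwX hwu
    rw [if_neg hwu] at e1 e2
    rw [e1, e2]
  -- The component of `w` does not contain `u` and is carried over unchanged.
  · have hX : ∀ x ∈ S.comp S.graph w, x ∈ S.live ∧ x ≠ u := by
      intro x hx
      refine ⟨(mem_comp.1 hx).1, ?_⟩
      rintro rfl
      exact hr (mem_comp.1 hx).2.symm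
    have hclosed : ∀ x ∈ S.comp S.graph w, ∀ y, S.graph.Adj x y → y ∈ S.comp S.graph w :=
      fun x hx y hxy => mem_comp.2 ⟨h.net.adj_mem' hxy, (mem_comp.1 hx).2.trans hxy.reachable⟩
    have hG : Net.Gate h.net h'.net (S.comp S.graph w) w id id :=
      { subset := fun x hx => (mem_comp.1 hx).1
        mem := mem_comp.2 ⟨hw, .rfl⟩
        conn := fun x hx => (mem_comp.1 hx).2
        gate := fun x hx y hy hxy => absurd (hclosed x hx y hxy) hy
        map_mem := fun x hx => (hs.live x).2 (Or.inl (hX x hx))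
        left_inv := fun _ _ => rfl
        adj := fun x hx y hy => by
          change _ ↔ S'.graph.Adj x y
          rw [hs.adj_old h hu (h.live_sub_copies (hX x hx).1) (h.live_sub_copies (hX y hy).1),
            deleteVerts_singleton_adj]
          exact ⟨fun hxy => ⟨hxy, (hX x hx).2, (hX y hy).2⟩, fun hxy => hxy.1⟩
        closed := fun x hx b hxb => by
          change S'.graph.Adj x b at hxb
          rcases (hs.live b).1 (h'.net.adj_mem' hxb) with ⟨h1, h2⟩ | ⟨κ, hκ, rfl⟩
          · have := (hs.adj_old h hu (h.live_sub_copies (hX x hx).1)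
              (h.live_sub_copies h1)).1 hxb
            exact ⟨b, hclosed x hx b this.1, rfl⟩
          · exact absurd (mem_comp.1 (hclosed x hx u
              ((hs.adj_new h hu hκ x).1 hxb.symm).1.symm)).2.symm hr
        mult := fun x hx => by
          change (S'.ident x : ℚ) = S.ident x
          rw [ident, hs.cls_old x (hX x hx).1 (hX x hx).2, ident] }
    obtain ⟨e1, e2⟩ := hG.btw_map_of_closed hclosed (R := S.weight) (R' := S'.weight)
      fun x hx => hs.weight_old h (hX x hx).1 (hX x hx).2
    rw [id] at e1 e2
    rw [e1, e2]

open Classical in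
/-- The parts as a finite set. -/
noncomputable def partsFinset (S : State V) (u : Copy V) :
    Finset (S.deleteVerts {u}).ConnectedComponent :=
  ((S.comp S.graph u).erase u).image (S.deleteVerts {u}).connectedComponentMk

theorem mem_partsFinset {κ : (S.deleteVerts {u}).ConnectedComponent} :
    κ ∈ S.partsFinset u ↔ κ ∈ S.parts u := by
  classical
  rw [partsFinset, Finset.mem_image]
  constructor
  · rintro ⟨x, hx, he⟩
    exact ⟨x, Finset.mem_of_mem_erase hx, Finset.ne_of_mem_erase hx, he⟩
  · rintro ⟨x, hx, hxu, he⟩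
    exact ⟨x, Finset.mem_erase.2 ⟨hxu, hx⟩, he⟩

open Classical in
theorem sum_parts (R : Copy V → ℚ) : ∑ x ∈ (S.comp S.graph u).erase u, R x =
    ∑ κ ∈ S.partsFinset u, ∑ x ∈ S.partVerts u κ, R x := by
  rw [← Finset.sum_fiberwise_of_maps_to (g := (S.deleteVerts {u}).connectedComponentMk)
    (t := S.partsFinset u)]
  · rfl
  · exact fun x hx => Finset.mem_image_of_mem _ hx

/-- The score of a copy merged into `u` is shared by its local copies. -/
theorem ShattersTo.finalScore_cls (h : S.Valid) (hu : u ∈ S.live) (hs : S.ShattersTo u cp S')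
    {m : Copy V} (hm : m ∈ S.cls u) :
    S.finalScore m = S'.finalScore m + ∑ κ ∈ S.partsFinset u, S'.finalScore (cp κ m) := by
  classical
  have h' := hs.valid h hu
  have hmc := h.cls_sub u hu hm
  -- The class of `u` has left the graph, so only the accumulated score of `m` remains.
  have hm' : S'.finalScore m = S.score m := by
    rw [finalScore_of_notMem, hs.score_old m hmc]
    intro w hw hmw
    rcases (hs.live w).1 hw with ⟨h1, h2⟩ | ⟨κ, hκ, rfl⟩
    · rw [hs.cls_old w h1 h2] at hmw
      exact h2 (h.disj w h1 u hu m hmw hm)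
    · obtain ⟨m', hm', rfl⟩ := (hs.cls_new κ hκ m).1 hmw
      exact hs.fresh κ hκ m' hm' hmc
  have huP : ∀ κ, u ∉ S.partVerts u κ := fun κ hκ => (mem_partVerts.1 hκ).1.2.1 rfl
  have hcp : ∀ κ ∈ S.partsFinset u, S'.finalScore (cp κ m) =
      (S.reach m - 1) * ∑ s ∈ S.partVerts u κ, S.weight s +
      (∑ s ∈ S.partVerts u κ, ∑ t ∈ S.partVerts u κ,
        S.weight s * S.weight t * h.net.frac s u t +
      S.outside u κ / S.ident u * ∑ s ∈ S.partVerts u κ, S.weight s) := by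
    intro κ hκ
    have hκ := mem_partsFinset.1 hκ
    have hG := hs.gate h hu hκ
    have e1 := hG.btw_map_gate (R := S.weight) (R' := S'.weight)
      (fun x hx hxu => hs.weight_map h hx hxu)
    have e2 := hG.rest_map_gate (R := S.weight) (R' := S'.weight)
      (fun x hx hxu => hs.weight_map h hx hxu)
    rw [if_pos rfl, Finset.erase_insert (huP κ)] at e1 e2
    rw [h'.finalScore_of_mem ((hs.live _).2 (Or.inr ⟨κ, hκ, rfl⟩))
      ((hs.cls_new κ hκ _).2 ⟨m, hm, rfl⟩), hs.score_new κ hκ m hm, hs.reach_new κ hκ m hm, e1, e2]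
    ring
  have hrest : h.net.rest S.weight u =
      ∑ κ ∈ S.partsFinset u, ∑ s ∈ S.partVerts u κ, S.weight s := by
    rw [← sum_parts, h.net.rest_eq_of_mem S.weight (B := S.comp S.graph u) fun x => mem_comp]
  -- Ordered pairs are sorted by the part of the source. If the target is in another part, every
  -- shortest path passes through `u` and each copy gets `1 / ident u`. This is what the local copy
  -- in the source's part collects through its increased reach, so no pair is counted twice.
  have hbtw : h.net.btw S.weight u = ∑ κ ∈ S.partsFinset u,
      (∑ s ∈ S.partVerts u κ, ∑ t ∈ S.partVerts u κ,
        S.weight s * S.weight t * h.net.frac s u t +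
      S.outside u κ / S.ident u * ∑ s ∈ S.partVerts u κ, S.weight s) := by
    rw [h.net.btw_eq_of_subset S.weight (B := S.comp S.graph u)
      (fun x hx => (mem_comp.1 hx).1) (fun x hx hr => mem_comp.2 ⟨hx, hr⟩), sum_parts]
    refine Finset.sum_congr rfl fun κ hκ => ?_
    have hκ := mem_partsFinset.1 hκ
    have hG := hs.gate h hu hκ
    rw [Finset.mul_sum, ← Finset.sum_add_distrib]
    refine Finset.sum_congr rfl fun s hsκ => ?_
    rw [← Finset.sum_filter_add_sum_filter_not ((S.comp S.graph u).erase u)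
      fun x => (S.deleteVerts {u}).connectedComponentMk x = κ]
    congr 1
    rw [outside_eq, Finset.sum_div, Finset.sum_mul]
    refine Finset.sum_congr rfl fun t ht => ?_
    obtain ⟨-, h1, h2⟩ := (mem_outside κ h t).1 ht
    rw [hG.frac_gate (Finset.mem_insert_of_mem hsκ) h1 h2]
    change _ * (1 / (S.ident u : ℚ)) = _
    ring
  rw [h.finalScore_of_mem hu hm, hm', Finset.sum_congr rfl hcp, Finset.sum_add_distrib, hrest,
    hbtw, Finset.mul_sum]

theorem ShattersTo.totalScore (h : S.Valid) (hu : u ∈ S.live) (hs : S.ShattersTo u cp S')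
    (v : V) : S'.totalScore v = S.totalScore v := by
  classical
  have hset : (S'.copies.filter fun c => c.1 = v) = (S.copies.filter fun c => c.1 = v) ∪
      ((S.cls u).filter fun c => c.1 = v).biUnion fun m =>
        (S.partsFinset u).image fun κ => cp κ m := by
    ext c
    simp only [Finset.mem_filter, Finset.mem_union, Finset.mem_biUnion, Finset.mem_image,
      hs.copies]
    constructor
    · rintro ⟨h1 | ⟨κ, hκ, m, hm, rfl⟩, h2⟩
      · exact Or.inl ⟨h1, h2⟩
      · exact Or.inr ⟨m, ⟨hm, (hs.org κ hκ m hm).symm.trans h2⟩, κ, mem_partsFinset.2 hκ, rfl⟩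
    · rintro (⟨h1, h2⟩ | ⟨m, ⟨hm, h2⟩, κ, hκ, rfl⟩)
      · exact ⟨Or.inl h1, h2⟩
      · rw [mem_partsFinset] at hκ
        exact ⟨Or.inr ⟨κ, hκ, m, hm, rfl⟩, (hs.org κ hκ m hm).trans h2⟩
  have hdisj : Disjoint (S.copies.filter fun c => c.1 = v)
      (((S.cls u).filter fun c => c.1 = v).biUnion fun m =>
        (S.partsFinset u).image fun κ => cp κ m) := by
    rw [Finset.disjoint_left]
    intro c hc hc'
    simp only [Finset.mem_filter, Finset.mem_biUnion, Finset.mem_image] at hc hc'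
    obtain ⟨m, ⟨hm, -⟩, κ, hκ, rfl⟩ := hc'
    exact hs.fresh κ (mem_partsFinset.1 hκ) m hm hc.1
  have hpw : (((S.cls u).filter fun c => c.1 = v : Finset (Copy V)) : Set (Copy V)).PairwiseDisjoint
      fun m => (S.partsFinset u).image fun κ => cp κ m := by
    intro m hm m' hm' hne
    rw [Function.onFun, Finset.disjoint_left]
    intro c hc hc'
    obtain ⟨κ, hκ, rfl⟩ := Finset.mem_image.1 hc
    obtain ⟨κ', hκ', he⟩ := Finset.mem_image.1 hc'
    exact hne (hs.inj κ (mem_partsFinset.1 hκ) κ' (mem_partsFinset.1 hκ') m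
      (Finset.mem_filter.1 hm).1 m' (Finset.mem_filter.1 hm').1 he.symm).2
  rw [State.totalScore, State.totalScore]
  -- Local copies keep the original vertex, so the score that leaves a copy of `v` stays in the sum
  -- for `v`.
  have hF : ∀ c ∈ S.copies.filter (fun c => c.1 = v), S.finalScore c = S'.finalScore c +
      if c ∈ S.cls u then ∑ κ ∈ S.partsFinset u, S'.finalScore (cp κ c) else 0 := by
    intro c hc
    split_ifs with hcu
    · exact hs.finalScore_cls h hu hcu
    · rw [add_zero, hs.finalScore_old h hu (Finset.mem_filter.1 hc).1 hcu]
  have hcls : (S.copies.filter fun c => c.1 = v).filter (fun c => c ∈ S.cls u) =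
      (S.cls u).filter fun c => c.1 = v := by
    ext c
    simp only [Finset.mem_filter]
    exact ⟨fun h => ⟨h.2, h.1.2⟩, fun h' => ⟨⟨h.cls_sub u hu h'.1, h'.2⟩, h'.1⟩⟩
  have e1 : ∑ c ∈ S'.copies.filter (fun c => c.1 = v), S'.finalScore c =
      ∑ c ∈ S.copies.filter (fun c => c.1 = v), S.finalScore c := by
    rw [Finset.sum_congr rfl hF, Finset.sum_add_distrib, ← Finset.sum_filter, hcls, hset,
      Finset.sum_union hdisj, Finset.sum_biUnion hpw]
    congr 1
    refine Finset.sum_congr rfl fun m hm => ?_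
    refine Finset.sum_image fun κ hκ κ' hκ' he => ?_
    exact (hs.inj κ (mem_partsFinset.1 hκ) κ' (mem_partsFinset.1 hκ') m
      (Finset.mem_filter.1 hm).1 m (Finset.mem_filter.1 hm).1 he).1
  convert e1

end State

end BCNet

namespace BCNet

namespace Net

variable {α : Type*} {N M : Net α} {I : Finset α} {v : α} {d : ℕ}

/-! ### Merging identical vertices -/

/-- The vertices of `I` have the same neighbours, up to edges inside `I`, and a common positive
distance `d` from each other. -/
structure Twins (N : Net α) (I : Finset α) (d : ℕ) : Prop where
  subset : I ⊆ N.verts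
  twin : ∀ a ∈ I, ∀ b ∈ I, ∀ x, x ≠ a → x ≠ b → (N.graph.Adj a x ↔ N.graph.Adj b x)
  dist : ∀ a ∈ I, ∀ b ∈ I, a ≠ b → N.graph.dist a b = d
  pos : d ≠ 0

namespace Twins

theorem reachable (hI : N.Twins I d) {a b : α} (ha : a ∈ I) (hb : b ∈ I) :
    N.graph.Reachable a b := by
  by_cases h : a = b
  · rw [h]
  · exact .of_dist_ne_zero (by rw [hI.dist a ha b hb h]; exact hI.pos)

open Classical in
theorem dist_le_of_mem (hI : N.Twins I d) {s a b : α} (hs : s ∉ I) (ha : a ∈ I) (hb : b ∈ I)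
    (h : N.graph.Reachable s a) : N.graph.dist s b ≤ N.graph.dist s a := by
  have := dist_map_le_of_contraction (G := N.graph) (H := N.graph)
    (fun x => if x ∈ I then b else x) (fun x y hxy => ?_) h
  · simpa [hs, ha] using this.2
  · have key : ∀ x ∈ I, ∀ y, y ∉ I → N.graph.Adj x y → N.graph.Adj b y := fun x hx y hy hxy =>
      (hI.twin x hx b hb y hxy.ne' (by rintro rfl; exact hy hb)).1 hxy
    by_cases hx : x ∈ I <;> by_cases hy : y ∈ I <;> simp only [hx, hy, if_true, if_false]
    · exact Or.inl trivial
    · exact Or.inr (key x hx y hy hxy)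
    · exact Or.inr (key y hy x hx hxy.symm).symm
    · exact Or.inr hxy

theorem dist_eq_of_mem (hI : N.Twins I d) {s a b : α} (hs : s ∉ I) (ha : a ∈ I) (hb : b ∈ I) :
    N.graph.dist s a = N.graph.dist s b := by
  by_cases h : N.graph.Reachable s a
  · exact le_antisymm (hI.dist_le_of_mem hs hb ha (h.trans (hI.reachable ha hb)))
      (hI.dist_le_of_mem hs ha hb h)
  · rw [SimpleGraph.dist_eq_zero_of_not_reachable h, SimpleGraph.dist_eq_zero_of_not_reachable
      fun h' => h (h'.trans (hI.reachable hb ha))]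

/-- A twin is not inside a shortest path that starts at another twin: vertices outside `I` are
equally far from both, and the mutual distances in `I` are all equal and positive. -/
theorem frac_eq_zero (hI : N.Twins I d) {s w t : α} (hs : s ∈ I) (hw : w ∈ I) (hsw : s ≠ w)
    (htw : t ≠ w) : N.frac s w t = 0 := by
  by_contra h
  obtain ⟨h1, h2, h3⟩ := N.reachable_of_frac_ne_zero h
  have h4 := hI.dist s hs w hw hsw
  have h5 := hI.pos
  by_cases ht : t ∈ I
  · have h6 := hI.dist t ht w hw htw
    rw [N.graph.dist_comm] at h6
    by_cases hst : s = t
    · subst hst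
      rw [SimpleGraph.dist_self] at h3
      omega
    · have h7 := hI.dist s hs t ht hst
      omega
  · have h6 := hI.dist_eq_of_mem ht hs hw
    rw [N.graph.dist_comm, N.graph.dist_comm (u := t)] at h6
    omega

end Twins

/-- `M` results from `N` by merging the twins `I` into `v`. -/
structure Merges (N M : Net α) (I : Finset α) (v : α) (d : ℕ) : Prop extends N.Twins I d where
  mem : v ∈ I
  verts : ∀ x, x ∈ M.verts ↔ x ∈ N.verts ∧ (x ∈ I → x = v)
  adj : ∀ x y, M.graph.Adj x y ↔ N.graph.Adj x y ∧ (x ∈ I → x = v) ∧ (y ∈ I → y = v)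
  mult_of_notMem : ∀ x ∈ N.verts, x ∉ I → M.mult x = N.mult x
  mult_rep : M.mult v = ∑ a ∈ I, N.mult a

namespace Merges

open Classical in
theorem dist_eq (h : Merges N M I v d) {a b : α} (ha : a ∈ I → a = v) (hb : b ∈ I → b = v) :
    (M.graph.Reachable a b ↔ N.graph.Reachable a b) ∧ M.graph.dist a b = N.graph.dist a b := by
  have hφ : ∀ {x : α}, (x ∈ I → x = v) → (if x ∈ I then v else x) = x := fun hx => by
    split_ifs with h'
    · exact (hx h').symm
    · rfl
  have := dist_eq_of_contractions (G := N.graph) (H := M.graph)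
    (fun x => if x ∈ I then v else x) id (a := a) (b := b) ?_
    (fun x y hxy => Or.inr ((h.adj x y).1 hxy).1) (hφ ha) (hφ hb)
  · simpa only [hφ ha, hφ hb] using this
  · intro x y hxy
    have key : ∀ x ∈ I, ∀ y, y ∉ I → N.graph.Adj x y → N.graph.Adj v y := fun x hx y hy hxy =>
      (h.twin x hx v h.mem y hxy.ne' (by rintro rfl; exact hy h.mem)).1 hxy
    by_cases hx : x ∈ I <;> by_cases hy : y ∈ I <;> simp only [hx, hy, if_true, if_false]
    · exact Or.inl trivial
    · exact Or.inr ((h.adj _ _).2 ⟨key x hx y hy hxy, fun _ => rfl, fun h' => absurd h' hy⟩)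
    · exact Or.inr ((h.adj _ _).2 ⟨(key y hy x hx hxy.symm).symm, fun h' => absurd h' hx,
        fun _ => rfl⟩)
    · exact Or.inr ((h.adj _ _).2 ⟨hxy, fun h' => absurd h' hx, fun h' => absurd h' hy⟩)

open Classical in
theorem dist_eq_map (h : Merges N M I v d) {s x : α} (hs : s ∉ I) :
    M.graph.dist s (if x ∈ I then v else x) = N.graph.dist s x := by
  split_ifs with hx
  · rw [(h.dist_eq (fun h' => absurd h' hs) fun _ => rfl).2, h.dist_eq_of_mem hs h.mem hx]
  · exact (h.dist_eq (fun h' => absurd h' hs) fun h' => absurd h' hx).2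

-- This is `shp_transfer` for the map collapsing `I` to `v`. The source has to be outside `I`, since
-- otherwise other vertices would be mapped onto it.
open Classical in
theorem shp_mul (h : Merges N M I v d) {s t : α} (hs : s ∉ I)
    (ht : t ∈ N.verts) : M.mult (if t ∈ I then v else t) * N.shp s t =
      N.mult t * M.shp s (if t ∈ I then v else t) := by
  have hφs : (if s ∈ I then v else s) = s := if_neg hs
  have := N.shp_transfer M (fun x => if x ∈ I then v else x) N.verts s subset_rfl ?_ ?_ ?_ ?_ ?_
    (fun x hx _ _ _ _ => hx) ?_ ht
  · simpa only [hφs] using this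
  · intro x hx
    rw [h.verts]
    split_ifs with hxI
    · exact ⟨h.subset h.mem, fun _ => rfl⟩
    · exact ⟨hx, fun h' => absurd h' hxI⟩
  · intro x _ hxs
    simp only [hφs] at hxs
    split_ifs at hxs with hxI
    · exact absurd (hxs ▸ h.mem) hs
    · exact hxs
  · intro x hx
    by_cases hxI : x ∈ I
    · simp only [hxI, if_true]
      rw [h.mult_rep]
      refine Finset.sum_congr ?_ fun _ _ => rfl
      ext y
      rw [Finset.mem_filter]
      constructor
      · intro hy
        refine ⟨h.subset hy, if_pos hy⟩
      · rintro ⟨-, hy⟩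
        split_ifs at hy with hyI
        · exact hyI
        · exact hy ▸ h.mem
    · simp only [hxI, if_false]
      rw [h.mult_of_notMem x hx hxI]
      have : (N.verts.filter fun y => (if y ∈ I then v else y) = x) = {x} := by
        ext y
        rw [Finset.mem_filter, Finset.mem_singleton]
        constructor
        · rintro ⟨-, hy⟩
          split_ifs at hy with hyI
          · exact absurd (hy ▸ h.mem) hxI
          · exact hy
        · rintro rfl
          exact ⟨hx, if_neg hxI⟩
      rw [this, Finset.sum_singleton]
  · intro x _
    simp only [hφs]
    exact h.dist_eq_map hs
  · intro x hx t ht hd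
    by_cases hxI : x ∈ I <;> by_cases htI : t ∈ I <;> simp only [hxI, htI, if_true, if_false]
    -- Two members of `I` are equally far from `s`, so neither precedes the other.
    · have := h.dist_eq_of_mem hs hxI htI
      omega
    · rw [h.adj, h.twin x hxI v h.mem t (by rintro rfl; exact htI hxI)
        (by rintro rfl; exact htI h.mem)]
      exact ⟨fun h' => ⟨h', fun _ => rfl, fun h' => absurd h' htI⟩, fun h' => h'.1⟩
    · rw [h.adj, N.graph.adj_comm, h.twin t htI v h.mem x (by rintro rfl; exact hxI htI)
        (by rintro rfl; exact hxI h.mem), N.graph.adj_comm]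
      exact ⟨fun h' => ⟨h', fun h' => absurd h' hxI, fun _ => rfl⟩, fun h' => h'.1⟩
    · rw [h.adj]
      exact ⟨fun h' => ⟨h', fun h' => absurd h' hxI, fun h' => absurd h' htI⟩, fun h' => h'.1⟩
  · intro y hy t _ _ _
    obtain ⟨h1, h2⟩ := (h.verts y).1 hy
    refine ⟨y, h1, ?_⟩
    by_cases hyI : y ∈ I
    · simp only [hyI, if_true]; exact (h2 hyI).symm
    · simp only [hyI, if_false]

theorem shp_eq (h : Merges N M I v d) {s t : α} (hs : s ∉ I)
    (htI : t ∉ I) (ht : t ∈ N.verts) : N.shp s t = M.shp s t := by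
  classical
  have := h.shp_mul hs ht
  rw [if_neg htI, h.mult_of_notMem t ht htI] at this
  exact mul_left_cancel₀ (N.mult_pos t ht).ne' this

theorem rep_mem (h : Merges N M I v d) : v ∈ M.verts :=
  (h.verts v).2 ⟨h.subset h.mem, fun _ => rfl⟩

theorem shp_eq_of_mem (h : Merges N M I v d) {s t : α} (hs : s ∉ I)
    (ht : t ∈ I) : N.shp s t = N.mult t / M.mult v * M.shp s v := by
  classical
  have := h.shp_mul hs (h.subset ht)
  rw [if_pos ht] at this
  have h0 := (M.mult_pos v h.rep_mem).ne'
  field_simp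
  linarith

theorem frac_eq (h : Merges N M I v d) {s w t : α} (hs : s ∉ I)
    (hw : w ∉ I) (hwv : w ∈ N.verts) (ht : t ∉ I) (htv : t ∈ N.verts) :
    N.frac s w t = M.frac s w t := by
  have hd : ∀ a b, a ∉ I → b ∉ I → N.graph.dist a b = M.graph.dist a b := fun a b ha hb =>
    (h.dist_eq (fun h' => absurd h' ha) fun h' => absurd h' hb).2.symm
  exact M.frac_congr N (hd s w hs hw) (hd w t hw ht) (hd s t hs ht) (h.shp_eq hs hw hwv)
    (h.shp_eq hw ht htv) (h.shp_eq hs ht htv) (h.mult_of_notMem w hwv hw).symm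

/-- The ratio of multiplicities at the endpoint occurs in numerator and denominator. -/
theorem frac_eq_right (h : Merges N M I v d) {s w t : α} (hs : s ∉ I)
    (hw : w ∉ I) (hwv : w ∈ N.verts) (ht : t ∈ I) :
    N.frac s w t = M.frac s w v := by
  classical
  have e1 := h.dist_eq_map (x := t) hs
  have e2 := h.dist_eq_map (x := t) hw
  have e3 := h.dist_eq_map (x := w) hs
  rw [if_pos ht] at e1 e2
  rw [if_neg hw] at e3
  unfold frac
  rw [e1, e2, e3, h.shp_eq hs hw hwv, h.shp_eq_of_mem hs ht, h.shp_eq_of_mem hw ht,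
    h.mult_of_notMem w hwv hw]
  have h0 : N.mult t / M.mult v ≠ 0 :=
    div_ne_zero (N.mult_pos t (h.subset ht)).ne' (M.mult_pos v h.rep_mem).ne'
  rw [mul_left_comm (M.shp s w), mul_left_comm (N.mult w ^ 2), mul_div_mul_left _ _ h0]

/-- The ratio of multiplicities occurs once from each side of `w`, which is exactly what the square
in `frac` absorbs. -/
theorem frac_eq_mid (h : Merges N M I v d) {s w t : α} (hs : s ∉ I)
    (hw : w ∈ I) (ht : t ∉ I) (htv : t ∈ N.verts) :
    N.frac s w t = M.frac s v t := by
  classical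
  have e1 := h.dist_eq_map (x := w) hs
  have e2 := h.dist_eq_map (x := w) ht
  have e3 := h.dist_eq_map (x := t) hs
  rw [if_pos hw] at e1 e2
  rw [if_neg ht] at e3
  rw [M.graph.dist_comm, N.graph.dist_comm] at e2
  unfold frac
  rw [e1, e2, e3, h.shp_eq hs ht htv, h.shp_eq_of_mem hs hw, N.shp_comm w,
    h.shp_eq_of_mem ht hw, M.shp_comm v]
  have h0 := (N.mult_pos w (h.subset hw)).ne'
  have h1 := (M.mult_pos v h.rep_mem).ne'
  congr 1
  rw [show N.mult w / M.mult v * M.shp s v * (N.mult w / M.mult v * M.shp t v) =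
    N.mult w ^ 2 * (M.shp s v * M.shp t v / M.mult v ^ 2) by field_simp,
    mul_div_mul_left _ _ (pow_ne_zero 2 h0), div_div]

variable [DecidableEq α]

theorem verts_erase (h : Merges N M I v d) {w : α} (hw : w ∉ I) :
    N.verts.erase w = (N.verts \ I).erase w ∪ I ∧
      M.verts.erase w = insert v ((N.verts \ I).erase w) := by
  have hvw : v ≠ w := by rintro rfl; exact hw h.mem
  constructor
  · ext x
    simp only [Finset.mem_erase, Finset.mem_union, Finset.mem_sdiff]
    by_cases hx : x ∈ I
    · simp only [hx, h.subset hx, or_true, and_true, iff_true]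
      rintro rfl; exact hw hx
    · simp [hx]
  · ext x
    rw [Finset.mem_erase, h.verts, Finset.mem_insert, Finset.mem_erase, Finset.mem_sdiff]
    by_cases hx : x = v
    · simp [hx, hvw, h.subset h.mem]
    · simp [hx]

theorem disjoint_erase (w : α) : Disjoint ((N.verts \ I).erase w) I :=
  Finset.disjoint_left.2 fun _ hx => (Finset.mem_sdiff.1 (Finset.mem_of_mem_erase hx)).2

/-- Pairs with at most one endpoint in `I` survive as pairs with endpoint `v`. Those with both
endpoints in `I` become the pair of `v` with itself, which counts zero. -/
theorem btw_eq (h : Merges N M I v d) {R R' : α → ℚ}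
    (hR : ∀ x ∈ N.verts, x ∉ I → R' x = R x) (hRv : R' v = ∑ a ∈ I, R a) {w : α}
    (hw : w ∉ I) (hwv : w ∈ N.verts) : N.btw R w = M.btw R' w +
      ∑ a ∈ I, ∑ b ∈ I.erase a, R a * R b * N.frac a w b := by
  obtain ⟨hN, hM⟩ := h.verts_erase hw
  have hvA : v ∉ (N.verts \ I).erase w := fun h' =>
    (Finset.mem_sdiff.1 (Finset.mem_of_mem_erase h')).2 h.mem
  have hA : ∀ x ∈ (N.verts \ I).erase w, x ∈ N.verts ∧ x ∉ I := fun x hx =>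
    Finset.mem_sdiff.1 (Finset.mem_of_mem_erase hx)
  have hvw : v ≠ w := by rintro rfl; exact hw h.mem
  rw [N.btw_eq, M.btw_eq, hN, hM, Finset.sum_union (disjoint_erase w), Finset.sum_insert hvA]
  simp only [Finset.sum_union (disjoint_erase (N := N) (I := I) w), Finset.sum_insert hvA,
    Finset.sum_add_distrib, M.frac_endpoints_eq hvw, mul_zero, zero_add]
  have e1 : ∑ s ∈ (N.verts \ I).erase w, ∑ t ∈ (N.verts \ I).erase w,
      R' s * R' t * M.frac s w t =
      ∑ s ∈ (N.verts \ I).erase w, ∑ t ∈ (N.verts \ I).erase w, R s * R t * N.frac s w t :=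
    Finset.sum_congr rfl fun s hs => Finset.sum_congr rfl fun t ht => by
      obtain ⟨h1, h2⟩ := hA s hs
      obtain ⟨h3, h4⟩ := hA t ht
      rw [hR s h1 h2, hR t h3 h4, h.frac_eq h2 hw hwv h4 h3]
  have e2 : ∑ s ∈ (N.verts \ I).erase w, ∑ t ∈ I, R s * R t * N.frac s w t =
      ∑ s ∈ (N.verts \ I).erase w, R' s * R' v * M.frac s w v := by
    refine Finset.sum_congr rfl fun s hs => ?_
    obtain ⟨h1, h2⟩ := hA s hs
    rw [hR s h1 h2, hRv, Finset.mul_sum, Finset.sum_mul]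
    exact Finset.sum_congr rfl fun t ht => by rw [h.frac_eq_right h2 hw hwv ht]
  have e3 : ∑ s ∈ I, ∑ t ∈ (N.verts \ I).erase w, R s * R t * N.frac s w t =
      ∑ s ∈ (N.verts \ I).erase w, ∑ t ∈ I, R s * R t * N.frac s w t := by
    rw [Finset.sum_comm]
    exact Finset.sum_congr rfl fun t _ => Finset.sum_congr rfl fun s _ => by
      rw [N.frac_comm]; ring
  have e4 : ∑ t ∈ (N.verts \ I).erase w, R' v * R' t * M.frac v w t =
      ∑ s ∈ (N.verts \ I).erase w, R' s * R' v * M.frac s w v :=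
    Finset.sum_congr rfl fun t _ => by rw [M.frac_comm]; ring
  have e5 : ∑ a ∈ I, ∑ b ∈ I, R a * R b * N.frac a w b =
      ∑ a ∈ I, ∑ b ∈ I.erase a, R a * R b * N.frac a w b := by
    refine Finset.sum_congr rfl fun a ha => ?_
    have : a ≠ w := by rintro rfl; exact hw ha
    rw [← Finset.add_sum_erase _ _ ha, N.frac_endpoints_eq this, mul_zero, zero_add]
  rw [e1, e3, e2, e4, e5]
  ring

theorem verts_erase_rep (h : Merges N M I v d) : M.verts.erase v = N.verts \ I := by
  ext x
  rw [Finset.mem_erase, h.verts, Finset.mem_sdiff]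
  constructor
  · rintro ⟨h1, h2, h3⟩; exact ⟨h2, fun h' => h1 (h3 h')⟩
  · rintro ⟨h1, h2⟩
    exact ⟨by rintro rfl; exact h2 h.mem, h1, fun h' => absurd h' h2⟩

theorem verts_erase_mem (h : Merges N M I v d) {w : α} (hw : w ∈ I) :
    N.verts.erase w = N.verts \ I ∪ I.erase w := by
  ext x
  simp only [Finset.mem_erase, Finset.mem_union, Finset.mem_sdiff]
  by_cases hx : x ∈ I
  · simp [hx, h.subset hx]
  · simp only [hx, not_false_eq_true, and_true, and_false, or_false]
    refine ⟨fun h' => h'.2, fun h' => ⟨?_, h'⟩⟩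
    rintro rfl; exact hx hw

theorem disjoint_sdiff_erase (w : α) : Disjoint (N.verts \ I) (I.erase w) :=
  Finset.disjoint_left.2 fun _ hx hx' => (Finset.mem_sdiff.1 hx).2 (Finset.mem_of_mem_erase hx')

/-- Pairs with an endpoint in `I` contribute nothing to `w`, and for the other pairs a copy in `w`
and a copy in `v` carry the same fraction. -/
theorem btw_eq_rep (h : Merges N M I v d) {R R' : α → ℚ}
    (hR : ∀ x ∈ N.verts, x ∉ I → R' x = R x) {w : α} (hw : w ∈ I) :
    N.btw R w = M.btw R' v := by
  rw [N.btw_eq, M.btw_eq, h.verts_erase_mem hw, h.verts_erase_rep,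
    Finset.sum_union (disjoint_sdiff_erase w)]
  have hz : ∀ s ∈ I.erase w, ∀ t, t ≠ w → N.frac s w t = 0 := fun s hs t ht =>
    h.frac_eq_zero (Finset.mem_of_mem_erase hs) hw (Finset.ne_of_mem_erase hs) ht
  have hAw : ∀ x ∈ N.verts \ I, x ≠ w := by
    rintro x hx rfl; exact (Finset.mem_sdiff.1 hx).2 hw
  have e1 : ∑ s ∈ I.erase w, ∑ t ∈ N.verts \ I ∪ I.erase w, R s * R t * N.frac s w t = 0 := by
    refine Finset.sum_eq_zero fun s hs => Finset.sum_eq_zero fun t ht => ?_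
    rw [hz s hs t, mul_zero]
    rcases Finset.mem_union.1 ht with h' | h'
    · exact hAw t h'
    · exact Finset.ne_of_mem_erase h'
  rw [e1, add_zero]
  refine Finset.sum_congr rfl fun s hs => ?_
  obtain ⟨h1, h2⟩ := Finset.mem_sdiff.1 hs
  rw [Finset.sum_union (disjoint_sdiff_erase w)]
  have e2 : ∑ t ∈ I.erase w, R s * R t * N.frac s w t = 0 :=
    Finset.sum_eq_zero fun t ht => by rw [N.frac_comm, hz t ht s (hAw s hs), mul_zero]
  rw [e2, add_zero]
  refine Finset.sum_congr rfl fun t ht => ?_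
  obtain ⟨h3, h4⟩ := Finset.mem_sdiff.1 ht
  rw [hR s h1 h2, hR t h3 h4, h.frac_eq_mid h2 hw h4 h3]

open Classical in
theorem rest_eq_sum_ite (N : Net α) (R : α → ℚ) (w : α) : N.rest R w =
    ∑ x ∈ N.verts.erase w, if N.graph.Reachable w x then R x else 0 := by
  rw [N.rest_eq, ← Finset.sum_filter]
  refine Finset.sum_congr ?_ fun _ _ => rfl
  ext x
  simp only [Finset.mem_erase, Finset.mem_filter, and_assoc]

theorem rest_eq (h : Merges N M I v d) {R R' : α → ℚ}
    (hR : ∀ x ∈ N.verts, x ∉ I → R' x = R x) (hRv : R' v = ∑ a ∈ I, R a) {w : α}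
    (hw : w ∉ I) : N.rest R w = M.rest R' w := by
  classical
  obtain ⟨hN, hM⟩ := h.verts_erase hw
  have hvA : v ∉ (N.verts \ I).erase w := fun h' =>
    (Finset.mem_sdiff.1 (Finset.mem_of_mem_erase h')).2 h.mem
  rw [rest_eq_sum_ite, rest_eq_sum_ite, hN, hM, Finset.sum_union (disjoint_erase w),
    Finset.sum_insert hvA, add_comm]
  congr 1
  · rw [(h.dist_eq (fun h' => absurd h' hw) fun _ => rfl).1]
    have : ∀ a ∈ I, (N.graph.Reachable w a ↔ N.graph.Reachable w v) := fun a ha =>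
      ⟨fun h' => h'.trans (h.reachable ha h.mem), fun h' => h'.trans (h.reachable h.mem ha)⟩
    split_ifs with hr
    · rw [hRv]
      exact Finset.sum_congr rfl fun a ha => if_pos ((this a ha).2 hr)
    · exact Finset.sum_eq_zero fun a ha => if_neg fun h' => hr ((this a ha).1 h')
  · refine Finset.sum_congr rfl fun x hx => ?_
    obtain ⟨h1, h2⟩ := Finset.mem_sdiff.1 (Finset.mem_of_mem_erase hx)
    rw [hR x h1 h2, (h.dist_eq (fun h' => absurd h' hw) fun h' => absurd h' h2).1]

/-- The other members of `I` drop out of `rest`; `endpointCorrection` compensates for this loss. -/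
theorem rest_eq_rep (h : Merges N M I v d) {R R' : α → ℚ}
    (hR : ∀ x ∈ N.verts, x ∉ I → R' x = R x) {w : α} (hw : w ∈ I) :
    N.rest R w = M.rest R' v + ∑ b ∈ I.erase w, R b := by
  classical
  rw [rest_eq_sum_ite, rest_eq_sum_ite, h.verts_erase_mem hw, h.verts_erase_rep,
    Finset.sum_union (disjoint_sdiff_erase w)]
  congr 1
  · refine Finset.sum_congr rfl fun x hx => ?_
    obtain ⟨h1, h2⟩ := Finset.mem_sdiff.1 hx
    rw [hR x h1 h2, (h.dist_eq (fun _ => rfl) fun h' => absurd h' h2).1]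
    have : N.graph.Reachable w x ↔ N.graph.Reachable v x :=
      ⟨fun h' => (h.reachable h.mem hw).trans h', fun h' => (h.reachable hw h.mem).trans h'⟩
    simp only [this]
  · exact Finset.sum_congr rfl fun b hb =>
      if_pos (h.reachable hw (Finset.mem_of_mem_erase hb))

end Merges

end Net

end BCNet

/-! ### Merging identical vertices in a state. -/

namespace BCNet

namespace State

variable {V : Type*} {S : State V} {I : Finset (Copy V)} {v : Copy V} {d : ℕ}

open Classical in
theorem Valid.pairwiseDisjoint_cls (h : S.Valid) (hI : I ⊆ S.live) :
    Set.PairwiseDisjoint (I : Set (Copy V)) S.cls := by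
  intro a ha b hb hne
  rw [Function.onFun, Finset.disjoint_left]
  exact fun c hca hcb => hne (h.disj a (hI ha) b (hI hb) c hca hcb)

theorem mem_mergeInto_live (corr : Copy V → ℚ) (x : Copy V) :
    x ∈ (S.mergeInto I v corr).live ↔ x ∈ S.live ∧ (x ∈ I → x = v) := by
  classical
  change x ∈ S.live \ I.erase v ↔ _
  rw [Finset.mem_sdiff, Finset.mem_erase]
  tauto

open Classical in
theorem mergeInto_cls (corr : Copy V → ℚ) (x : Copy V) :
    (S.mergeInto I v corr).cls x = if x = v then I.biUnion S.cls else S.cls x := rfl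

theorem mem_mergeInto_cls (hv : v ∈ I) (hI : I ⊆ S.live) (corr : Copy V → ℚ)
    {c x : Copy V} (hx : x ∈ (S.mergeInto I v corr).live) :
    c ∈ (S.mergeInto I v corr).cls x ↔
      ∃ a ∈ S.live, c ∈ S.cls a ∧ (a = x ∨ a ∈ I ∧ x = v) := by
  classical
  obtain ⟨h1, h2⟩ := (mem_mergeInto_live corr x).1 hx
  rw [mergeInto_cls]
  split_ifs with hxv
  · subst hxv
    rw [Finset.mem_biUnion]
    constructor
    · rintro ⟨a, ha, hc⟩; exact ⟨a, hI ha, hc, Or.inr ⟨ha, rfl⟩⟩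
    · rintro ⟨a, -, hc, rfl | ⟨ha, -⟩⟩
      · exact ⟨a, hv, hc⟩
      · exact ⟨a, ha, hc⟩
  · constructor
    · exact fun hc => ⟨x, h1, hc, Or.inl rfl⟩
    · rintro ⟨a, -, hc, rfl | ⟨-, h3⟩⟩
      · exact hc
      · exact absurd h3 hxv

theorem Valid.mergeInto (h : S.Valid) (hv : v ∈ I) (hI : I ⊆ S.live) (corr : Copy V → ℚ) :
    (S.mergeInto I v corr).Valid where
  adj_mem a b hab := by
    refine (mem_mergeInto_live corr a).2 ⟨h.adj_mem a b hab.1, fun ha => ?_⟩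
    by_contra hne
    exact hab.2.1 (by classical exact (by convert Finset.mem_erase.2 ⟨hne, ha⟩))
  mem_cls a ha := (mem_mergeInto_cls hv hI corr ha).2
    ⟨a, ((mem_mergeInto_live corr a).1 ha).1, h.mem_cls a ((mem_mergeInto_live corr a).1 ha).1,
      Or.inl rfl⟩
  disj a ha b hb c hca hcb := by
    obtain ⟨x, hx, hcx, hxa⟩ := (mem_mergeInto_cls hv hI corr ha).1 hca
    obtain ⟨y, hy, hcy, hyb⟩ := (mem_mergeInto_cls hv hI corr hb).1 hcb
    obtain rfl := h.disj x hx y hy c hcx hcy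
    have ha' := ((mem_mergeInto_live corr a).1 ha).2
    have hb' := ((mem_mergeInto_live corr b).1 hb).2
    rcases hxa with rfl | ⟨h1, rfl⟩ <;> rcases hyb with rfl | ⟨h2, rfl⟩
    · rfl
    · exact ha' h2
    · exact (hb' h1).symm
    · rfl
  cls_sub a ha c hc := by
    obtain ⟨x, hx, hcx, -⟩ := (mem_mergeInto_cls hv hI corr ha).1 hc
    exact h.cls_sub x hx hcx

open Classical in
theorem Valid.merges (h : S.Valid) (hv : v ∈ I) (hT : h.net.Twins I d) (corr : Copy V → ℚ) :
    Net.Merges h.net (h.mergeInto hv hT.subset corr).net I v d where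
  toTwins := hT
  mem := hv
  verts := mem_mergeInto_live corr
  adj x y := by
    change S.graph.Adj x y ∧ x ∉ _ ∧ y ∉ _ ↔ S.graph.Adj x y ∧ _
    rw [Finset.mem_erase, Finset.mem_erase]
    tauto
  mult_of_notMem x hx hxI := by
    classical
    have : x ≠ v := by rintro rfl; exact hxI hv
    change ((S.mergeInto I v corr).ident x : ℚ) = S.ident x
    rw [ident, mergeInto_cls, if_neg this, ident]
  mult_rep := by
    classical
    change ((S.mergeInto I v corr).ident v : ℚ) = ∑ a ∈ I, (S.ident a : ℚ)
    rw [ident, mergeInto_cls, if_pos rfl, Finset.card_biUnion (h.pairwiseDisjoint_cls hT.subset)]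
    simp [ident]

theorem Valid.mergeInto_weight_rep (h : S.Valid) (hI : I ⊆ S.live) (corr : Copy V → ℚ) :
    (S.mergeInto I v corr).weight v = ∑ a ∈ I, S.weight a := by
  classical
  rw [weight, mergeInto_cls, if_pos rfl, Finset.sum_biUnion (h.pairwiseDisjoint_cls hI)]
  rfl

theorem mergeInto_weight_of_ne (corr : Copy V → ℚ) {x : Copy V} (hx : x ≠ v) :
    (S.mergeInto I v corr).weight x = S.weight x := by
  classical
  rw [weight, mergeInto_cls, if_neg hx]
  rfl

/-- The conditions on the corrections under which merging preserves the final scores. -/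
theorem Valid.finalScore_mergeInto (h : S.Valid) (hv : v ∈ I) (hT : h.net.Twins I d)
    [DecidableEq (Copy V)] {corr : Copy V → ℚ} {c : Copy V}
    (hnone : (∀ w ∈ S.live, c ∉ S.cls w) → corr c = 0)
    (hin : ∀ w ∈ I, c ∈ S.cls w → corr c = (S.reach c - 1) * ∑ b ∈ I.erase w, S.weight b)
    (hout : ∀ w ∈ S.live, w ∉ I → c ∈ S.cls w →
      corr c = ∑ a ∈ I, ∑ b ∈ I.erase a, S.weight a * S.weight b * h.net.frac a w b) :
    (S.mergeInto I v corr).finalScore c = S.finalScore c := by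
  have hM := h.merges hv hT corr
  have h' := h.mergeInto hv hT.subset corr
  have hscore : (S.mergeInto I v corr).score c = S.score c + corr c := rfl
  have hreach : (S.mergeInto I v corr).reach c = S.reach c := rfl
  have hR : ∀ x ∈ h.net.verts, x ∉ I → (S.mergeInto I v corr).weight x = S.weight x :=
    fun x _ hx => mergeInto_weight_of_ne corr (by rintro rfl; exact hx hv)
  have hRv := h.mergeInto_weight_rep (v := v) hT.subset corr
  by_cases hex : ∃ w ∈ S.live, c ∈ S.cls w
  swap
  · push Not at hex
    rw [finalScore_of_notMem hex, finalScore_of_notMem, hscore, hnone hex, add_zero]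
    intro w hw hcw
    obtain ⟨a, ha, hca, -⟩ := (mem_mergeInto_cls hv hT.subset corr hw).1 hcw
    exact hex a ha hca
  obtain ⟨w, hw, hcw⟩ := hex
  by_cases hwI : w ∈ I
  · have hvl := hM.rep_mem
    have hcv : c ∈ (S.mergeInto I v corr).cls v :=
      (mem_mergeInto_cls hv hT.subset corr hvl).2 ⟨w, hw, hcw, Or.inr ⟨hwI, rfl⟩⟩
    rw [h.finalScore_of_mem hw hcw, h'.finalScore_of_mem hvl hcv, hscore, hreach, hin w hwI hcw,
      hM.btw_eq_rep hR hwI, hM.rest_eq_rep hR hwI]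
    ring
  · have hwl : w ∈ (S.mergeInto I v corr).live :=
      (mem_mergeInto_live corr w).2 ⟨hw, fun h' => absurd h' hwI⟩
    have hcw' : c ∈ (S.mergeInto I v corr).cls w :=
      (mem_mergeInto_cls hv hT.subset corr hwl).2 ⟨w, hw, hcw, Or.inl rfl⟩
    rw [h.finalScore_of_mem hw hcw, h'.finalScore_of_mem hwl hcw', hscore, hreach,
      hout w hw hwI hcw, hM.btw_eq hR hRv hwI hw, hM.rest_eq hR hRv hwI]
    ring

open Classical in
theorem Valid.endpointCorrection_of_mem (h : S.Valid) (hI : I ⊆ S.live) {c w : Copy V}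
    (hw : w ∈ I) (hc : c ∈ S.cls w) :
    S.endpointCorrection I c = (S.reach c - 1) * ∑ b ∈ I.erase w, S.weight b := by
  rw [endpointCorrection, Finset.sum_eq_single w, if_pos hc]
  · exact fun a ha haw => if_neg fun hca => haw (h.disj a (hI ha) w (hI hw) c hca hc)
  · exact fun h' => absurd hw h'

theorem endpointCorrection_of_notMem {c : Copy V} (hc : ∀ a ∈ I, c ∉ S.cls a) :
    S.endpointCorrection I c = 0 := by
  classical
  rw [endpointCorrection]
  exact Finset.sum_eq_zero fun a ha => if_neg (hc a ha)

theorem Valid.notMem_cls (h : S.Valid) (hI : I ⊆ S.live) {c w : Copy V} (hw : w ∈ S.live)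
    (hwI : w ∉ I) (hc : c ∈ S.cls w) : ∀ a ∈ I, c ∉ S.cls a := by
  intro a ha hca
  exact hwI (h.disj a (hI ha) w hw c hca hc ▸ ha)

/-! #### Type II -/

theorem Valid.twins_of_isTypeII (h : S.Valid) (hI : S.IsTypeII I) : h.net.Twins I 1 where
  subset := hI.1
  twin a ha b hb x hxa hxb := by
    have := Set.ext_iff.1 (hI.2 a ha b hb) x
    rw [Set.mem_insert_iff, Set.mem_insert_iff, or_iff_right hxa, or_iff_right hxb] at this
    exact this
  dist a ha b hb hab := by
    have : b ∈ insert a (S.graph.neighborSet a) := by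
      rw [hI.2 a ha b hb]; exact Set.mem_insert _ _
    exact SimpleGraph.dist_eq_one_iff_adj.2 (this.resolve_left (Ne.symm hab))
  pos := one_ne_zero

theorem Valid.finalScore_typeII (h : S.Valid) (hv : v ∈ I) (hI : S.IsTypeII I) (c : Copy V) :
    (S.mergeInto I v (S.endpointCorrection I)).finalScore c = S.finalScore c := by
  classical
  have hT := h.twins_of_isTypeII hI
  refine h.finalScore_mergeInto hv hT (fun hc => ?_) (fun w hw hc => ?_) fun w hw hwI hc => ?_
  · exact endpointCorrection_of_notMem fun a ha => hc a (hI.1 ha)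
  · rw [h.endpointCorrection_of_mem hI.1 hw hc]
  · rw [endpointCorrection_of_notMem (h.notMem_cls hI.1 hw hwI hc)]
    symm
    refine Finset.sum_eq_zero fun a ha => Finset.sum_eq_zero fun b hb => ?_
    suffices h.net.frac a w b = 0 by rw [this, mul_zero]
    -- Adjacent vertices leave no room for a third vertex on a shortest path.
    by_contra h0
    obtain ⟨h1, h2, h3⟩ := h.net.reachable_of_frac_ne_zero h0
    obtain ⟨hba, hb⟩ := Finset.mem_erase.1 hb
    have h4 := hT.dist a ha b hb hba.symm
    have h5 := h1.pos_dist_of_ne (by rintro rfl; exact hwI ha)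
    have h6 := h2.pos_dist_of_ne (by rintro rfl; exact hwI hb)
    omega

/-! #### Type I -/

theorem IsTypeI.adj_iff (hI : S.IsTypeI I) {a b : Copy V} (ha : a ∈ I) (hb : b ∈ I)
    (x : Copy V) : S.graph.Adj a x ↔ S.graph.Adj b x := by
  rw [← SimpleGraph.mem_neighborSet, (hI.2 a ha b hb).2, SimpleGraph.mem_neighborSet]

theorem IsTypeI.not_adj (hI : S.IsTypeI I) {a b : Copy V} (ha : a ∈ I) (hb : b ∈ I) :
    ¬ S.graph.Adj a b := fun hab => ((hI.adj_iff ha hb b).1 hab).ne rfl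

/-- A neighbour of one twin is a neighbour of all, which gives distance `2`. Reachability excludes
isolated vertices, whose neighbour sets agree trivially. -/
theorem Valid.twins_of_isTypeI (h : S.Valid) (hI : S.IsTypeI I) : h.net.Twins I 2 where
  subset := hI.1
  twin a ha b hb x _ _ := hI.adj_iff ha hb x
  dist a ha b hb hab := by
    have hr := (hI.2 a ha b hb).1
    obtain ⟨x, hx, hax, hd⟩ := Net.exists_pred hr hab
    have h1 := SimpleGraph.dist_eq_one_iff_adj.2 ((hI.adj_iff hb ha x).1 hx.symm)
    change S.graph.dist a b = 2
    omega
  pos := two_ne_zero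

open Classical in
theorem _root_.BCNet.Net.shp_of_adj {α : Type*} (N : Net α) {a w : α} (h : N.graph.Adj a w) :
    N.shp a w = N.mult a * N.mult w := by
  rw [N.shp_eq_sum_preds h.ne]
  have : (N.verts.filter fun v => N.graph.Adj v w ∧
      N.graph.dist a w = N.graph.dist a v + 1) = {a} := by
    ext v
    rw [Finset.mem_filter, Finset.mem_singleton, SimpleGraph.dist_eq_one_iff_adj.2 h]
    constructor
    · rintro ⟨-, h1, h2⟩
      have : N.graph.Reachable a v := h.reachable.trans h1.symm.reachable
      exact ((this.dist_eq_zero_iff).1 (by omega)).symm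
    · rintro rfl
      exact ⟨N.adj_mem _ _ h, h, by simp⟩
  rw [this, Finset.sum_singleton, Net.shp_self, mul_comm]

open Classical in
/-- Between two vertices at distance two, the paths pass through the common neighbours. -/
theorem Valid.frac_of_isTypeI (h : S.Valid) (hI : S.IsTypeI I) (hv : v ∈ I) {a b w : Copy V}
    (ha : a ∈ I) (hb : b ∈ I) (hab : a ≠ b) (hwI : w ∉ I) : h.net.frac a w b =
    if S.graph.Adj v w then
      1 / ∑ y ∈ S.live with S.graph.Adj v y, (S.ident y : ℚ) else 0 := by
  have hT := h.twins_of_isTypeI hI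
  have hd : h.net.graph.dist a b = 2 := hT.dist a ha b hb hab
  split_ifs with hvw
  · have haw : h.net.graph.Adj a w := (hI.adj_iff hv ha w).1 hvw
    have hwb : h.net.graph.Adj w b := ((hI.adj_iff hv hb w).1 hvw).symm
    have h1 := SimpleGraph.dist_eq_one_iff_adj.2 haw
    have h2 := SimpleGraph.dist_eq_one_iff_adj.2 hwb
    have e : h.net.shp a b = h.net.mult b * (h.net.mult a *
        ∑ y ∈ S.live with S.graph.Adj v y, (S.ident y : ℚ)) := by
      rw [h.net.shp_eq_sum_preds hab]
      congr 1
      rw [Finset.mul_sum]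
      refine Finset.sum_congr ?_ fun y hy => ?_
      -- Every common neighbour is at distance `1` from `a`, so all of them precede `b`.
      · ext y
        rw [Finset.mem_filter, Finset.mem_filter, hd]
        constructor
        · rintro ⟨h3, h4, -⟩
          exact ⟨h3, (hI.adj_iff hb hv y).1 h4.symm⟩
        · rintro ⟨h3, h4⟩
          refine ⟨h3, ((hI.adj_iff hv hb y).1 h4).symm, ?_⟩
          rw [SimpleGraph.dist_eq_one_iff_adj.2 (show h.net.graph.Adj a y from
            (hI.adj_iff hv ha y).1 h4)]
      · exact h.net.shp_of_adj ((hI.adj_iff hv ha y).1 (Finset.mem_filter.1 hy).2)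
    unfold Net.frac
    rw [if_pos (by omega), h.net.shp_of_adj haw, h.net.shp_of_adj hwb, e]
    have m1 := (h.net.mult_pos a (hI.1 ha)).ne'
    have m2 := (h.net.mult_pos b (hI.1 hb)).ne'
    have m3 := (h.net.mult_pos w (h.net.adj_mem' haw)).ne'
    have m4 : (∑ y ∈ S.live with S.graph.Adj v y, (S.ident y : ℚ)) ≠ 0 := by
      intro h0
      rw [h0, mul_zero, mul_zero] at e
      exact (h.net.shp_pos (hI.1 ha) (haw.reachable.trans hwb.reachable)).ne' e
    field_simp
  · by_contra h0
    obtain ⟨h1, h2, h3⟩ := h.net.reachable_of_frac_ne_zero h0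
    have h4 := h1.pos_dist_of_ne (by rintro rfl; exact hwI ha)
    have h5 := h2.pos_dist_of_ne (by rintro rfl; exact hwI hb)
    have h6 : h.net.graph.dist a w = 1 := by omega
    exact hvw ((hI.adj_iff ha hv w).1 (SimpleGraph.dist_eq_one_iff_adj.1 h6))

theorem Valid.finalScore_typeI (h : S.Valid) (hv : v ∈ I) (hI : S.IsTypeI I) (c : Copy V) :
    (S.mergeInto I v (fun c => S.endpointCorrection I c +
      S.neighbourCorrection I v c)).finalScore c = S.finalScore c := by
  classical
  have hT := h.twins_of_isTypeI hI
  refine h.finalScore_mergeInto hv hT (fun hc => ?_) (fun w hw hc => ?_) fun w hw hwI hc => ?_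
  · rw [endpointCorrection_of_notMem fun a ha => hc a (hI.1 ha), neighbourCorrection,
      Finset.sum_eq_zero, add_zero]
    exact fun x hx => if_neg (hc x (Finset.mem_filter.1 hx).1)
  -- Type-I twins are not adjacent, so no copy in `I` shares in the distributed amount.
  · have : S.neighbourCorrection I v c = 0 := by
      rw [neighbourCorrection]
      refine Finset.sum_eq_zero fun x hx => if_neg fun hcx => hI.not_adj hv hw ?_
      obtain ⟨h1, h2⟩ := Finset.mem_filter.1 hx
      rwa [h.disj x h1 w (hI.1 hw) c hcx hc] at h2
    rw [h.endpointCorrection_of_mem hI.1 hw hc, this, add_zero]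
  · rw [endpointCorrection_of_notMem (h.notMem_cls hI.1 hw hwI hc), zero_add]
    have e1 : ∑ a ∈ I, ∑ b ∈ I.erase a, S.weight a * S.weight b * h.net.frac a w b =
        S.pairWeight I * if S.graph.Adj v w then
          1 / ∑ y ∈ S.live with S.graph.Adj v y, (S.ident y : ℚ) else 0 := by
      rw [pairWeight, Finset.sum_mul]
      refine Finset.sum_congr rfl fun a ha => ?_
      rw [Finset.sum_mul]
      refine Finset.sum_congr (by congr!) fun b hb => ?_
      obtain ⟨hba, hb⟩ := Finset.mem_erase.1 hb
      rw [h.frac_of_isTypeI hI hv ha hb hba.symm hwI]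
    rw [e1, neighbourCorrection]
    split_ifs with hvw
    · rw [Finset.sum_eq_single w, if_pos hc, mul_one_div]
      · intro x hx hxw
        exact if_neg fun hcx => hxw (h.disj x (Finset.mem_filter.1 hx).1 w hw c hcx hc)
      · exact fun h' => absurd (Finset.mem_filter.2 ⟨hw, hvw⟩) h'
    · rw [mul_zero]
      refine Finset.sum_eq_zero fun x hx => if_neg fun hcx => hvw ?_
      obtain ⟨h1, h2⟩ := Finset.mem_filter.1 hx
      rwa [h.disj x h1 w hw c hcx hc] at h2

end State

/-! ### The invariance of the total scores -/

open State

/-- All operations but shattering at an articulation vertex keep the set of copies and preserve the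
final score of every single copy. -/
theorem Step.valid_and_totalScore {V : Type*} {S S' : State V} (hstep : Step S S')
    (h : S.Valid) : S'.Valid ∧ ∀ v, S'.totalScore v = S.totalScore v := by
  have key : ∀ {S' : State V}, S'.copies = S.copies →
      (∀ c, S'.finalScore c = S.finalScore c) → ∀ v, S'.totalScore v = S.totalScore v := by
    intro S' hc hF v
    rw [State.totalScore, State.totalScore, hc]
    exact Finset.sum_congr rfl fun c _ => hF c
  cases hstep with
  | articulation _ u cp hu hs => exact ⟨hs.valid h hu.1, hs.totalScore h hu.1⟩
  | bridge u v hadj hb =>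
    exact ⟨h.removeBridge u v, key rfl (h.finalScore_removeBridge hadj hb)⟩
  | degreeOne u v hu =>
    exact ⟨h.removeDegreeOne u v, key rfl (h.finalScore_removeDegreeOne hu)⟩
  | sideVertex u hu hc => exact ⟨h.removeSide u, key rfl (h.finalScore_removeSide hu hc)⟩
  | typeI I v hv hI =>
    exact ⟨h.mergeInto hv hI.1 _, key rfl (h.finalScore_typeI hv hI)⟩
  | typeII I v hv hI =>
    exact ⟨h.mergeInto hv hI.1 _, key rfl (h.finalScore_typeII hv hI)⟩

end BCNet

theorem mainTheorem5 {V : Type*} [Fintype V] (G : SimpleGraph V) (S : BCNet.State V)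
    (hS : BCNet.Preprocessed G S) (v : V) :
    BCNet.bc G v = S.totalScore v := by
  -- Validity is carried along, since each invariance step relies on it.
  suffices S.Valid ∧ S.totalScore v = BCNet.bc G v from this.2.symm
  induction hS with
  | refl => exact ⟨BCNet.init_valid G, BCNet.totalScore_init G v⟩
  | tail _ hstep ih =>
    obtain ⟨h1, h2⟩ := hstep.valid_and_totalScore ih.1
    exact ⟨h1, (h2 v).trans ih.2⟩
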